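/- Let $F_0$ be a non-archimedean local field of odd residual characteristic and $F/F_0$ the unramified quadratic extension, with Galois conjugation $x\mapsto\bar x$. Let $\varpi$ be a common uniformizer of $F_0$ and $F$, let $\mathfrak o_F,\mathfrak p_F$ be the ring of integers of $F$ and its maximal ideal, and let $\Omega$ be an additive character of $F_0$ with conductor $\mathfrak p_0$, the maximal ideal of $\mathfrak o_0$ (trivial on $\mathfrak p_0$, not on $\mathfrak o_0$). Put $V=F^4$ with standard basis $e_1,\dots,e_4$, $A=M_4(F)$, $H=E_{14}+E_{23}+E_{32}+E_{41}$, $\sigma(X)=H^{-1}\,{}^t\overline X H$, and $G=U(2,2)=\{g\in GL_4(F)\mid g\sigma(g)=1\}$. Let $N_0=\mathfrak o_Fe_1\oplus\mathfrak o_Fe_2\oplus\mathfrak o_Fe_3\oplus\mathfrak o_Fe_4$, $N_2=\mathfrak o_Fe_1\oplus\mathfrak o_Fe_2\oplus\mathfrak p_Fe_3\oplus\mathfrak p_Fe_4$, and let $\Lambda$ be the lattice sequence $\Lambda(2i)=\varpi^iN_0$, $\Lambda(2i+1)=\varpi^iN_2$ ($i\in\mathbf Z$). For $k\in\mathbf Z$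 put $\mathfrak a_k=\{X\in A\mid X\Lambda(i)\subset\Lambda(i+k)\text{ for all }i\}$; let $P_{\Lambda,0}=G\cap\mathfrak a_0$ and $P_{\Lambda,k}=G\cap(1+\mathfrak a_k)$ for $k\ge1$. Let $m\ge1$ be an integer, $n=2m-1$, let $\lambda\in\mathfrak o_F$ satisfy $\lambda\not\equiv\bar\lambda\pmod{\mathfrak p_F}$, and put $$\beta=\varpi^{-m}\begin{pmatrix}0&0&1&0\\0&0&0&-1\\ \varpi\lambda&0&0&0\\0&-\varpi\bar\lambda&0&0\end{pmatrix}.$$ Let $B$ be the centralizer of $\beta$ in $A$, $B^\perp$ its orthogonal complement for the pairing $(X,Y)\mapsto\mathrm{tr}(XY)$, $\mathfrak J=(\mathfrak a_n\cap B)\oplus(\mathfrak a_{[n/2]+1}\cap B^\perp)$, $J=(1+\mathfrak J)\cap G$, and let $\Psi$ be the character $\Psi(x)=\Omega(\mathrm{tr}_{F/F_0}\mathrm{tr}(\beta(x-1)))$ of $J$. Put $G'=G\cap B$, $J'=J\cap G'$, $\Psi'=\Psi|_{J'}$, $B'=G'\cap P_{\Lambda,0}$ and $$\zeta=\begin{pmatrix}0&0&\varpi^{-1}\lambda^{-1}&0\\0&0&0&1\\1&0&0&0\\0&\varpi\bar\lambda&0&0\end{pmatrix}.$$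 For a compact open subgroup $K$ of a unimodular, locally compact, totally disconnected group $\mathcal G$ and a unitary character $\chi$ of $K$, let $\mathcal H(\mathcal G//K,\chi)$ be the algebra of compactly supported $f:\mathcal G\to\mathbf C$ with $f(kgk')=\chi(k)^{-1}f(g)\chi(k')^{-1}$ for $k,k'\in K$, $g\in\mathcal G$, under convolution for the Haar measure giving $K$ volume $1$, with the involution $f^*(g)=\overline{f(g^{-1})}$. Then: 1. The characteristic polynomial of $y_\beta=\varpi^n\beta^2$ is $(X-\lambda)^2(X-\bar\lambda)^2$; hence that of the stratum $[\Lambda,n,n-1,\beta]$ is its reduction modulo $\mathfrak p_F$. 2. The group $G'$ is abelian and not compact, $\zeta\in G$, and $G'=\langle\zeta\rangle B'$. 3. There is a $*$-isomorphism of algebras $\eta:\mathcal H(G'//J',\Psi')\simeq\mathcal H(G//J,\Psi)$ which preserves support: $\mathrm{supp}(\eta(f))=J\,\mathrm{supp}(f)\,J$ for all $f\in\mathcal H(G'//J',\Psi')$. 4. No irreducible smooth complex representation $\pi$ of $G$ which contains the stratum $[\Lambda,n,n-1,\beta]$ is supercuspidal. Here $\pi$ contains the stratum if the restriction of $\pi$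 to $P_{\Lambda,n}$ contains the character $p\mapsto\Omega(\mathrm{tr}_{F/F_0}\mathrm{tr}(\beta(p-1)))$, and $\pi$ is supercuspidal if all its matrix coefficients $g\mapsto\xi(\pi(g)w)$ ($w$ a vector of $\pi$, $\xi$ in the contragredient) are compactly supported modulo the centre of $G$. -/

import Mathlib

open MeasureTheory Matrix ValuativeRel
open scoped Pointwise

set_option linter.unusedSectionVars false
set_option linter.style.haveILetI false

noncomputable section

namespace HeckeTheory

section Hecke

variable {G : Type*} [Group G] [TopologicalSpace G] [IsTopologicalGroup G] [LocallyCompactSpace G]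

/-- Haar measure on the Borel sets of `G`, normalised so that `J` has volume `1`. -/
def haarNormalized (J : Subgroup G) : @Measure G (borel G) :=
  letI : MeasurableSpace G := borel G
  haveI : BorelSpace G := ⟨rfl⟩
  ((Measure.haar : Measure G) (J : Set G))⁻¹ • (Measure.haar : Measure G)

/-- Convolution of complex functions on `G` for the Haar measure giving `J` volume `1`. -/
def convolution (J : Subgroup G) (f₁ f₂ : G → ℂ) : G → ℂ := fun x =>
  letI : MeasurableSpace G := borel G
  ∫ y, f₁ y * f₂ (y⁻¹ * x) ∂(haarNormalized J)

/-- The Hecke algebra `ℋ(G//J, χ)` of a unitary character `χ` of `J`: compactly supported functions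
`f : G → ℂ` with `f(kgk') = χ̃(k) f(g) χ̃(k')` for `k, k' ∈ J`, where `χ̃ = χ⁻¹` is the
contragredient of `χ`. -/
def HeckeAlgebra (J : Subgroup G) (χ : J →* Circle) : Submodule ℂ (G → ℂ) where
  carrier := {f | HasCompactSupport f ∧
    ∀ (k k' : J) (g : G), f (k * g * k') = ((χ k)⁻¹ : Circle) * f g * ((χ k')⁻¹ : Circle)}
  zero_mem' := ⟨HasCompactSupport.zero, fun _ _ _ => by simp⟩
  add_mem' := by
    rintro f₁ f₂ ⟨h₁, e₁⟩ ⟨h₂, e₂⟩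
    refine ⟨h₁.add h₂, fun k k' g => ?_⟩
    simp only [Pi.add_apply, e₁, e₂]
    ring
  smul_mem' := by
    rintro c f ⟨h, e⟩
    refine ⟨h.smul_left (f := fun _ => c), fun k k' g => ?_⟩
    simp only [Pi.smul_apply, e, smul_eq_mul]
    ring

theorem convolution_mem (J : Subgroup G) (χ : J →* Circle) {f₁ f₂ : G → ℂ}
    (h₁ : f₁ ∈ HeckeAlgebra J χ) (h₂ : f₂ ∈ HeckeAlgebra J χ) :
    convolution J f₁ f₂ ∈ HeckeAlgebra J χ := by
  obtain ⟨c₁, e₁⟩ := h₁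
  obtain ⟨c₂, e₂⟩ := h₂
  refine ⟨?_, fun k k' x => ?_⟩
  · refine HasCompactSupport.of_support_subset_isCompact (c₁.isCompact.mul c₂.isCompact) ?_
    intro x hx
    by_contra hx'
    refine hx ?_
    unfold convolution
    refine (integral_congr_ae (Filter.Eventually.of_forall fun y => ?_)).trans
      (integral_zero _ _)
    by_contra hne
    have hne' : f₁ y * f₂ (y⁻¹ * x) ≠ 0 := hne
    refine hx' ⟨y, subset_tsupport _ (left_ne_zero_of_mul hne'), y⁻¹ * x,
      subset_tsupport _ (right_ne_zero_of_mul hne'), by simp⟩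
  · letI : MeasurableSpace G := borel G
    haveI : BorelSpace G := ⟨rfl⟩
    haveI : (haarNormalized J).IsMulLeftInvariant := by
      unfold haarNormalized; infer_instance
    have key := integral_mul_left_eq_self (μ := haarNormalized J)
      (fun y => f₁ y * f₂ (y⁻¹ * (k * x * k'))) (k : G)
    unfold convolution
    rw [← key, ← integral_const_mul, ← integral_mul_const]
    congr 1
    ext y
    have a := e₁ k 1 y
    have b := e₂ 1 k' (y⁻¹ * x)
    simp only [OneMemClass.coe_one, mul_one, one_mul, map_one, inv_one, Circle.coe_one] at a b
    rw [a, show ((k : G) * y)⁻¹ * (k * x * k') = y⁻¹ * x * k' by group, b]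
    ring

/-- The product of the Hecke algebra is convolution. -/
instance (J : Subgroup G) (χ : J →* Circle) : Mul (HeckeAlgebra J χ) :=
  ⟨fun f₁ f₂ => ⟨convolution J f₁ f₂, convolution_mem J χ f₁.2 f₂.2⟩⟩

theorem involution_mem (J : Subgroup G) (χ : J →* Circle) {f : G → ℂ}
    (h : f ∈ HeckeAlgebra J χ) :
    (fun g => starRingEnd ℂ (f g⁻¹)) ∈ HeckeAlgebra J χ := by
  obtain ⟨c, e⟩ := h
  refine ⟨?_, fun k k' g => ?_⟩
  · have := c.comp_homeomorph (Homeomorph.inv G)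
    exact this.comp_left (g := starRingEnd ℂ) (map_zero _)
  · have := e k'⁻¹ k⁻¹ g⁻¹
    simp only [map_inv, inv_inv, InvMemClass.coe_inv] at this
    change starRingEnd ℂ (f ((k : G) * g * k')⁻¹) =
      ((χ k)⁻¹ : Circle) * starRingEnd ℂ (f g⁻¹) * ((χ k')⁻¹ : Circle)
    rw [show ((k : G) * g * k')⁻¹ = (k' : G)⁻¹ * g⁻¹ * (k : G)⁻¹ by group, this]
    simp only [map_mul, ← Circle.coe_inv_eq_conj]
    ring

/-- The involution `f^*(g) = conj (f(g⁻¹))` of the Hecke algebra. -/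
instance (J : Subgroup G) (χ : J →* Circle) : Star (HeckeAlgebra J χ) :=
  ⟨fun f => ⟨fun g => starRingEnd ℂ (f.1 g⁻¹), involution_mem J χ f.2⟩⟩

end Hecke

section Reps

variable {G : Type*} [Group G] [TopologicalSpace G] {W : Type*} [AddCommGroup W] [Module ℂ W]

/-- Smooth representations: every vector is fixed by an open subgroup. -/
def IsSmoothRep (π : Representation ℂ G W) : Prop :=
  ∀ w : W, ∃ U : Subgroup G, IsOpen (U : Set G) ∧ ∀ u ∈ U, π u w = w

/-- Smooth linear functionals, the elements of the contragredient representation. -/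
def IsSmoothFunctional (π : Representation ℂ G W) (ξ : Module.Dual ℂ W) : Prop :=
  ∃ U : Subgroup G, IsOpen (U : Set G) ∧ ∀ u ∈ U, ∀ w : W, ξ (π u w) = ξ w

/-- Supercuspidal representations: irreducible smooth representations all of whose matrix
coefficients `g ↦ ξ(π(g)w)` (`ξ` in the contragredient) are compactly supported modulo the
centre. -/
def IsSupercuspidal (π : Representation ℂ G W) : Prop :=
  π.IsIrreducible ∧ IsSmoothRep π ∧
    ∀ (w : W) (ξ : Module.Dual ℂ W), IsSmoothFunctional π ξ →
      ∃ K : Set G, IsCompact K ∧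
        ∀ g : G, ξ (π g w) ≠ 0 → g ∈ K * (Subgroup.center G : Set G)

end Reps

end HeckeTheory

/-- `ϖ` generates the maximal ideal of the valuation ring of `K`. -/
def IsUnif (K : Type*) [Field K] [ValuativeRel K] (ϖ : K) : Prop :=
  ∀ x : K, valuation K x < 1 ↔ valuation K x ≤ valuation K ϖ

/-- The standing data: `F₀` a non-archimedean local field of odd residual characteristic, `F / F₀`
its unramified quadratic extension, with Galois conjugation `conj`, and a common uniformiser `unif`
of `F₀` and `F` (its existence says that the quadratic extension `F / F₀` is unramified). -/
structure UnramifiedQuadratic (F₀ F : Type*) [Field F₀] [ValuativeRel F₀] [TopologicalSpace F₀]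
    [IsNonarchimedeanLocalField F₀] [Field F] [ValuativeRel F] [TopologicalSpace F]
    [IsNonarchimedeanLocalField F] [Algebra F₀ F] [ValuativeExtension F₀ F] where
  residueChar_ne_two : ringChar 𝓀[F₀] ≠ 2
  finrank_eq_two : Module.finrank F₀ F = 2
  conj : F ≃ₐ[F₀] F
  conj_ne_refl : conj ≠ AlgEquiv.refl
  unif : F₀
  unif_base : IsUnif F₀ unif
  unif_top : IsUnif F (algebraMap F₀ F unif)

namespace UnramifiedQuadratic

variable {F₀ F : Type*} [Field F₀] [ValuativeRel F₀] [TopologicalSpace F₀]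
    [IsNonarchimedeanLocalField F₀] [Field F] [ValuativeRel F] [TopologicalSpace F]
    [IsNonarchimedeanLocalField F] [Algebra F₀ F] [ValuativeExtension F₀ F]

theorem val_le_iff (x y : F₀) :
    valuation F (algebraMap F₀ F x) ≤ valuation F (algebraMap F₀ F y) ↔
      valuation F₀ x ≤ valuation F₀ y := by
  rw [← Valuation.Compatible.vle_iff_le, ← Valuation.Compatible.vle_iff_le,
    ValuativeExtension.vle_iff_vle]

theorem val_le_one_iff (x : F₀) :
    valuation F (algebraMap F₀ F x) ≤ 1 ↔ valuation F₀ x ≤ 1 := by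
  simpa using val_le_iff (F := F) x 1

theorem val_lt_one_iff (x : F₀) :
    valuation F (algebraMap F₀ F x) < 1 ↔ valuation F₀ x < 1 := by
  have := val_le_iff (F := F) 1 x
  rw [← not_le, ← not_le, not_iff_not]; simpa using this


theorem aut_eq (D : UnramifiedQuadratic F₀ F) (g : F ≃ₐ[F₀] F) : g = 1 ∨ g = D.conj := by
  classical
  haveI : FiniteDimensional F₀ F := Module.finite_of_finrank_pos (by rw [D.finrank_eq_two]; simp)
  by_contra h
  push Not at h
  have hc : Fintype.card (F ≃ₐ[F₀] F) ≤ 2 := D.finrank_eq_two ▸ AlgEquiv.card_le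
  have : ({1, D.conj, g} : Finset (F ≃ₐ[F₀] F)).card = 3 := by
    rw [Finset.card_eq_three]
    exact ⟨1, D.conj, g, fun e => D.conj_ne_refl e.symm, fun e => h.1 e.symm,
      fun e => h.2 e.symm, rfl⟩
  have := Finset.card_le_univ ({1, D.conj, g} : Finset (F ≃ₐ[F₀] F))
  omega

theorem finiteDimensional (D : UnramifiedQuadratic F₀ F) : FiniteDimensional F₀ F :=
  Module.finite_of_finrank_pos (by rw [D.finrank_eq_two]; simp)

theorem isGalois (D : UnramifiedQuadratic F₀ F) : IsGalois F₀ F := by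
  classical
  haveI := D.finiteDimensional
  apply IsGalois.of_card_aut_eq_finrank
  rw [D.finrank_eq_two]
  have hc : Fintype.card (F ≃ₐ[F₀] F) ≤ 2 := D.finrank_eq_two ▸ AlgEquiv.card_le
  have : ({1, D.conj} : Finset (F ≃ₐ[F₀] F)).card = 2 :=
    Finset.card_pair (fun e => D.conj_ne_refl e.symm)
  have := Finset.card_le_univ ({1, D.conj} : Finset (F ≃ₐ[F₀] F))
  rw [Nat.card_eq_fintype_card]
  omega

theorem trace_eq (D : UnramifiedQuadratic F₀ F) (x : F) : algebraMap F₀ F (Algebra.trace F₀ F x) = x + D.conj x := by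
  classical
  haveI := D.finiteDimensional
  haveI := D.isGalois
  rw [trace_eq_sum_automorphisms]
  have : (Finset.univ : Finset (F ≃ₐ[F₀] F)) = {1, D.conj} := by
    ext g; simpa using D.aut_eq g
  have hne : (1 : F ≃ₐ[F₀] F) ≠ D.conj := fun e => D.conj_ne_refl e.symm
  rw [this, Finset.sum_pair hne]
  rfl

theorem conj_conj (D : UnramifiedQuadratic F₀ F) (x : F) : D.conj (D.conj x) = x := by
  rcases D.aut_eq (D.conj * D.conj) with h | h
  · exact DFunLike.congr_fun h x
  · exact absurd (mul_eq_left.mp h) D.conj_ne_refl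

theorem mem_base (D : UnramifiedQuadratic F₀ F) {x : F} (h : D.conj x = x) : ∃ a : F₀, algebraMap F₀ F a = x := by
  haveI := D.finiteDimensional
  haveI := D.isGalois
  refine (IsGalois.mem_range_algebraMap_iff_fixed x).mpr fun g => ?_
  rcases D.aut_eq g with rfl | rfl
  · rfl
  · exact h

theorem conj_val_le_one (D : UnramifiedQuadratic F₀ F) {x : F} (hx : valuation F x ≤ 1) : valuation F (D.conj x) ≤ 1 := by
  by_contra hlt
  rw [not_le] at hlt
  set v := valuation F with hv
  set τ := D.conj with hτ
  have hT : v (x + τ x) = v (τ x) := add_comm (τ x) x ▸ Valuation.map_add_eq_of_lt_left _ (hx.trans_lt hlt)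
  have hT0 : x + τ x ≠ 0 := by
    intro h; rw [h, map_zero] at hT; rw [← hT] at hlt; simp at hlt
  set y := τ x / (x + τ x) with hy
  have hy1 : 1 - y = x / (x + τ x) := by rw [hy]; field_simp; ring
  have hτy : τ y = 1 - y := by
    rw [hy1, hy, map_div₀, map_add, hτ, D.conj_conj, add_comm]
  have hvT0 : v (x + τ x) ≠ 0 := by simpa using hT0
  have h1 : v (1 - y) < 1 := by
    rw [hy1, map_div₀, hT]
    exact (div_lt_one₀ (zero_lt_one.trans hlt)).mpr (hx.trans_lt hlt)
  have h2 : v y = 1 := by rw [hy, map_div₀, hT, div_self (hT ▸ hvT0)]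
  obtain ⟨c, hc⟩ := D.mem_base (x := y * (1 - y)) (by
    rw [map_mul, map_sub, map_one, ← hτ, hτy]; ring)
  have hcv : valuation F₀ c < 1 := by
    rw [← val_lt_one_iff (F := F), hc, map_mul, ← hv, h2, one_mul]; exact h1
  letI := IsTopologicalAddGroup.rightUniformSpace F₀
  haveI := isUniformAddGroup_of_addCommGroup (G := F₀)
  let c' : 𝒪[F₀] := ⟨c, hcv.le⟩
  have hc' : c' ∈ 𝓂[F₀] := by
    rw [IsLocalRing.mem_maximalIdeal, mem_nonunits_iff]
    intro hu
    have := (Valuation.integer.integers (valuation F₀)).isUnit_iff_valuation_eq_one.mp hu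
    exact hcv.ne this
  obtain ⟨a, ha, -⟩ := HenselianRing.is_henselian (I := 𝓂[F₀])
    (Polynomial.X ^ 2 - Polynomial.X + Polynomial.C c' : Polynomial 𝒪[F₀])
    (by
      have : (Polynomial.X ^ 2 - Polynomial.X + Polynomial.C c' : Polynomial 𝒪[F₀]) =
        Polynomial.X ^ 2 + (Polynomial.C (-1) * Polynomial.X) + Polynomial.C c' := by
          simp; ring
      rw [this]; monicity!) 0
    (by simpa using hc')
    (by simp)
  have ha' : (a : F₀) ^ 2 - a + c = 0 := by
    have := congrArg (Subtype.val) (show _ = _ from ha)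
    simpa [c'] using this
  have hF : (algebraMap F₀ F a - y) * (algebraMap F₀ F a - (1 - y)) = 0 := by
    have := congrArg (algebraMap F₀ F) ha'
    rw [map_add, map_sub, map_pow, map_zero, hc] at this
    linear_combination this
  have hyy : y = 1 - y := by
    rcases mul_eq_zero.mp hF with h | h
    · have e : y = algebraMap F₀ F a := (sub_eq_zero.mp h).symm
      have : τ y = y := by rw [e, AlgEquiv.commutes]
      rw [← hτy, this]
    · have e : 1 - y = algebraMap F₀ F a := (sub_eq_zero.mp h).symm
      have : τ (1 - y) = 1 - y := by rw [e, AlgEquiv.commutes]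
      rw [map_sub, map_one, hτy] at this
      linear_combination this
  rw [hyy] at h2
  exact h1.ne h2

theorem conj_val_le_one_iff (D : UnramifiedQuadratic F₀ F) (x : F) : valuation F (D.conj x) ≤ 1 ↔ valuation F x ≤ 1 :=
  ⟨fun h => by simpa [D.conj_conj] using D.conj_val_le_one h, D.conj_val_le_one⟩

theorem conj_val (D : UnramifiedQuadratic F₀ F) (x : F) : valuation F (D.conj x) = valuation F x := by
  by_cases hx : x = 0
  · simp [hx]
  have hx' : valuation F x ≠ 0 := by simpa using hx
  have hx'' : valuation F (D.conj x) ≠ 0 := by simpa using hx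
  have key : ∀ y z : F, z ≠ 0 → valuation F y ≤ valuation F z →
      valuation F (D.conj y) ≤ valuation F (D.conj z) := by
    intro y z hz h
    have hz' : 0 < valuation F z := by simpa [zero_lt_iff] using hz
    have hz'' : 0 < valuation F (D.conj z) := by simpa [zero_lt_iff] using hz
    have := D.conj_val_le_one (x := y / z) (by rw [map_div₀]; exact (div_le_one₀ hz').mpr h)
    rw [map_div₀, map_div₀] at this
    exact (div_le_one₀ hz'').mp this
  rcases le_total (valuation F (D.conj x)) (valuation F x) with h | h
  · refine le_antisymm h ?_
    simpa [D.conj_conj] using key (D.conj x) x hx h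
  · refine le_antisymm ?_ h
    simpa [D.conj_conj] using key x (D.conj x) (by simpa using hx) h

theorem continuous_conj (D : UnramifiedQuadratic F₀ F) : Continuous D.conj := by
  refine continuous_of_continuousAt_zero D.conj.toRingEquiv.toAddEquiv.toAddMonoidHom ?_
  have hb := IsValuativeTopology.hasBasis_nhds_zero' F
  rw [ContinuousAt, map_zero]
  refine (hb.tendsto_iff hb).mpr fun γ hγ => ⟨γ, hγ, fun x hx => ?_⟩
  have : valuation F (D.conj x) < γ := by rw [D.conj_val]; exact hx
  exact this

end UnramifiedQuadratic

namespace UnramifiedQuadratic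

variable {F₀ F : Type*} [Field F₀] [ValuativeRel F₀] [TopologicalSpace F₀]
    [IsNonarchimedeanLocalField F₀] [Field F] [ValuativeRel F] [TopologicalSpace F]
    [IsNonarchimedeanLocalField F] [Algebra F₀ F] [ValuativeExtension F₀ F]

variable (D : UnramifiedQuadratic F₀ F)

/-- The uniformiser viewed in `F`. -/
def piF : F := algebraMap F₀ F D.unif

/-- The matrix `H = E₁₄ + E₂₃ + E₃₂ + E₄₁` of the hermitian form. -/
def gramMatrix (F : Type*) [Field F] : Matrix (Fin 4) (Fin 4) F :=
  !![0, 0, 0, 1; 0, 0, 1, 0; 0, 1, 0, 0; 1, 0, 0, 0]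

/-- The adjoint involution `σ(X) = H⁻¹ ᵗX̄ H`. -/
def adj (X : Matrix (Fin 4) (Fin 4) F) : Matrix (Fin 4) (Fin 4) F :=
  (gramMatrix F)⁻¹ * (X.map D.conj)ᵀ * gramMatrix F

theorem gram_mul_gram : gramMatrix F * gramMatrix F = 1 := by
  ext i j
  fin_cases i <;> fin_cases j <;> simp [gramMatrix, Matrix.mul_apply, Fin.sum_univ_four]

theorem gram_inv : (gramMatrix F)⁻¹ = gramMatrix F :=
  Matrix.inv_eq_left_inv gram_mul_gram

theorem adj_apply (X : Matrix (Fin 4) (Fin 4) F) (i j : Fin 4) :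
    D.adj X i j = D.conj (X (Fin.rev j) (Fin.rev i)) := by
  rw [adj, gram_inv, Matrix.mul_apply, Fin.sum_univ_four]
  simp only [Matrix.mul_apply, Fin.sum_univ_four, Matrix.transpose_apply, Matrix.map_apply]
  fin_cases i <;> fin_cases j <;> simp [gramMatrix, Fin.rev]

theorem adj_mul (X Y : Matrix (Fin 4) (Fin 4) F) : D.adj (X * Y) = D.adj Y * D.adj X := by
  ext i j
  simp only [adj_apply, Matrix.mul_apply, map_sum, map_mul]
  rw [← Equiv.sum_comp Fin.revPerm]
  exact Finset.sum_congr rfl fun k _ => by simp [mul_comm]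

theorem adj_adj (X : Matrix (Fin 4) (Fin 4) F) : D.adj (D.adj X) = X := by
  ext i j
  simp [adj_apply, D.conj_conj]

theorem adj_add (X Y : Matrix (Fin 4) (Fin 4) F) : D.adj (X + Y) = D.adj X + D.adj Y := by
  ext i j; simp [adj_apply]

theorem adj_neg (X : Matrix (Fin 4) (Fin 4) F) : D.adj (-X) = -D.adj X := by
  ext i j; simp [adj_apply]

theorem adj_one : D.adj (1 : Matrix (Fin 4) (Fin 4) F) = 1 := by
  ext i j
  simp [adj_apply, Matrix.one_apply, apply_ite D.conj, eq_comm]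

theorem trace_adj (X : Matrix (Fin 4) (Fin 4) F) : (D.adj X).trace = D.conj X.trace := by
  simp only [Matrix.trace, Matrix.diag_apply, adj_apply, map_sum]
  rw [← Equiv.sum_comp Fin.revPerm]
  simp

/-- The unramified unitary group `U(2,2) = {g ∈ GL₄(F) | g σ(g) = 1}`. -/
def unitaryGroup : Subgroup (GL (Fin 4) F) where
  carrier := {g | (g : Matrix (Fin 4) (Fin 4) F) * D.adj g = 1}
  one_mem' := by simp [adj_one]
  mul_mem' := by
    intro a b ha hb
    simp only [Set.mem_ofPred_eq, Units.val_mul, adj_mul] at *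
    rw [mul_assoc, ← mul_assoc _ (D.adj _) (D.adj _), hb, one_mul, ha]
  inv_mem' := by
    intro a ha
    simp only [Set.mem_ofPred_eq] at *
    have h1 : ((a⁻¹ : GL (Fin 4) F) : Matrix (Fin 4) (Fin 4) F) = D.adj a :=
      Units.inv_eq_of_mul_eq_one_right ha
    rw [h1, adj_adj]
    exact mul_eq_one_comm.mp ha

/-- The group `G = U(2,2)`, with the topology induced from `GL₄(F)`. -/
abbrev U22 : Type _ := D.unitaryGroup

/-- The underlying matrix of an element of `U(2,2)`. -/
def mat (g : D.U22) : Matrix (Fin 4) (Fin 4) F := ((g : GL (Fin 4) F) : Matrix (Fin 4) (Fin 4) F)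

theorem mat_one : D.mat 1 = 1 := rfl
theorem mat_mul (g h : D.U22) : D.mat (g * h) = D.mat g * D.mat h := rfl
theorem mat_inv (g : D.U22) : D.mat g⁻¹ = D.adj (D.mat g) :=
  Units.inv_eq_of_mul_eq_one_right g.2

theorem continuous_adj : Continuous D.adj := by
  refine continuous_matrix fun i j => ?_
  simp only [adj_apply]
  exact D.continuous_conj.comp (continuous_apply_apply _ _)

theorem t2Space_field (K : Type*) [Field K] [ValuativeRel K] [TopologicalSpace K]
    [IsNonarchimedeanLocalField K] : T2Space K := by
  letI := IsTopologicalAddGroup.rightUniformSpace K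
  haveI := isUniformAddGroup_of_addCommGroup (G := K)
  infer_instance

instance : T2Space D.U22 := by
  haveI := t2Space_field F
  infer_instance

theorem continuous_mat : Continuous D.mat :=
  Units.continuous_val.comp continuous_subtype_val

instance : LocallyCompactSpace D.U22 := by
  haveI := t2Space_field F
  haveI : LocallyCompactSpace (Matrix (Fin 4) (Fin 4) F) :=
    inferInstanceAs (LocallyCompactSpace (Fin 4 → Fin 4 → F))
  haveI : LocallyCompactSpace (Matrix (Fin 4) (Fin 4) F)ᵐᵒᵖ :=
    MulOpposite.opHomeomorph.symm.isClosedEmbedding.locallyCompactSpace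
  haveI : LocallyCompactSpace (GL (Fin 4) F) :=
    (Units.isClosedEmbedding_embedProduct (α := Matrix (Fin 4) (Fin 4) F)).locallyCompactSpace
  refine IsClosed.locallyCompactSpace (X := GL (Fin 4) F) ?_
  refine isClosed_eq ?_ continuous_const
  exact Units.continuous_val.mul (D.continuous_adj.comp Units.continuous_val)

/-! ### Lattices -/

/-- `N₀ = 𝔬e₁ ⊕ 𝔬e₂ ⊕ 𝔬e₃ ⊕ 𝔬e₄`. -/
def N₀ (F : Type*) [Field F] [ValuativeRel F] : Submodule 𝒪[F] (Fin 4 → F) where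
  carrier := {v | ∀ j, valuation F (v j) ≤ 1}
  zero_mem' := by simp
  add_mem' := fun ha hb j => Valuation.map_add_le _ (ha j) (hb j)
  smul_mem' := fun c v hv j => by
    change valuation F (c * v j) ≤ 1
    rw [map_mul]
    exact mul_le_one' c.2 (hv j)

/-- `N₂ = 𝔬e₁ ⊕ 𝔬e₂ ⊕ 𝔭e₃ ⊕ 𝔭e₄`. -/
def N₂ (F : Type*) [Field F] [ValuativeRel F] : Submodule 𝒪[F] (Fin 4 → F) where
  carrier := {v | (valuation F (v 0) ≤ 1 ∧ valuation F (v 1) ≤ 1) ∧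
    valuation F (v 2) < 1 ∧ valuation F (v 3) < 1}
  zero_mem' := by simp
  add_mem' := fun ha hb =>
    ⟨⟨Valuation.map_add_le _ ha.1.1 hb.1.1, Valuation.map_add_le _ ha.1.2 hb.1.2⟩,
      Valuation.map_add_lt _ ha.2.1 hb.2.1, Valuation.map_add_lt _ ha.2.2 hb.2.2⟩
  smul_mem' := fun c v hv => by
    have hc : ∀ j, (c • v) j = (c : F) * v j := fun _ => rfl
    simp only [Set.mem_ofPred_eq, hc, map_mul]
    exact ⟨⟨mul_le_one' c.2 hv.1.1, mul_le_one' c.2 hv.1.2⟩,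
      (mul_le_of_le_one_left' c.2).trans_lt hv.2.1, (mul_le_of_le_one_left' c.2).trans_lt hv.2.2⟩

/-- The lattice sequence `Λ(2i) = ϖⁱ N₀`, `Λ(2i+1) = ϖⁱ N₂`. -/
def latticeSeq (i : ℤ) : Submodule 𝒪[F] (Fin 4 → F) :=
  D.piF ^ (i / 2) • (if Even i then N₀ F else N₂ F)

/-- `𝔞_k(Λ) = {X | X Λ(i) ⊆ Λ(i+k) for all i}`. -/
def filtration (k : ℤ) : Submodule 𝒪[F] (Matrix (Fin 4) (Fin 4) F) where
  carrier := {X | ∀ i, ∀ v ∈ D.latticeSeq i, X *ᵥ v ∈ D.latticeSeq (i + k)}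
  zero_mem' := fun i v _ => by simp
  add_mem' := fun ha hb i v hv => by
    rw [Matrix.add_mulVec]; exact add_mem (ha i v hv) (hb i v hv)
  smul_mem' := fun c X hX i v hv => by
    rw [Matrix.smul_mulVec]; exact Submodule.smul_mem _ c (hX i v hv)

theorem unif_ne_zero : D.unif ≠ 0 := by
  intro h
  obtain ⟨x, h0, h1⟩ := Valuation.IsNontrivial.exists_lt_one (v := valuation F₀)
  have := (D.unif_base x).mp h1
  rw [h, map_zero] at this
  exact h0 (by simpa using this)

theorem piF_ne_zero : D.piF ≠ 0 := by
  simpa [piF] using D.unif_ne_zero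

theorem val_piF_lt_one : valuation F D.piF < 1 := (D.unif_top D.piF).mpr le_rfl

theorem val_piF_pos : 0 < valuation F D.piF := by
  simpa [zero_lt_iff] using D.piF_ne_zero

theorem conj_piF : D.conj D.piF = D.piF := by simp [piF]

/-- Weights of the four coordinates with respect to `Λ`. -/
def wt : Fin 4 → ℤ := ![1, 1, 0, 0]

theorem mem_smul_iff (t : ℤ) (L : Submodule 𝒪[F] (Fin 4 → F)) (v : Fin 4 → F) :
    v ∈ D.piF ^ t • L ↔ (D.piF ^ t)⁻¹ • v ∈ L := by
  have h0 : D.piF ^ t ≠ 0 := zpow_ne_zero _ D.piF_ne_zero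
  rw [Submodule.mem_smul_pointwise_iff_exists]
  constructor
  · rintro ⟨u, hu, rfl⟩
    rwa [smul_smul, inv_mul_cancel₀ h0, one_smul]
  · intro h
    exact ⟨_, h, by rw [smul_smul, mul_inv_cancel₀ h0, one_smul]⟩

theorem val_zpow_smul_le (t s : ℤ) (x : F) :
    valuation F ((D.piF ^ t)⁻¹ * x) ≤ valuation F D.piF ^ s ↔
      valuation F x ≤ valuation F D.piF ^ (s + t) := by
  have h0 : 0 < valuation F D.piF ^ t := zpow_pos D.val_piF_pos t
  rw [map_mul, map_inv₀, map_zpow₀, inv_mul_le_iff₀ h0, ← zpow_add₀ D.val_piF_pos.ne', add_comm]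

theorem mem_latticeSeq_iff (i : ℤ) (v : Fin 4 → F) :
    v ∈ D.latticeSeq i ↔ ∀ j, valuation F (v j) ≤ valuation F D.piF ^ ((i - wt j + 1) / 2) := by
  have key : ∀ x : F, valuation F ((D.piF ^ (i / 2))⁻¹ * x) ≤ 1 ↔
      valuation F x ≤ valuation F D.piF ^ (i / 2) := fun x => by
    simpa using D.val_zpow_smul_le (i / 2) 0 x
  have key' : ∀ x : F, valuation F ((D.piF ^ (i / 2))⁻¹ * x) < 1 ↔
      valuation F x ≤ valuation F D.piF ^ (i / 2 + 1) := fun x => by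
    rw [D.unif_top]
    simpa [add_comm, piF] using D.val_zpow_smul_le (i / 2) 1 x
  rw [latticeSeq, mem_smul_iff]
  split_ifs with h
  · have e2 : (i + 1) / 2 = i / 2 := by obtain ⟨r, hr⟩ := h; omega
    change (∀ j, valuation F ((D.piF ^ (i / 2))⁻¹ * v j) ≤ 1) ↔ _
    simp only [key, Fin.forall_fin_succ, wt]
    simp [e2]
  · have e2 : (i + 1) / 2 = i / 2 + 1 := by
      rw [Int.not_even_iff_odd] at h; obtain ⟨r, hr⟩ := h; omega
    change ((valuation F ((D.piF ^ (i / 2))⁻¹ * v 0) ≤ 1 ∧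
      valuation F ((D.piF ^ (i / 2))⁻¹ * v 1) ≤ 1) ∧
      valuation F ((D.piF ^ (i / 2))⁻¹ * v 2) < 1 ∧
      valuation F ((D.piF ^ (i / 2))⁻¹ * v 3) < 1) ↔ _
    simp only [key, key', Fin.forall_fin_succ, wt]
    simp [e2, and_assoc]

theorem val_zpow_anti {s t : ℤ} (h : s ≤ t) :
    valuation F D.piF ^ t ≤ valuation F D.piF ^ s :=
  zpow_le_zpow_right_of_le_one₀ D.val_piF_pos D.val_piF_lt_one.le h

theorem mem_filtration_iff (k : ℤ) (X : Matrix (Fin 4) (Fin 4) F) :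
    X ∈ D.filtration k ↔
      ∀ i j, valuation F (X i j) ≤ valuation F D.piF ^ ((k + wt j - wt i + 1) / 2) := by
  constructor
  · intro h a b
    have hb : Pi.single b 1 ∈ D.latticeSeq (wt b) := by
      rw [mem_latticeSeq_iff]
      intro j
      by_cases hj : j = b
      · subst hj; simp
      · simp [Pi.single_eq_of_ne hj]
    have := (D.mem_latticeSeq_iff _ _).mp (h _ _ hb) a
    simpa [add_comm] using this
  · intro h i v hv
    rw [mem_latticeSeq_iff] at hv ⊢
    intro a
    simp only [Matrix.mulVec, dotProduct]
    refine Valuation.map_sum_le _ fun b _ => ?_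
    rw [map_mul]
    refine (mul_le_mul' (h a b) (hv b)).trans ?_
    rw [← zpow_add₀ D.val_piF_pos.ne']
    exact D.val_zpow_anti (by omega)

theorem filtration_anti {k l : ℤ} (h : k ≤ l) : D.filtration l ≤ D.filtration k := by
  intro X hX
  rw [mem_filtration_iff] at *
  exact fun i j => (hX i j).trans (D.val_zpow_anti (by omega))

theorem filtration_mul {k l : ℤ} {X Y : Matrix (Fin 4) (Fin 4) F}
    (hX : X ∈ D.filtration k) (hY : Y ∈ D.filtration l) : X * Y ∈ D.filtration (k + l) := by
  intro i v hv
  rw [← Matrix.mulVec_mulVec, show i + (k + l) = i + l + k by ring]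
  exact hX _ _ (hY _ _ hv)

theorem wt_rev (j : Fin 4) : wt (Fin.rev j) = 1 - wt j := by
  fin_cases j <;> simp [wt, Fin.rev]

theorem adj_mem_filtration {k : ℤ} {X : Matrix (Fin 4) (Fin 4) F} (hX : X ∈ D.filtration k) :
    D.adj X ∈ D.filtration k := by
  rw [mem_filtration_iff] at *
  intro i j
  rw [adj_apply, D.conj_val]
  have := hX (Fin.rev j) (Fin.rev i)
  rwa [wt_rev, wt_rev, show k + (1 - wt i) - (1 - wt j) + 1 = k + wt j - wt i + 1 by ring] at this

end UnramifiedQuadratic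

namespace UnramifiedQuadratic

variable {F₀ F : Type*} [Field F₀] [ValuativeRel F₀] [TopologicalSpace F₀]
    [IsNonarchimedeanLocalField F₀] [Field F] [ValuativeRel F] [TopologicalSpace F]
    [IsNonarchimedeanLocalField F] [Algebra F₀ F] [ValuativeExtension F₀ F]

theorem val_two (D : UnramifiedQuadratic F₀ F) : valuation F (2 : F) = 1 := by
  have h : (2 : 𝓀[F₀]) ≠ 0 := Ring.two_ne_zero D.residueChar_ne_two
  have h1 : IsUnit (2 : 𝒪[F₀]) := by
    by_contra hu
    have : (2 : 𝒪[F₀]) ∈ 𝓂[F₀] := hu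
    rw [← IsLocalRing.residue_eq_zero_iff, map_ofNat] at this
    exact h this
  have h2 : valuation F₀ (2 : F₀) = 1 := by
    exact (Valuation.integer.integers (valuation F₀)).isUnit_iff_valuation_eq_one.mp h1
  have h3 : (2 : F) = algebraMap F₀ F 2 := (map_ofNat _ 2).symm
  rw [h3]
  refine le_antisymm ((val_le_one_iff _).mpr h2.le) ?_
  rw [← not_lt, val_lt_one_iff]
  exact not_lt.mpr h2.ge

/-- An additive character `Ω` of `F₀` with conductor `𝔭₀`, an integer `m ≥ 1` and an element
`lam ∈ 𝔬_F` with `lam ≢ conj lam` modulo `𝔭_F`. -/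
structure SplitStratum (D : UnramifiedQuadratic F₀ F) where
  Ω : AddChar F₀ Circle
  Ω_eq_one : ∀ x : F₀, valuation F₀ x < 1 → Ω x = 1
  Ω_ne_one : ∃ x : F₀, valuation F₀ x ≤ 1 ∧ Ω x ≠ 1
  m : ℕ
  m_pos : 0 < m
  lam : F
  lam_integral : valuation F lam ≤ 1
  lam_not_congr : ¬ valuation F (lam - D.conj lam) < 1

namespace SplitStratum

variable {D : UnramifiedQuadratic F₀ F} (S : D.SplitStratum)

/-- `n = 2m - 1`. -/
def n : ℤ := 2 * S.m - 1

/-- The element `β`. -/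
def beta : Matrix (Fin 4) (Fin 4) F :=
  D.piF ^ (-(S.m : ℤ)) •
    !![0, 0, 1, 0;
       0, 0, 0, -1;
       D.piF * S.lam, 0, 0, 0;
       0, -(D.piF * D.conj S.lam), 0, 0]

/-- The centralizer `B` of `β` in `A = M₄(F)`. -/
def B : Subalgebra F (Matrix (Fin 4) (Fin 4) F) := Subalgebra.centralizer F {S.beta}

/-- The orthogonal complement `B^⊥` of `B` for the trace pairing of `A`. -/
def Bperp : Submodule F (Matrix (Fin 4) (Fin 4) F) where
  carrier := {X | ∀ Y ∈ S.B, (X * Y).trace = 0}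
  zero_mem' := by simp
  add_mem' := fun ha hb Y hY => by rw [add_mul, trace_add, ha Y hY, hb Y hY, add_zero]
  smul_mem' := fun c X hX Y hY => by rw [smul_mul_assoc, trace_smul, hX Y hY, smul_zero]

/-- The lattice `𝔍 = (𝔞_n ∩ B) ⊕ (𝔞_{[n/2]+1} ∩ B^⊥)`. -/
def latJ : Submodule 𝒪[F] (Matrix (Fin 4) (Fin 4) F) :=
  (D.filtration S.n ⊓ (Subalgebra.toSubmodule S.B).restrictScalars 𝒪[F]) ⊔
    (D.filtration (S.n / 2 + 1) ⊓ S.Bperp.restrictScalars 𝒪[F])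

theorem mem_latJ_iff (Z : Matrix (Fin 4) (Fin 4) F) : Z ∈ S.latJ ↔
    ∃ X Y, X ∈ D.filtration S.n ∧ X ∈ S.B ∧ Y ∈ D.filtration (S.n / 2 + 1) ∧ Y ∈ S.Bperp ∧
      X + Y = Z := by
  rw [latJ, Submodule.mem_sup]
  constructor
  · rintro ⟨X, ⟨h1, h2⟩, Y, ⟨h3, h4⟩, e⟩
    exact ⟨X, Y, h1, h2, h3, h4, e⟩
  · rintro ⟨X, Y, h1, h2, h3, h4, e⟩
    exact ⟨X, ⟨h1, h2⟩, Y, ⟨h3, h4⟩, e⟩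

theorem half_n : S.n / 2 + 1 = S.m := by unfold n; omega

theorem mem_B {X : Matrix (Fin 4) (Fin 4) F} : X ∈ S.B ↔ S.beta * X = X * S.beta := by
  simp [B, Subalgebra.mem_centralizer_iff]

theorem val_lam_sub : valuation F (S.lam - D.conj S.lam) = 1 :=
  le_antisymm (Valuation.map_sub_le _ S.lam_integral (D.conj_val_le_one S.lam_integral))
    (not_lt.mp S.lam_not_congr)

theorem val_lam : valuation F S.lam = 1 := by
  refine le_antisymm S.lam_integral (not_lt.mp fun h => S.lam_not_congr ?_)
  exact Valuation.map_sub_lt _ h (by rwa [D.conj_val])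

theorem lam_ne_zero : S.lam ≠ 0 := by
  intro h; have := S.val_lam; simp [h] at this

theorem conj_lam_ne_zero : D.conj S.lam ≠ 0 := by
  simpa using S.lam_ne_zero

theorem lam_sub_ne_zero : S.lam - D.conj S.lam ≠ 0 := by
  intro h; have := S.val_lam_sub; simp [h] at this

theorem beta_mem : S.beta ∈ D.filtration (-S.n) := by
  rw [mem_filtration_iff]
  have h1 := S.val_lam
  have h2 : valuation F (D.conj S.lam) = 1 := by rw [D.conj_val, h1]
  have h0 := D.val_piF_pos.ne'
  obtain ⟨c, hc, hb⟩ : ∃ c : F, valuation F c = valuation F D.piF ^ (-(S.m : ℤ)) ∧ S.beta = c •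
      !![0, 0, 1, 0; 0, 0, 0, -1; D.piF * S.lam, 0, 0, 0;
        0, -(D.piF * D.conj S.lam), 0, 0] := ⟨_, map_zpow₀ _ _ _, rfl⟩
  intro i j
  rw [hb]
  fin_cases i <;> fin_cases j <;>
    simp only [Matrix.smul_apply, smul_eq_mul, map_mul, hc] <;>
    simp [wt, n, h1, h2, -_root_.zpow_neg, -zpow_natCast, Valuation.map_neg] <;>
    
    first
      | exact D.val_zpow_anti (by omega)
      | (rw [← zpow_add_one₀ h0]; exact D.val_zpow_anti (by omega))

theorem adj_beta : D.adj S.beta = -S.beta := by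
  ext i j
  rw [adj_apply]
  fin_cases i <;> fin_cases j <;>
    simp [beta, Fin.rev, D.conj_piF, D.conj_conj]

theorem adj_mem_B {X : Matrix (Fin 4) (Fin 4) F} (hX : X ∈ S.B) : D.adj X ∈ S.B := by
  rw [mem_B] at *
  have := congrArg D.adj hX
  rw [adj_mul, adj_mul, adj_beta] at this
  simpa using this.symm

theorem adj_mem_Bperp {X : Matrix (Fin 4) (Fin 4) F} (hX : X ∈ S.Bperp) : D.adj X ∈ S.Bperp := by
  intro Y hY
  have h : D.adj X * Y = D.adj (D.adj Y * X) := by rw [adj_mul, adj_adj]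
  rw [h, trace_adj, trace_mul_comm, hX _ (S.adj_mem_B hY), map_zero]

theorem adj_mem_latJ {X : Matrix (Fin 4) (Fin 4) F} (hX : X ∈ S.latJ) : D.adj X ∈ S.latJ := by
  rw [mem_latJ_iff] at *
  obtain ⟨Y, Z, h1, h2, h3, h4, rfl⟩ := hX
  exact ⟨_, _, D.adj_mem_filtration h1, S.adj_mem_B h2, D.adj_mem_filtration h3,
    S.adj_mem_Bperp h4, (D.adj_add _ _).symm⟩

/-- The projection of `A` onto `B` along `B^⊥`. -/
def proj (X : Matrix (Fin 4) (Fin 4) F) : Matrix (Fin 4) (Fin 4) F :=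
  !![(X 0 0 + X 2 2) / 2, 0, (X 0 2 + X 2 0 / (D.piF * S.lam)) / 2, 0;
     0, (X 1 1 + X 3 3) / 2, 0, (X 1 3 + X 3 1 / (D.piF * D.conj S.lam)) / 2;
     (X 2 0 + D.piF * S.lam * X 0 2) / 2, 0, (X 0 0 + X 2 2) / 2, 0;
     0, (X 3 1 + D.piF * D.conj S.lam * X 1 3) / 2, 0, (X 1 1 + X 3 3) / 2]

theorem two_ne_zero' (D : UnramifiedQuadratic F₀ F) : (2 : F) ≠ 0 := by
  intro h; have := D.val_two; simp [h] at this

theorem proj_mem_B (X : Matrix (Fin 4) (Fin 4) F) : S.proj X ∈ S.B := by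
  rw [mem_B]
  have h1 := S.lam_ne_zero
  have h2 := S.conj_lam_ne_zero
  have h3 := D.piF_ne_zero
  have h4 := two_ne_zero' D
  have h5 : D.piF ^ (-(S.m : ℤ)) ≠ 0 := zpow_ne_zero _ h3
  unfold beta
  rw [smul_mul_assoc, mul_smul_comm]
  congr 1
  ext i j
  fin_cases i <;> fin_cases j <;>
    simp [proj, Matrix.mul_apply, Fin.sum_univ_four] <;> field_simp <;> ring

theorem entries_of_mem_B {Y : Matrix (Fin 4) (Fin 4) F} (hY : Y ∈ S.B) :
    (Y 0 1 = 0 ∧ Y 0 3 = 0 ∧ Y 1 0 = 0 ∧ Y 1 2 = 0 ∧ Y 2 1 = 0 ∧ Y 2 3 = 0 ∧ Y 3 0 = 0 ∧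
      Y 3 2 = 0) ∧ Y 0 0 = Y 2 2 ∧ Y 1 1 = Y 3 3 ∧ Y 2 0 = D.piF * S.lam * Y 0 2 ∧
      Y 3 1 = D.piF * D.conj S.lam * Y 1 3 := by
  have h3 := D.piF_ne_zero
  have h5 : D.piF ^ (-(S.m : ℤ)) ≠ 0 := zpow_ne_zero _ h3
  have h6 := S.lam_sub_ne_zero
  rw [mem_B] at hY
  unfold beta at hY
  rw [smul_mul_assoc, mul_smul_comm] at hY
  have hY' := smul_right_injective _ h5 hY
  have e : ∀ i j, _ := fun i j => congrFun (congrFun hY' i) j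
  have e01 := e 0 1
  have e03 := e 0 3
  have e21 := e 2 1
  have e23 := e 2 3
  have e10 := e 1 0
  have e12 := e 1 2
  have e30 := e 3 0
  have e32 := e 3 2
  have e00 := e 0 0
  have e02 := e 0 2
  have e11 := e 1 1
  have e13 := e 1 3
  clear e
  simp [Matrix.mul_apply, Fin.sum_univ_four] at e01 e03 e21 e23 e10 e12 e30 e32 e00 e02 e11 e13
  have z : ∀ y : F, D.piF * (S.lam - D.conj S.lam) * y = 0 → y = 0 := fun y hy =>
    (mul_eq_zero.mp hy).resolve_left (mul_ne_zero h3 h6)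
  have y03 : Y 0 3 = 0 := z _ (by linear_combination e23 - e01)
  have y01 : Y 0 1 = 0 := z _ (by linear_combination e21 - D.piF * D.conj S.lam * e03)
  have y12 : Y 1 2 = 0 := z _ (by linear_combination e32 - e10)
  have y32 : Y 3 2 = 0 := z _ (by linear_combination D.piF * D.conj S.lam * e12 - e30)
  refine ⟨⟨y01, y03, ?_, y12, ?_, ?_, ?_, y32⟩, e02.symm, e13.symm, ?_, ?_⟩
  · rw [← e12, y32, neg_zero]
  · rw [e01, y03]; ring
  · rw [e03, y01, neg_zero]
  · rw [← e32, y12]; ring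
  · rw [e00]; ring
  · rw [e11]; ring

theorem trace_proj {X Y : Matrix (Fin 4) (Fin 4) F} (hY : Y ∈ S.B) :
    ((X - S.proj X) * Y).trace = 0 := by
  obtain ⟨⟨a1, a2, a3, a4, a5, a6, a7, a8⟩, b1, b2, b3, b4⟩ := S.entries_of_mem_B hY
  have h1 := S.lam_ne_zero
  have h2 := S.conj_lam_ne_zero
  have h3 := D.piF_ne_zero
  have h4 := two_ne_zero' D
  simp only [Matrix.trace, Matrix.diag_apply, Matrix.mul_apply, Fin.sum_univ_four]
  simp [proj, a1, a2, a3, a4, a5, a6, a7, a8, b1, b2, b3, b4]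
  field_simp
  ring

theorem proj_mem_filtration {k : ℤ} {X : Matrix (Fin 4) (Fin 4) F} (hX : X ∈ D.filtration k) :
    S.proj X ∈ D.filtration k := by
  have h1 := S.val_lam
  have h2 : valuation F (D.conj S.lam) = 1 := by rw [D.conj_val, h1]
  have h0 := D.val_piF_pos
  have add : ∀ {a b : F} {γ : ValueGroupWithZero F}, valuation F a ≤ γ → valuation F b ≤ γ →
      valuation F (a + b) / valuation F 2 ≤ γ := fun ha hb => by
    rw [D.val_two, div_one]; exact Valuation.map_add_le _ ha hb
  have hmul : ∀ {a u : F} {s t : ℤ}, valuation F u = 1 → valuation F a ≤ valuation F D.piF ^ s →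
      t ≤ s + 1 → valuation F (D.piF * u * a) ≤ valuation F D.piF ^ t := fun {a u s t} hu ha hst => by
    rw [map_mul, map_mul, hu, mul_one]
    refine (mul_le_mul_right ha _).trans ?_
    rw [← zpow_one_add₀ h0.ne']
    exact D.val_zpow_anti (by omega)
  have hdiv : ∀ {a u : F} {s t : ℤ}, valuation F u = 1 → valuation F a ≤ valuation F D.piF ^ s →
      t + 1 ≤ s → valuation F (a / (D.piF * u)) ≤ valuation F D.piF ^ t := fun {a u s t} hu ha hst => by
    rw [map_div₀, map_mul, hu, mul_one, div_le_iff₀ h0, ← zpow_add_one₀ h0.ne']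
    exact ha.trans (D.val_zpow_anti hst)
  rw [mem_filtration_iff] at *
  have e00 := hX 0 0
  have e02 := hX 0 2
  have e20 := hX 2 0
  have e22 := hX 2 2
  have e11 := hX 1 1
  have e13 := hX 1 3
  have e31 := hX 3 1
  have e33 := hX 3 3
  simp only [wt, Matrix.cons_val] at e00 e02 e20 e22 e11 e13 e31 e33
  intro i j
  fin_cases i <;> fin_cases j <;> simp [proj, wt] <;> apply add
  all_goals
    first
      | exact LE.le.trans (by assumption) (D.val_zpow_anti (by omega))
      | exact hmul h1 (by assumption) (by omega)
      | exact hmul h2 (by assumption) (by omega)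
      | exact hdiv h1 (by assumption) (by omega)
      | exact hdiv h2 (by assumption) (by omega)

theorem filtration_le_latJ {k : ℤ} (hk : S.n ≤ k) : D.filtration k ≤ S.latJ := by
  intro X hX
  rw [mem_latJ_iff]
  have hm := S.m_pos
  have h1 := S.proj_mem_filtration hX
  exact ⟨S.proj X, X - S.proj X, D.filtration_anti hk h1, S.proj_mem_B X,
    D.filtration_anti (by unfold n at *; omega) (sub_mem hX h1), fun Y hY => S.trace_proj hY,
    by abel⟩

theorem Bperp_mul_B {X Y : Matrix (Fin 4) (Fin 4) F} (hX : X ∈ S.Bperp) (hY : Y ∈ S.B) :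
    X * Y ∈ S.Bperp := fun Z hZ => by rw [mul_assoc]; exact hX _ (mul_mem hY hZ)

theorem B_mul_Bperp {X Y : Matrix (Fin 4) (Fin 4) F} (hX : X ∈ S.B) (hY : Y ∈ S.Bperp) :
    X * Y ∈ S.Bperp := fun Z hZ => by
  rw [mul_assoc, trace_mul_comm, mul_assoc]; exact hY _ (mul_mem hZ hX)

theorem beta_mem_B : S.beta ∈ S.B := S.mem_B.mpr rfl

theorem latJ_mul {X Y : Matrix (Fin 4) (Fin 4) F} (hX : X ∈ S.latJ) (hY : Y ∈ S.latJ) :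
    X * Y ∈ S.latJ := by
  have hm := S.m_pos
  have hn := S.half_n
  obtain ⟨X₁, X₂, a1, a2, a3, a4, rfl⟩ := S.mem_latJ_iff X |>.mp hX
  obtain ⟨Y₁, Y₂, b1, b2, b3, b4, rfl⟩ := S.mem_latJ_iff Y |>.mp hY
  have h1 : X₁ * Y₁ ∈ S.latJ := S.filtration_le_latJ (by unfold n; omega) (D.filtration_mul a1 b1)
  have h2 : X₁ * Y₂ ∈ S.latJ := S.filtration_le_latJ (by omega) (D.filtration_mul a1 b3)
  have h3 : X₂ * Y₁ ∈ S.latJ := S.filtration_le_latJ (by omega) (D.filtration_mul a3 b1)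
  have h4 : X₂ * Y₂ ∈ S.latJ := S.filtration_le_latJ (by unfold n; omega) (D.filtration_mul a3 b3)
  rw [add_mul, mul_add, mul_add]
  exact add_mem (add_mem h1 h2) (add_mem h3 h4)

/-- The open compact subgroup `J = (1 + 𝔍) ∩ G`. -/
def J : Subgroup D.U22 where
  carrier := {g | D.mat g - 1 ∈ S.latJ}
  one_mem' := by simp [mat_one]
  mul_mem' := by
    intro a b ha hb
    simp only [Set.mem_ofPred_eq] at *
    have : D.mat (a * b) - 1 = (D.mat a - 1) * (D.mat b - 1) + (D.mat a - 1) + (D.mat b - 1) := by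
      rw [mat_mul]; noncomm_ring
    rw [this]
    exact add_mem (add_mem (S.latJ_mul ha hb) ha) hb
  inv_mem' := by
    intro a ha
    simp only [Set.mem_ofPred_eq] at *
    have : D.mat a⁻¹ - 1 = D.adj (D.mat a - 1) := by
      rw [mat_inv, sub_eq_add_neg, sub_eq_add_neg, adj_add, adj_neg, adj_one]
    rw [this]
    exact S.adj_mem_latJ ha

/-- The function `x ↦ Ω(tr_{A/F₀}(β(x-1)))`. -/
def psi (x : D.U22) : Circle :=
  S.Ω (Algebra.trace F₀ F (S.beta * (D.mat x - 1)).trace)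

theorem Ω_trace {z : F} (hz : valuation F z < 1) : S.Ω (Algebra.trace F₀ F z) = 1 := by
  apply S.Ω_eq_one
  rw [← val_lt_one_iff (F := F), D.trace_eq]
  exact Valuation.map_add_lt _ hz (by rwa [D.conj_val])

theorem val_trace_lt {X : Matrix (Fin 4) (Fin 4) F} (hX : X ∈ D.filtration 1) :
    valuation F X.trace < 1 := by
  rw [D.unif_top]
  refine Valuation.map_sum_le _ fun i _ => ?_
  have := (D.mem_filtration_iff 1 X).mp hX i i
  simpa [show (1 + wt i - wt i + 1) / 2 = 1 by omega, piF] using this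

theorem val_trace_beta {X Y : Matrix (Fin 4) (Fin 4) F} (hX : X ∈ S.latJ) (hY : Y ∈ S.latJ) :
    valuation F (S.beta * (X * Y)).trace < 1 := by
  have hm := S.m_pos
  have hn := S.half_n
  obtain ⟨X₁, X₂, a1, a2, a3, a4, rfl⟩ := S.mem_latJ_iff X |>.mp hX
  obtain ⟨Y₁, Y₂, b1, b2, b3, b4, rfl⟩ := S.mem_latJ_iff Y |>.mp hY
  have h1 : valuation F (S.beta * (X₁ * Y₁)).trace < 1 :=
    val_trace_lt (D.filtration_anti (by unfold n; omega)
      (D.filtration_mul S.beta_mem (D.filtration_mul a1 b1)))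
  have h4 : valuation F (S.beta * (X₂ * Y₂)).trace < 1 :=
    val_trace_lt (D.filtration_anti (by unfold n; omega)
      (D.filtration_mul S.beta_mem (D.filtration_mul a3 b3)))
  have h2 : (S.beta * (X₁ * Y₂)).trace = 0 := by
    rw [trace_mul_comm]; exact S.B_mul_Bperp a2 b4 _ S.beta_mem_B
  have h3 : (S.beta * (X₂ * Y₁)).trace = 0 := by
    rw [trace_mul_comm]; exact S.Bperp_mul_B a4 b2 _ S.beta_mem_B
  have : (S.beta * ((X₁ + X₂) * (Y₁ + Y₂))).trace =
      (S.beta * (X₁ * Y₁)).trace + (S.beta * (X₂ * Y₂)).trace := by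
    simp only [add_mul, mul_add, trace_add, h2, h3]; ring
  rw [this]
  exact Valuation.map_add_lt _ h1 h4

/-- The character `Ψ = Ψ_β` of `J`, `Ψ(x) = Ω(tr_{A/F₀}(β(x-1)))`. -/
def Psi : S.J →* Circle where
  toFun x := S.psi x
  map_one' := by simp [psi, mat_one]
  map_mul' := by
    intro x y
    have hx : D.mat (x : D.U22) - 1 ∈ S.latJ := x.2
    have hy : D.mat (y : D.U22) - 1 ∈ S.latJ := y.2
    have : S.beta * (D.mat ((x * y : S.J) : D.U22) - 1) =
        S.beta * (D.mat (x : D.U22) - 1) + S.beta * (D.mat (y : D.U22) - 1) +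
          S.beta * ((D.mat (x : D.U22) - 1) * (D.mat (y : D.U22) - 1)) := by
      rw [Subgroup.coe_mul, mat_mul]; noncomm_ring
    simp only [psi]
    rw [this, trace_add, trace_add, map_add (Algebra.trace F₀ F), map_add (Algebra.trace F₀ F),
      AddChar.map_add_eq_mul, AddChar.map_add_eq_mul, S.Ω_trace (S.val_trace_beta hx hy), mul_one]

/-- `G' = G ∩ B`. -/
def Gprime : Subgroup D.U22 where
  carrier := {g | D.mat g ∈ S.B}
  one_mem' := one_mem S.B
  mul_mem' := fun {a b} ha hb => by
    have h1 : D.mat a ∈ S.B := ha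
    have h2 : D.mat b ∈ S.B := hb
    exact mul_mem h1 h2
  inv_mem' := by
    intro a ha
    simp only [Set.mem_ofPred_eq, mat_inv] at *
    exact S.adj_mem_B ha

instance : LocallyCompactSpace ↥S.Gprime := by
  haveI := t2Space_field F
  have h : IsClosed (S.Gprime : Set D.U22) := by
    have : (S.Gprime : Set D.U22) = {g | S.beta * D.mat g = D.mat g * S.beta} := by
      ext g; exact S.mem_B
    rw [this]
    exact isClosed_eq (continuous_const.mul D.continuous_mat) (D.continuous_mat.mul continuous_const)
  exact h.locallyCompactSpace

/-- `J' = J ∩ G'`, as a subgroup of `G'`. -/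
def Jprime : Subgroup S.Gprime := S.J.subgroupOf S.Gprime

/-- `Ψ'`, the restriction of `Ψ` to `J'`. -/
def PsiPrime : S.Jprime →* Circle := S.Psi.comp (S.Gprime.subtype.subgroupComap S.J)

/-- `B' = G' ∩ P_{Λ,0}`, where `P_{Λ,0} = G ∩ 𝔞₀(Λ)`. -/
def Bzero : Set D.U22 := {g | g ∈ S.Gprime ∧ D.mat g ∈ D.filtration 0}

/-- The matrix of the element `ζ`. -/
def zeta : Matrix (Fin 4) (Fin 4) F :=
  !![0, 0, D.piF⁻¹ * S.lam⁻¹, 0;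
     0, 0, 0, 1;
     1, 0, 0, 0;
     0, D.piF * D.conj S.lam, 0, 0]

/-- `Φ_β(X)`, the characteristic polynomial of `y_β = ϖⁿ β²` (here `e(Λ) = 2` and `n` is odd). -/
def charPoly : Polynomial F := (D.piF ^ S.n • S.beta ^ 2).charpoly

/-- A representation of `G` contains the stratum `[Λ, n, n-1, β]` if its restriction to
`P_{Λ,n} = G ∩ (1 + 𝔞_n(Λ))` contains the character `ψ_β(p) = Ω(tr_{A/F₀}(β(p-1)))`. -/
def Contains {W : Type*} [AddCommGroup W] [Module ℂ W] (π : Representation ℂ D.U22 W) : Prop :=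
  ∃ w : W, w ≠ 0 ∧ ∀ p : D.U22, D.mat p - 1 ∈ D.filtration S.n → π p w = (S.psi p : ℂ) • w

end SplitStratum

end UnramifiedQuadratic

end

/-!
Write `V₁ = Fe₁ ⊕ Fe₃` and `V₂ = Fe₂ ⊕ Fe₄`. The matrix `ϖⁿ β²` is the scalar `λ` on `V₁` and
`conj λ` on `V₂`, so `β` preserves this decomposition, on each summand it generates a ramified
quadratic extension of `F`, and its centralizer `B` is the product of these two fields. The summands
are totally isotropic and exchanged by the form, so the stabiliser of the decomposition in `G` is a
Levi subgroup `GL₂(F)` of a Siegel parabolic. The torus `G'` sits in it as the multiplicative group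
of a ramified quadratic extension, with uniformiser `ζ`: an element of `G'` shifts the lattice
filtration by opposite amounts on `V₁` and on `V₂`, which defines a homomorphism `shift` from `G'` to
`ℤ` with kernel `B'` and value `1` at `ζ`. This gives the structure of `G'` (`Gprime_eq`,
`not_isCompact_Gprime`).

*Intertwining.* Because `λ` and `conj λ` are distinct modulo the maximal ideal and the residual
characteristic is odd, `ad β` is invertible on `B^⊥` and moves the filtration by exactly `-n`
(`exists_ad_beta`). Successive approximation, with elements of `G` made by the Cayley transform and a
compactness argument for the limit, then conjugates into `B` every skew element that is close enough
to `β` (`exists_conj_mem_B`). If `g` intertwines `Ψ`, lattice duality for the trace form turns this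
into an equation `β + u = g (β + u') g⁻¹` with `u`, `u'` small; conjugating both sides into `B` by
elements of `J` shows that `g` lies in `J G' J` (`intertwining`).

*The isomorphism of Hecke algebras.* The group `J` has an Iwahori decomposition with respect to the
Levi subgroup above and the two opposite unipotent groups (`exists_unip_levi_unip`), `Ψ` is trivial on
the unipotent factors, and conjugation by `g ∈ G'` shifts the natural filtrations of the unipotent
groups by `± shift g`, up to a factor `2`. The structure `HeckeTheory.Cover` records these facts
together with the intertwining property, and `SplitStratum.cover` verifies them. In that setting a
function on `G'` extends to `J G' J`, and multiplying it by `Q ^ (-|v g| / 2)`, the inverse square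
root of the number of cosets of `J` in `J g J`, makes the extension multiplicative
(`Cover.extend_convolution`): all convolutions are finite sums over cosets, and the cosets that
contribute are counted by indices in the filtrations. The factor is real and even, so the extension
respects the involution as well.

*Absence of supercuspidals.* Suppose `π` contains the stratum. Decomposing under an abelian quotient
of congruence subgroups yields an eigenvector for the character of some skew `γ` close to `β`, and
conjugating `γ` into `B` yields an eigenvector `w` of `J` with character `Ψ`
(`exists_eigenvector_J`). By the covering property no translate `π(ζ^k) w` with `k ≥ 0` dies in the
`(J, Ψ)`-coinvariants, so some `(J, Ψ)`-equivariant functional is nonzero on infinitely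
many of them (`Cover.exists_isEquivariant_apply_ne_zero`). The corresponding matrix coefficient is not
compactly supported modulo the centre, because the centre is bounded and the powers of `ζ` are not
(`not_isSupercuspidal_of_eigenvector`).
-/

noncomputable section

namespace UnramifiedQuadratic

variable {F₀ F : Type*} [Field F₀] [ValuativeRel F₀] [TopologicalSpace F₀]
    [IsNonarchimedeanLocalField F₀] [Field F] [ValuativeRel F] [TopologicalSpace F]
    [IsNonarchimedeanLocalField F] [Algebra F₀ F] [ValuativeExtension F₀ F]
    (D : UnramifiedQuadratic F₀ F)

/-! ### The lattice filtration of the matrix algebra -/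

theorem exists_val_le_zpow (x : F) : ∃ k : ℕ, valuation F x ≤ valuation F D.piF ^ (-(k : ℤ)) := by
  obtain ⟨k, hk⟩ := MulArchimedean.arch (valuation F x)
    ((one_lt_inv₀ D.val_piF_pos).mpr D.val_piF_lt_one)
  exact ⟨k, by simpa using hk⟩

theorem val_zpow_le_iff {s t : ℤ} :
    valuation F D.piF ^ t ≤ valuation F D.piF ^ s ↔ s ≤ t :=
  zpow_le_zpow_iff_right_of_lt_one₀ D.val_piF_pos D.val_piF_lt_one

theorem eq_zero_of_val_le_zpow {x : F} (h : ∀ k : ℕ, valuation F x ≤ valuation F D.piF ^ (k : ℤ)) :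
    x = 0 := by
  by_contra hx
  have hx' : 0 < valuation F x := by simpa [zero_lt_iff] using hx
  obtain ⟨k, hk⟩ := D.exists_val_le_zpow x⁻¹
  rw [map_inv₀, _root_.zpow_neg] at hk
  have h1 := (inv_le_inv₀ hx' (zpow_pos D.val_piF_pos _)).mp hk
  have h2 := D.val_zpow_le_iff.mp (h1.trans (h (k + 1)))
  push_cast at h2
  omega

theorem val_lt_zpow_iff (x : F) (t : ℤ) :
    valuation F x < valuation F D.piF ^ t ↔ valuation F x ≤ valuation F D.piF ^ (t + 1) := by
  have h0 := zpow_pos D.val_piF_pos t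
  have h1 := D.unif_top (x / D.piF ^ t)
  rw [map_div₀, map_zpow₀, div_lt_one₀ h0, div_le_iff₀ h0] at h1
  rw [h1, zpow_add_one₀ D.val_piF_pos.ne', mul_comm]
  rfl

theorem wt_bounds (i : Fin 4) : 0 ≤ wt i ∧ wt i ≤ 1 := by
  fin_cases i <;> simp [wt]

theorem exists_mem_filtration (X : Matrix (Fin 4) (Fin 4) F) :
    ∃ k : ℕ, X ∈ D.filtration (-(k : ℤ)) := by
  choose k hk using fun i j => D.exists_val_le_zpow (X i j)
  obtain ⟨K, hK⟩ : ∃ K : ℕ, ∀ i j, k i j ≤ K :=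
    ⟨∑ i, ∑ j, k i j, fun i j =>
      (Finset.single_le_sum (f := fun j => k i j) (fun _ _ => Nat.zero_le _)
        (Finset.mem_univ j)).trans (Finset.single_le_sum (f := fun i => ∑ j, k i j)
          (fun _ _ => Nat.zero_le _) (Finset.mem_univ i))⟩
  refine ⟨2 * K + 2, (D.mem_filtration_iff _ _).mpr fun i j => (hk i j).trans (D.val_zpow_anti ?_)⟩
  have := hK i j
  have := wt_bounds i
  have := wt_bounds j
  omega

theorem eq_zero_of_mem_filtration {X : Matrix (Fin 4) (Fin 4) F}
    (h : ∀ k : ℕ, X ∈ D.filtration k) : X = 0 := by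
  ext i j
  refine D.eq_zero_of_val_le_zpow fun k => ?_
  refine ((D.mem_filtration_iff _ _).mp (h (2 * k + 2)) i j).trans (D.val_zpow_anti ?_)
  have := wt_bounds i
  have := wt_bounds j
  push_cast
  omega

theorem smul_mem_filtration {c : F} {t k : ℤ} (hc : valuation F c ≤ valuation F D.piF ^ t)
    {X : Matrix (Fin 4) (Fin 4) F} (hX : X ∈ D.filtration k) : c • X ∈ D.filtration (k + 2 * t) := by
  rw [mem_filtration_iff] at *
  intro i j
  rw [Matrix.smul_apply, smul_eq_mul, map_mul]
  refine (mul_le_mul' hc (hX i j)).trans ?_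
  rw [← zpow_add₀ D.val_piF_pos.ne']
  exact D.val_zpow_anti (by omega)

theorem smul_mem_filtration_of_le_one {c : F} {k : ℤ} (hc : valuation F c ≤ 1)
    {X : Matrix (Fin 4) (Fin 4) F} (hX : X ∈ D.filtration k) : c • X ∈ D.filtration k := by
  simpa using D.smul_mem_filtration (t := 0) (by simpa using hc) hX

theorem half_mem_filtration {k : ℤ} {X : Matrix (Fin 4) (Fin 4) F} (hX : X ∈ D.filtration k) :
    (2⁻¹ : F) • X ∈ D.filtration k :=
  D.smul_mem_filtration_of_le_one (by rw [map_inv₀, D.val_two, inv_one]) hX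

theorem diagonal_mem_filtration {d : Fin 4 → F} (h : ∀ i, valuation F (d i) ≤ 1) :
    Matrix.diagonal d ∈ D.filtration 0 := by
  rw [mem_filtration_iff]
  intro i j
  by_cases hij : i = j
  · subst hij; simpa using h i
  · simp [hij]

theorem one_mem_filtration : (1 : Matrix (Fin 4) (Fin 4) F) ∈ D.filtration 0 := by
  rw [← Matrix.diagonal_one]
  exact D.diagonal_mem_filtration fun i => by simp

/-- Multiplication by `1 + X` with `X ∈ 𝔞₁` does not change the position in the filtration. -/
theorem mem_filtration_of_one_add_mul {X Z : Matrix (Fin 4) (Fin 4) F} {k : ℤ}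
    (hX : X ∈ D.filtration 1) (h : (1 + X) * Z ∈ D.filtration k) : Z ∈ D.filtration k := by
  obtain ⟨l, hl⟩ := D.exists_mem_filtration Z
  have key : ∀ r : ℕ, Z ∈ D.filtration (min k (-(l : ℤ) + r)) := by
    intro r
    induction r with
    | zero => exact D.filtration_anti (by simp) hl
    | succ r ih =>
      have e : Z = (1 + X) * Z - X * Z := by rw [add_mul, one_mul, add_sub_cancel_right]
      rw [e]
      refine sub_mem (D.filtration_anti (min_le_left _ _) h)
        (D.filtration_anti ?_ (D.filtration_mul hX ih))
      push_cast
      omega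
  refine D.filtration_anti ?_ (key (k + l).toNat)
  omega

theorem exists_inv_one_add {X : Matrix (Fin 4) (Fin 4) F} {k : ℤ} (hk : 1 ≤ k)
    (hX : X ∈ D.filtration k) :
    ∃ Y ∈ D.filtration k, (1 + X) * (1 + Y) = 1 ∧ (1 + Y) * (1 + X) = 1 := by
  have hX1 := D.filtration_anti hk hX
  have hdet : (1 + X).det ≠ 0 := by
    intro h0
    obtain ⟨v, hv, hv0⟩ := Matrix.exists_mulVec_eq_zero_iff.mpr h0
    let V : Matrix (Fin 4) (Fin 4) F := Matrix.of fun i _ => v i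
    have hz : (1 + X) * V = 0 := by
      ext i j
      exact congrFun hv0 i
    have := D.eq_zero_of_mem_filtration (X := V) fun k =>
      D.mem_filtration_of_one_add_mul hX1 (by rw [hz]; exact zero_mem _)
    exact hv (funext fun i => congrFun (congrFun this i) 0)
  have hu : IsUnit (1 + X).det := isUnit_iff_ne_zero.mpr hdet
  have h1 := Matrix.mul_nonsing_inv (1 + X) hu
  have h0 : (1 + X)⁻¹ ∈ D.filtration 0 :=
    D.mem_filtration_of_one_add_mul hX1 (by rw [h1]; exact D.one_mem_filtration)
  refine ⟨(1 + X)⁻¹ - 1, ?_, by rw [add_sub_cancel, h1],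
    by rw [add_sub_cancel, Matrix.nonsing_inv_mul _ hu]⟩
  have e : (1 + X)⁻¹ - 1 = -(X * (1 + X)⁻¹) := by
    rw [add_mul, one_mul] at h1
    exact eq_neg_of_add_eq_zero_left (by rw [sub_add_eq_add_sub, h1, sub_self])
  rw [e]
  exact neg_mem (by simpa using D.filtration_mul hX h0)

theorem isOpen_filtration (k : ℤ) :
    IsOpen (D.filtration k : Set (Matrix (Fin 4) (Fin 4) F)) := by
  have : (D.filtration k : Set (Matrix (Fin 4) (Fin 4) F)) = ⋂ i, ⋂ j,
      (fun X : Matrix (Fin 4) (Fin 4) F => X i j) ⁻¹'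
        {x | valuation F x ≤ valuation F D.piF ^ ((k + wt j - wt i + 1) / 2)} := by
    ext X
    simp [mem_filtration_iff]
  rw [this]
  refine isOpen_iInter_of_finite fun i => isOpen_iInter_of_finite fun j => ?_
  refine IsOpen.preimage (continuous_apply_apply i j) ?_
  have h0 := zpow_pos D.val_piF_pos ((k + wt j - wt i + 1) / 2)
  set γ := valuation F D.piF ^ ((k + wt j - wt i + 1) / 2)
  let U : AddSubgroup F :=
    { carrier := {x | valuation F x ≤ γ}
      zero_mem' := by simp
      add_mem' := fun {a b} (ha : valuation F a ≤ γ) (hb : valuation F b ≤ γ) =>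
        show valuation F (a + b) ≤ γ from Valuation.map_add_le _ ha hb
      neg_mem' := fun {x} ha => by simpa [Valuation.map_neg] using ha }
  refine AddSubgroup.isOpen_of_mem_nhds U (g := 0) ?_
  exact Filter.mem_of_superset
    ((IsValuativeTopology.hasBasis_nhds_zero' F).mem_of_mem h0.ne') fun x hx =>
      show valuation F x ≤ γ from le_of_lt hx

theorem isCompact_filtration (k : ℤ) :
    IsCompact (D.filtration k : Set (Matrix (Fin 4) (Fin 4) F)) := by
  have : (D.filtration k : Set (Matrix (Fin 4) (Fin 4) F)) = Set.pi Set.univ fun i => Set.pi Set.univ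
      fun j => {x | valuation F x ≤ valuation F D.piF ^ ((k + wt j - wt i + 1) / 2)} := by
    ext X
    rw [SetLike.mem_coe, mem_filtration_iff]
    exact ⟨fun h i _ j _ => h i j, fun h i j => h i trivial j trivial⟩
  rw [this]
  exact isCompact_univ_pi fun i => isCompact_univ_pi fun j =>
    IsNonarchimedeanLocalField.isCompact_closedBall F _

theorem isClosed_filtration (k : ℤ) :
    IsClosed (D.filtration k : Set (Matrix (Fin 4) (Fin 4) F)) := by
  haveI := t2Space_field F
  exact (D.isCompact_filtration k).isClosed

end UnramifiedQuadratic

namespace UnramifiedQuadratic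

variable {F₀ F : Type*} [Field F₀] [ValuativeRel F₀] [TopologicalSpace F₀]
    [IsNonarchimedeanLocalField F₀] [Field F] [ValuativeRel F] [TopologicalSpace F]
    [IsNonarchimedeanLocalField F] [Algebra F₀ F] [ValuativeExtension F₀ F]
    (D : UnramifiedQuadratic F₀ F)

/-! ### Duality for the trace form -/

theorem adj_sub (X Y : Matrix (Fin 4) (Fin 4) F) : D.adj (X - Y) = D.adj X - D.adj Y := by
  rw [sub_eq_add_neg, adj_add, adj_neg, ← sub_eq_add_neg]

theorem adj_smul (c : F) (X : Matrix (Fin 4) (Fin 4) F) :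
    D.adj (c • X) = D.conj c • D.adj X := by
  ext i j; simp [adj_apply]

theorem conj_half : D.conj (2⁻¹ : F) = 2⁻¹ := by
  rw [map_inv₀, map_ofNat]

theorem half_add_half (D : UnramifiedQuadratic F₀ F) (X : Matrix (Fin 4) (Fin 4) F) :
    (2⁻¹ : F) • X + (2⁻¹ : F) • X = X := by
  have h2 : (2 : F) ≠ 0 := SplitStratum.two_ne_zero' D
  rw [← add_smul, show (2⁻¹ + 2⁻¹ : F) = 1 by field_simp; norm_num, one_smul]

theorem trace_mul_single_eq (X : Matrix (Fin 4) (Fin 4) F) (i j : Fin 4) (c : F) :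
    (X * Matrix.single j i c).trace = X i j * c := by
  rw [Matrix.trace_mul_single]; rfl

/-- The dual of `𝔞_k` for the pairing `tr(XY)` with values modulo `𝔭_F` is `𝔞_{1-k}`. -/
theorem mem_filtration_of_trace {k : ℤ} {X : Matrix (Fin 4) (Fin 4) F}
    (h : ∀ Y ∈ D.filtration k, valuation F (X * Y).trace < 1) : X ∈ D.filtration (1 - k) := by
  rw [mem_filtration_iff]
  intro i j
  set e : ℤ := (k + wt i - wt j + 1) / 2 with he
  have hY : Matrix.single j i (D.piF ^ e) ∈ D.filtration k := by
    rw [mem_filtration_iff]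
    intro a b
    rw [Matrix.single_apply]
    split_ifs with hab
    · obtain ⟨rfl, rfl⟩ := hab
      rw [map_zpow₀]
    · simp
  have := h _ hY
  rw [trace_mul_single_eq, map_mul, map_zpow₀] at this
  have h0 := zpow_pos D.val_piF_pos e
  rw [← lt_div_iff₀ h0, one_div, ← _root_.zpow_neg, D.val_lt_zpow_iff] at this
  exact this.trans (D.val_zpow_anti (by omega))

theorem val_trace_mul_lt {k l : ℤ} (hkl : 1 ≤ k + l) {X Y : Matrix (Fin 4) (Fin 4) F}
    (hX : X ∈ D.filtration k) (hY : Y ∈ D.filtration l) : valuation F (X * Y).trace < 1 :=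
  SplitStratum.val_trace_lt (D.filtration_anti hkl (D.filtration_mul hX hY))

namespace SplitStratum

variable {D} (S : D.SplitStratum)

/-- An element of `F` whose integral multiples all have `Ω ∘ tr_{F/F₀}` trivial lies in `𝔭_F`. -/
theorem val_lt_one_of_Ω {z : F}
    (h : ∀ a : F, valuation F a ≤ 1 → S.Ω (Algebra.trace F₀ F (a * z)) = 1) :
    valuation F z < 1 := by
  have key : ∀ a : F, valuation F a ≤ 1 → valuation F (a * z + D.conj (a * z)) < 1 := by
    intro a ha
    rw [← D.trace_eq, val_lt_one_iff]
    by_contra hlt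
    rw [not_lt] at hlt
    obtain ⟨x, hx, hx1⟩ := S.Ω_ne_one
    set t := Algebra.trace F₀ F (a * z) with ht
    have ht0 : t ≠ 0 := by
      intro h0; rw [h0, map_zero] at hlt; simp at hlt
    refine hx1 ?_
    have hb : valuation F₀ (x / t) ≤ 1 := by
      rw [map_div₀]
      exact div_le_one_of_le₀ (hx.trans hlt) zero_le
    have := h (algebraMap F₀ F (x / t) * a) (by
      rw [map_mul]
      exact mul_le_one' ((val_le_one_iff _).mpr hb) ha)
    rw [mul_assoc, ← Algebra.smul_def, map_smul, smul_eq_mul, ← ht, div_mul_cancel₀ _ ht0] at this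
    exact this
  have h1 := key 1 (by simp)
  have h2 := key S.lam S.lam_integral
  have h3 : valuation F ((S.lam - D.conj S.lam) * z) < 1 := by
    have e : (S.lam - D.conj S.lam) * z = (S.lam * z + D.conj (S.lam * z)) -
        D.conj S.lam * (1 * z + D.conj (1 * z)) := by
      simp only [map_mul, map_one]; ring
    rw [e]
    refine Valuation.map_sub_lt _ h2 ?_
    rw [map_mul]
    exact (mul_le_of_le_one_left' (D.conj_val_le_one S.lam_integral)).trans_lt h1
  rwa [map_mul, S.val_lam_sub, one_mul] at h3

theorem trace_eq_zero_of_conj {z : F} (h : D.conj z = -z) : Algebra.trace F₀ F z = 0 := by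
  have := D.trace_eq z
  rw [h, add_neg_cancel] at this
  simpa using this

/-- A skew element orthogonal to the skew elements of a `σ`-stable lattice is orthogonal to the
whole lattice. -/
theorem val_trace_lt_of_skew {Δ : Matrix (Fin 4) (Fin 4) F} (hΔ : D.adj Δ = -Δ)
    (L : Submodule 𝒪[F] (Matrix (Fin 4) (Fin 4) F)) (hL : ∀ X ∈ L, D.adj X ∈ L)
    (h : ∀ X ∈ L, D.adj X = -X → S.Ω (Algebra.trace F₀ F (Δ * X).trace) = 1)
    {X : Matrix (Fin 4) (Fin 4) F} (hX : X ∈ L) : valuation F (Δ * X).trace < 1 := by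
  have hsm : ∀ a : F, valuation F a ≤ 1 → ∀ Y ∈ L, a • Y ∈ L := fun a ha Y hY =>
    L.smul_mem (⟨a, ha⟩ : 𝒪[F]) hY
  refine S.val_lt_one_of_Ω fun a ha => ?_
  rw [← smul_eq_mul, ← trace_smul, ← Matrix.mul_smul]
  set Y := a • X with hY
  have hYL : Y ∈ L := hsm a ha X hX
  have h2 : valuation F (2⁻¹ : F) ≤ 1 := by rw [map_inv₀, D.val_two, inv_one]
  have e : Y = (2⁻¹ : F) • (Y - D.adj Y) + (2⁻¹ : F) • (Y + D.adj Y) := by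
    rw [← smul_add, sub_add_add_cancel, smul_add, D.half_add_half]
  have hs : Algebra.trace F₀ F (Δ * ((2⁻¹ : F) • (Y + D.adj Y))).trace = 0 := by
    apply trace_eq_zero_of_conj (D := D)
    rw [← trace_adj, adj_mul, hΔ, adj_smul, D.conj_half, adj_add, adj_adj, trace_mul_comm,
      neg_mul, trace_neg, add_comm (D.adj Y)]
  rw [e, Matrix.mul_add, trace_add, map_add, hs, add_zero]
  refine h _ (hsm _ h2 _ (sub_mem hYL (hL _ hYL))) ?_
  rw [adj_smul, D.conj_half, adj_sub, adj_adj, ← smul_neg, neg_sub]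

/-! ### The decomposition `A = B ⊕ B^⊥` and the inverse of `ad β` on `B^⊥` -/

theorem sub_proj_mem_Bperp (X : Matrix (Fin 4) (Fin 4) F) : X - S.proj X ∈ S.Bperp :=
  fun _ hY => S.trace_proj hY

theorem eq_zero_of_trace {X : Matrix (Fin 4) (Fin 4) F}
    (h : ∀ Y : Matrix (Fin 4) (Fin 4) F, (X * Y).trace = 0) : X = 0 := by
  ext i j
  have := h (Matrix.single j i 1)
  rwa [trace_mul_single_eq, mul_one] at this

theorem eq_zero_of_mem_B_of_mem_Bperp {X : Matrix (Fin 4) (Fin 4) F} (h1 : X ∈ S.B)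
    (h2 : X ∈ S.Bperp) : X = 0 := by
  refine eq_zero_of_trace fun Y => ?_
  have e : X * Y = X * S.proj Y + X * (Y - S.proj Y) := by rw [← Matrix.mul_add, add_sub_cancel]
  rw [e, trace_add, h2 _ (S.proj_mem_B Y), trace_mul_comm, S.trace_proj h1, add_zero]

/-- Uniqueness of the decomposition `A = B ⊕ B^⊥`. -/
theorem proj_add {X Y : Matrix (Fin 4) (Fin 4) F} (hX : X ∈ S.B) (hY : Y ∈ S.Bperp) :
    S.proj (X + Y) = X := by
  rw [← sub_eq_zero]
  refine S.eq_zero_of_mem_B_of_mem_Bperp (sub_mem (S.proj_mem_B _) hX) ?_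
  have e : S.proj (X + Y) - X = Y - (X + Y - S.proj (X + Y)) := by abel
  rw [e]
  exact sub_mem hY (S.sub_proj_mem_Bperp _)

theorem proj_of_mem_Bperp {X : Matrix (Fin 4) (Fin 4) F} (hX : X ∈ S.Bperp) : S.proj X = 0 := by
  simpa using S.proj_add (zero_mem S.B) hX

theorem proj_adj (X : Matrix (Fin 4) (Fin 4) F) : S.proj (D.adj X) = D.adj (S.proj X) := by
  have e : D.adj X = D.adj (S.proj X) + D.adj (X - S.proj X) := by rw [← adj_add, add_sub_cancel]
  rw [e, S.proj_add (S.adj_mem_B (S.proj_mem_B X)) (S.adj_mem_Bperp (S.sub_proj_mem_Bperp X))]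

theorem proj_neg (X : Matrix (Fin 4) (Fin 4) F) : S.proj (-X) = -S.proj X := by
  have e : -X = -S.proj X + -(X - S.proj X) := by abel
  conv_lhs => rw [e]
  exact S.proj_add (neg_mem (S.proj_mem_B X)) (neg_mem (S.sub_proj_mem_Bperp X))

end SplitStratum

/-- The idempotent of `A` with image `F e₁ ⊕ F e₃` and kernel `F e₂ ⊕ F e₄`. -/
def idem₁ (F : Type*) [Field F] : Matrix (Fin 4) (Fin 4) F := Matrix.diagonal ![1, 0, 1, 0]

/-- The idempotent of `A` with image `F e₂ ⊕ F e₄` and kernel `F e₁ ⊕ F e₃`. -/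
def idem₂ (F : Type*) [Field F] : Matrix (Fin 4) (Fin 4) F := Matrix.diagonal ![0, 1, 0, 1]

theorem idem₁_mem : idem₁ F ∈ D.filtration 0 :=
  D.diagonal_mem_filtration fun i => by fin_cases i <;> simp

theorem idem₂_mem : idem₂ F ∈ D.filtration 0 :=
  D.diagonal_mem_filtration fun i => by fin_cases i <;> simp

theorem idem₁_mul_idem₁ : idem₁ F * idem₁ F = idem₁ F := by
  rw [idem₁, Matrix.diagonal_mul_diagonal]; congr 1; ext i; fin_cases i <;> simp

theorem idem₂_mul_idem₂ : idem₂ F * idem₂ F = idem₂ F := by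
  rw [idem₂, Matrix.diagonal_mul_diagonal]; congr 1; ext i; fin_cases i <;> simp

theorem idem₁_mul_idem₂ : idem₁ F * idem₂ F = 0 := by
  rw [idem₁, idem₂, Matrix.diagonal_mul_diagonal, ← Matrix.diagonal_zero]
  congr 1; ext i; fin_cases i <;> simp

theorem idem₂_mul_idem₁ : idem₂ F * idem₁ F = 0 := by
  rw [idem₁, idem₂, Matrix.diagonal_mul_diagonal, ← Matrix.diagonal_zero]
  congr 1; ext i; fin_cases i <;> simp

theorem idem₁_add_idem₂ : idem₁ F + idem₂ F = 1 := by
  rw [idem₁, idem₂, Matrix.diagonal_add, ← Matrix.diagonal_one]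
  congr 1; ext i; fin_cases i <;> simp

theorem adj_idem₁ : D.adj (idem₁ F) = idem₂ F := by
  ext i j
  rw [adj_apply]
  fin_cases i <;> fin_cases j <;> simp [idem₁, idem₂, Fin.rev]

theorem adj_idem₂ : D.adj (idem₂ F) = idem₁ F := by
  rw [← D.adj_idem₁, adj_adj]

namespace SplitStratum

variable {D} (S : D.SplitStratum)

theorem idem₁_mem_B : idem₁ F ∈ S.B := by
  rw [mem_B, beta, smul_mul_assoc, mul_smul_comm]
  congr 1
  ext i j
  fin_cases i <;> fin_cases j <;> simp [idem₁, Matrix.mul_apply, Fin.sum_univ_four]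

theorem idem₂_mem_B : idem₂ F ∈ S.B := by
  rw [← D.adj_idem₁]; exact S.adj_mem_B S.idem₁_mem_B

/-- The matrix `y_β = ϖⁿ β²`. -/
theorem smul_beta_sq : D.piF ^ S.n • S.beta ^ 2 =
    S.lam • idem₁ F + D.conj S.lam • idem₂ F := by
  have h3 := D.piF_ne_zero
  have e : D.piF ^ S.n * (D.piF ^ (-(S.m : ℤ)) * D.piF ^ (-(S.m : ℤ))) = D.piF⁻¹ := by
    rw [← zpow_add₀ h3, ← zpow_add₀ h3, ← _root_.zpow_neg_one]; congr 1; unfold n; ring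
  rw [pow_two, beta, smul_mul_assoc, mul_smul_comm, smul_smul, smul_smul, mul_assoc, e]
  ext i j
  fin_cases i <;> fin_cases j <;>
    simp [idem₁, idem₂, h3]

theorem charPoly_eq : S.charPoly = (Polynomial.X - Polynomial.C S.lam) ^ 2 *
    (Polynomial.X - Polynomial.C (D.conj S.lam)) ^ 2 := by
  rw [charPoly, smul_beta_sq, idem₁, idem₂, ← Matrix.diagonal_smul, ← Matrix.diagonal_smul,
    Matrix.diagonal_add, Matrix.charpoly_diagonal, Fin.prod_univ_four]
  simp
  ring

end SplitStratum

end UnramifiedQuadratic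

namespace UnramifiedQuadratic

variable {F₀ F : Type*} [Field F₀] [ValuativeRel F₀] [TopologicalSpace F₀]
    [IsNonarchimedeanLocalField F₀] [Field F] [ValuativeRel F] [TopologicalSpace F]
    [IsNonarchimedeanLocalField F] [Algebra F₀ F] [ValuativeExtension F₀ F]
    (D : UnramifiedQuadratic F₀ F)

namespace SplitStratum

variable {D} (S : D.SplitStratum)

/-- On the summands `V₁` and `V₂` the centralizer of `β` is a quadratic field generated by `β`, and
the orthogonal complement of such a field in a `2 × 2` matrix algebra anticommutes with `β`. -/
theorem beta_mul_diag_part {w : Matrix (Fin 4) (Fin 4) F} (hw : w ∈ S.Bperp) :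
    S.beta * (idem₁ F * w * idem₁ F + idem₂ F * w * idem₂ F) =
      -((idem₁ F * w * idem₁ F + idem₂ F * w * idem₂ F) * S.beta) := by
  have h0 := S.proj_of_mem_Bperp hw
  have hl := S.lam_ne_zero
  have hc := S.conj_lam_ne_zero
  have h3 := D.piF_ne_zero
  have h4 := two_ne_zero' D
  have e00 := congrFun (congrFun h0 0) 0
  have e11 := congrFun (congrFun h0 1) 1
  have e20 := congrFun (congrFun h0 2) 0
  have e31 := congrFun (congrFun h0 3) 1
  simp [proj, h4] at e00 e11 e20 e31
  have f22 : w 2 2 = -w 0 0 := by linear_combination e00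
  have f33 : w 3 3 = -w 1 1 := by linear_combination e11
  have f20 : w 2 0 = -(D.piF * S.lam * w 0 2) := by linear_combination e20
  have f31 : w 3 1 = -(D.piF * D.conj S.lam * w 1 3) := by linear_combination e31
  rw [beta, smul_mul_assoc, mul_smul_comm, ← smul_neg]
  congr 1
  ext i j
  fin_cases i <;> fin_cases j <;>
    simp [idem₁, idem₂, Matrix.mul_apply, Fin.sum_univ_four, f22, f33, f20, f31] <;> ring

/-- The inverse of `β`, in the form that shows that it lies in `𝔞_n`. -/
theorem exists_inv_beta : ∃ β' ∈ D.filtration S.n, S.beta * β' = 1 ∧ β' * S.beta = 1 ∧ β' ∈ S.B := by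
  have hl := S.lam_ne_zero
  have hc := S.conj_lam_ne_zero
  have h1 : valuation F S.lam⁻¹ ≤ 1 := by rw [map_inv₀, S.val_lam, inv_one]
  have h2 : valuation F (D.conj S.lam)⁻¹ ≤ 1 := by rw [map_inv₀, D.conj_val, S.val_lam, inv_one]
  set Λ' : Matrix (Fin 4) (Fin 4) F := S.lam⁻¹ • idem₁ F + (D.conj S.lam)⁻¹ • idem₂ F with hΛ
  have hm : Λ' ∈ D.filtration 0 :=
    add_mem (D.smul_mem_filtration_of_le_one h1 D.idem₁_mem)
      (D.smul_mem_filtration_of_le_one h2 D.idem₂_mem)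
  have hB : Λ' ∈ S.B := add_mem (S.B.smul_mem S.idem₁_mem_B _) (S.B.smul_mem S.idem₂_mem_B _)
  have hinv : Λ' * (D.piF ^ S.n • S.beta ^ 2) = 1 := by
    rw [S.smul_beta_sq, hΛ, add_mul, mul_add, mul_add]
    simp only [smul_mul_smul_comm, idem₁_mul_idem₁, idem₁_mul_idem₂, idem₂_mul_idem₁,
      idem₂_mul_idem₂, smul_zero, add_zero, zero_add, inv_mul_cancel₀ hl, inv_mul_cancel₀ hc,
      one_smul, idem₁_add_idem₂]
  have hcomm := S.mem_B.mp hB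
  have hr : D.piF ^ S.n • (Λ' * S.beta) * S.beta = 1 := by
    rw [← hinv, pow_two, smul_mul_assoc, mul_smul_comm, mul_assoc]
  refine ⟨D.piF ^ S.n • (Λ' * S.beta), ?_, ?_, hr, S.B.smul_mem (mul_mem hB S.beta_mem_B) _⟩
  · have := D.smul_mem_filtration (t := S.n) (by rw [map_zpow₀]) (D.filtration_mul hm S.beta_mem)
    exact D.filtration_anti (by omega) this
  · exact mul_eq_one_comm.mp hr

/-- `ad β` maps `𝔞_k ∩ B^⊥` onto `𝔞_{k-n} ∩ B^⊥`. -/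
theorem exists_ad_beta {k : ℤ} {w : Matrix (Fin 4) (Fin 4) F} (hw : w ∈ S.Bperp)
    (hwk : w ∈ D.filtration (k - S.n)) :
    ∃ x ∈ S.Bperp, x ∈ D.filtration k ∧ S.beta * x - x * S.beta = w := by
  obtain ⟨β', hβ'm, hββ', hβ'β, hβ'B⟩ := S.exists_inv_beta
  have h4 := two_ne_zero' D
  set u := idem₁ F * w * idem₂ F with hu
  set u' := idem₂ F * w * idem₁ F with hu'
  set d := idem₁ F * w * idem₁ F + idem₂ F * w * idem₂ F with hd
  have hsum : w = u + u' + d := by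
    have e : w = (idem₁ F + idem₂ F) * w * (idem₁ F + idem₂ F) := by
      rw [idem₁_add_idem₂, one_mul, mul_one]
    rw [hu, hu', hd]
    conv_lhs => rw [e]
    noncomm_ring
  have mem : ∀ {e f : Matrix (Fin 4) (Fin 4) F}, e ∈ D.filtration 0 → f ∈ D.filtration 0 →
      e * w * f ∈ D.filtration (k - S.n) := fun he hf => by
    simpa using D.filtration_mul (D.filtration_mul he hwk) hf
  have memB : ∀ {e f : Matrix (Fin 4) (Fin 4) F}, e ∈ S.B → f ∈ S.B →
      e * w * f ∈ S.Bperp := fun he hf => S.Bperp_mul_B (S.B_mul_Bperp he hw) hf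
  have hum := mem D.idem₁_mem D.idem₂_mem
  have hu'm := mem D.idem₂_mem D.idem₁_mem
  have hdm := add_mem (mem D.idem₁_mem D.idem₁_mem) (mem D.idem₂_mem D.idem₂_mem)
  have huB := memB S.idem₁_mem_B S.idem₂_mem_B
  have hu'B := memB S.idem₂_mem_B S.idem₁_mem_B
  have hdB := add_mem (memB S.idem₁_mem_B S.idem₁_mem_B) (memB S.idem₂_mem_B S.idem₂_mem_B)
  rw [← hu] at hum huB
  rw [← hu'] at hu'm hu'B
  rw [← hd] at hdm hdB
  have hanti : S.beta * d = -(d * S.beta) := S.beta_mul_diag_part hw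
  set μ := S.lam - D.conj S.lam with hμ
  have hμ0 : μ ≠ 0 := S.lam_sub_ne_zero
  have hμv : valuation F (μ⁻¹ * D.piF ^ S.n) ≤ valuation F D.piF ^ S.n := by
    rw [map_mul, map_inv₀, S.val_lam_sub, inv_one, one_mul, map_zpow₀]
  have hsq := S.smul_beta_sq
  have a1 : D.piF ^ S.n • S.beta ^ 2 * u = S.lam • u := by
    rw [hsq, hu, add_mul, smul_mul_assoc, smul_mul_assoc, ← mul_assoc, ← mul_assoc,
      idem₁_mul_idem₁, ← mul_assoc, ← mul_assoc, idem₂_mul_idem₁]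
    simp
  have a2 : u * D.piF ^ S.n • S.beta ^ 2 = D.conj S.lam • u := by
    rw [hsq, hu, mul_add, mul_smul_comm, mul_smul_comm, mul_assoc _ (idem₂ F), idem₂_mul_idem₁,
      mul_assoc _ (idem₂ F), idem₂_mul_idem₂]
    simp
  have a3 : D.piF ^ S.n • S.beta ^ 2 * u' = D.conj S.lam • u' := by
    rw [hsq, hu', add_mul, smul_mul_assoc, smul_mul_assoc, ← mul_assoc, ← mul_assoc,
      idem₁_mul_idem₂, ← mul_assoc, ← mul_assoc, idem₂_mul_idem₂]
    simp
  have a4 : u' * D.piF ^ S.n • S.beta ^ 2 = S.lam • u' := by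
    rw [hsq, hu', mul_add, mul_smul_comm, mul_smul_comm, mul_assoc _ (idem₁ F), idem₁_mul_idem₁,
      mul_assoc _ (idem₁ F), idem₁_mul_idem₂]
    simp
  refine ⟨(μ⁻¹ * D.piF ^ S.n) • (S.beta * u + u * S.beta - (S.beta * u' + u' * S.beta)) +
    (2⁻¹ : F) • (β' * d), ?_, ?_, ?_⟩
  · refine add_mem (S.Bperp.smul_mem _ (sub_mem ?_ ?_))
      (S.Bperp.smul_mem _ (S.B_mul_Bperp hβ'B hdB))
    · exact add_mem (S.B_mul_Bperp S.beta_mem_B huB) (S.Bperp_mul_B huB S.beta_mem_B)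
    · exact add_mem (S.B_mul_Bperp S.beta_mem_B hu'B) (S.Bperp_mul_B hu'B S.beta_mem_B)
  · have c1 : ∀ z ∈ D.filtration (k - S.n), S.beta * z + z * S.beta ∈ D.filtration (k - 2 * S.n) :=
      fun z hz => add_mem (D.filtration_anti (by omega) (D.filtration_mul S.beta_mem hz))
        (D.filtration_anti (by omega) (D.filtration_mul hz S.beta_mem))
    refine add_mem ?_ (D.half_mem_filtration ?_)
    · exact D.filtration_anti (by omega)
        (D.smul_mem_filtration hμv (sub_mem (c1 u hum) (c1 u' hu'm)))
    · exact D.filtration_anti (by omega) (D.filtration_mul hβ'm hdm)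
  · have p1 : S.beta * (S.beta * u + u * S.beta - (S.beta * u' + u' * S.beta)) -
        (S.beta * u + u * S.beta - (S.beta * u' + u' * S.beta)) * S.beta =
        S.beta ^ 2 * u - u * S.beta ^ 2 - (S.beta ^ 2 * u' - u' * S.beta ^ 2) := by
      noncomm_ring
    have p2 : D.piF ^ S.n • (S.beta ^ 2 * u - u * S.beta ^ 2 -
        (S.beta ^ 2 * u' - u' * S.beta ^ 2)) = μ • (u + u') := by
      rw [smul_sub, smul_sub, smul_sub, ← smul_mul_assoc, ← mul_smul_comm, ← smul_mul_assoc,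
        ← mul_smul_comm, a1, a2, a3, a4, hμ, sub_smul, smul_add, smul_add]
      abel
    have p3 : S.beta * (β' * d) - β' * d * S.beta = d + d := by
      rw [← mul_assoc, hββ', one_mul, mul_assoc, ← neg_eq_iff_eq_neg.mpr hanti, mul_neg,
        ← mul_assoc, hβ'β, one_mul, sub_neg_eq_add]
    rw [mul_add, add_mul, add_sub_add_comm, mul_smul_comm, smul_mul_assoc, ← smul_sub, p1,
      mul_smul, p2, smul_smul, inv_mul_cancel₀ hμ0, one_smul, mul_smul_comm, smul_mul_assoc,
      ← smul_sub, p3, smul_add, half_add_half D, hsum]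

theorem eq_zero_of_commute_beta {x : Matrix (Fin 4) (Fin 4) F} (hx : x ∈ S.Bperp)
    (h : S.beta * x - x * S.beta = 0) : x = 0 :=
  S.eq_zero_of_mem_B_of_mem_Bperp (S.mem_B.mpr (sub_eq_zero.mp h)) hx

/-- `ad β` is strict on `B^⊥` for the filtration. -/
theorem mem_filtration_of_ad_beta {k : ℤ} {x : Matrix (Fin 4) (Fin 4) F} (hx : x ∈ S.Bperp)
    (h : S.beta * x - x * S.beta ∈ D.filtration (k - S.n)) : x ∈ D.filtration k := by
  have hw : S.beta * x - x * S.beta ∈ S.Bperp :=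
    sub_mem (S.B_mul_Bperp S.beta_mem_B hx) (S.Bperp_mul_B hx S.beta_mem_B)
  obtain ⟨y, hy, hyk, e⟩ := S.exists_ad_beta hw h
  have : y - x = 0 := S.eq_zero_of_commute_beta (sub_mem hy hx) (by
    rw [mul_sub, sub_mul, sub_sub_sub_comm, e, sub_self])
  rwa [← sub_eq_zero.mp this]

/-- An element intertwining two small deformations of `β` inside `B` lies in `B`. -/
theorem mem_B_of_intertwine {b₁ b₂ g : Matrix (Fin 4) (Fin 4) F} (h₁ : b₁ ∈ S.B)
    (h₁' : b₁ ∈ D.filtration (1 - S.n)) (h₂ : b₂ ∈ S.B) (h₂' : b₂ ∈ D.filtration (1 - S.n))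
    (h : (S.beta + b₁) * g = g * (S.beta + b₂)) : g ∈ S.B := by
  set p := S.proj g with hp
  set z := g - p with hz
  have hpB : p ∈ S.B := S.proj_mem_B g
  have hzB : z ∈ S.Bperp := S.sub_proj_mem_Bperp g
  have e : ((S.beta + b₁) * p - p * (S.beta + b₂)) + ((S.beta + b₁) * z - z * (S.beta + b₂)) = 0 := by
    have : g = p + z := by rw [hz, add_sub_cancel]
    rw [this] at h
    rw [sub_add_sub_comm, ← mul_add, ← add_mul, h, sub_self]
  have x1 := add_mem S.beta_mem_B h₁
  have x2 := add_mem S.beta_mem_B h₂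
  have hB : (S.beta + b₁) * z - z * (S.beta + b₂) ∈ S.B := by
    rw [← neg_eq_of_add_eq_zero_right e]
    exact neg_mem (sub_mem (mul_mem x1 hpB) (mul_mem hpB x2))
  have hz0 := S.eq_zero_of_mem_B_of_mem_Bperp hB
    (sub_mem (S.B_mul_Bperp x1 hzB) (S.Bperp_mul_B hzB x2))
  have had : S.beta * z - z * S.beta = z * b₂ - b₁ * z := by
    rw [add_mul, mul_add, add_sub_add_comm] at hz0
    rw [eq_neg_of_add_eq_zero_left hz0, neg_sub]
  obtain ⟨l, hl⟩ := D.exists_mem_filtration z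
  have key : ∀ r : ℕ, z ∈ D.filtration (-(l : ℤ) + r) := by
    intro r
    induction r with
    | zero => simpa using hl
    | succ r ih =>
      refine S.mem_filtration_of_ad_beta hzB ?_
      rw [had]
      push_cast
      exact sub_mem (D.filtration_anti (by omega) (D.filtration_mul ih h₂'))
        (D.filtration_anti (by omega) (D.filtration_mul h₁' ih))
  have : z = 0 := D.eq_zero_of_mem_filtration fun k =>
    D.filtration_anti (by push_cast; omega) (key (l + k))
  rw [sub_eq_zero.mp this]
  exact hpB

end SplitStratum

end UnramifiedQuadratic

namespace UnramifiedQuadratic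

variable {F₀ F : Type*} [Field F₀] [ValuativeRel F₀] [TopologicalSpace F₀]
    [IsNonarchimedeanLocalField F₀] [Field F] [ValuativeRel F] [TopologicalSpace F]
    [IsNonarchimedeanLocalField F] [Algebra F₀ F] [ValuativeExtension F₀ F]
    (D : UnramifiedQuadratic F₀ F)

/-! ### Compact open subgroups of `U(2,2)` -/

theorem mat_mul_mat_inv (g : D.U22) : D.mat g * D.mat g⁻¹ = 1 := by
  rw [← mat_mul, mul_inv_cancel, mat_one]

theorem mat_inv_mul_mat (g : D.U22) : D.mat g⁻¹ * D.mat g = 1 := by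
  rw [← mat_mul, inv_mul_cancel, mat_one]

theorem mat_injective : Function.Injective D.mat := fun _ _ h =>
  Subtype.ext (Units.ext h)

theorem exists_mat_eq {X : Matrix (Fin 4) (Fin 4) F} (h : X * D.adj X = 1) :
    ∃ g : D.U22, D.mat g = X :=
  ⟨⟨⟨X, D.adj X, h, mul_eq_one_comm.mp h⟩, h⟩, rfl⟩

/-- The congruence subgroup `P_{Λ,0} ∩ (1 + 𝔞_k)`; for `k ≥ 1` this is `P_{Λ,k}`. -/
def congruenceSubgroup (k : ℤ) : Subgroup D.U22 where
  carrier := {g | D.mat g ∈ D.filtration 0 ∧ D.mat g - 1 ∈ D.filtration k}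
  one_mem' := ⟨by rw [mat_one]; exact D.one_mem_filtration, by simp [mat_one]⟩
  mul_mem' := by
    rintro a b ⟨ha, ha'⟩ ⟨hb, hb'⟩
    refine ⟨by rw [mat_mul]; simpa using D.filtration_mul ha hb, ?_⟩
    have : D.mat (a * b) - 1 = D.mat a * (D.mat b - 1) + (D.mat a - 1) := by
      rw [mat_mul]; noncomm_ring
    rw [this]
    exact add_mem (by simpa using D.filtration_mul ha hb') ha'
  inv_mem' := by
    rintro a ⟨ha, ha'⟩
    refine ⟨by rw [mat_inv]; exact D.adj_mem_filtration ha, ?_⟩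
    have : D.mat a⁻¹ - 1 = D.adj (D.mat a - 1) := by rw [mat_inv, adj_sub, adj_one]
    rw [this]
    exact D.adj_mem_filtration ha'

theorem mat_mem_of_sub_one_mem {k : ℤ} (hk : 0 ≤ k) {g : D.U22} (h : D.mat g - 1 ∈ D.filtration k) :
    D.mat g ∈ D.filtration 0 := by
  have := add_mem (D.filtration_anti hk h) D.one_mem_filtration
  rwa [sub_add_cancel] at this

theorem mem_congruenceSubgroup_of_nonneg {k : ℤ} (hk : 0 ≤ k) {g : D.U22} :
    g ∈ D.congruenceSubgroup k ↔ D.mat g - 1 ∈ D.filtration k :=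
  ⟨fun h => h.2, fun h => ⟨D.mat_mem_of_sub_one_mem hk h, h⟩⟩

theorem congruenceSubgroup_anti {k l : ℤ} (h : k ≤ l) :
    D.congruenceSubgroup l ≤ D.congruenceSubgroup k := fun _ hg =>
  ⟨hg.1, D.filtration_anti h hg.2⟩

theorem isOpen_congruenceSubgroup (k : ℤ) : IsOpen (D.congruenceSubgroup k : Set D.U22) :=
  ((D.isOpen_filtration 0).preimage D.continuous_mat).inter
    ((D.isOpen_filtration k).preimage (D.continuous_mat.sub continuous_const))

theorem isCompact_mat_preimage :
    IsCompact {g : D.U22 | D.mat g ∈ D.filtration 0} := by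
  haveI := t2Space_field F
  have hG : IsClosed (D.unitaryGroup : Set (GL (Fin 4) F)) :=
    isClosed_eq (Units.continuous_val.mul (D.continuous_adj.comp Units.continuous_val))
      continuous_const
  have hemb := (Units.isClosedEmbedding_embedProduct
    (α := Matrix (Fin 4) (Fin 4) F)).comp hG.isClosedEmbedding_subtypeVal
  have hc := (D.isCompact_filtration 0).prod
    ((D.isCompact_filtration 0).image MulOpposite.continuous_op)
  refine (hemb.isCompact_preimage hc).of_isClosed_subset
    ((D.isClosed_filtration 0).preimage D.continuous_mat) fun g hg => ?_
  refine ⟨hg, D.mat g⁻¹, ?_, rfl⟩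
  rw [mat_inv]
  exact D.adj_mem_filtration hg

theorem isCompact_congruenceSubgroup (k : ℤ) : IsCompact (D.congruenceSubgroup k : Set D.U22) :=
  D.isCompact_mat_preimage.of_isClosed_subset
    (Subgroup.isClosed_of_isOpen _ (D.isOpen_congruenceSubgroup k)) fun _ hg => hg.1

/-- The Cayley transform `(1 + X/2)(1 - X/2)⁻¹` of a skew element of `𝔞_k`, `k ≥ 1`, written as
`1 + X + XY`. -/
theorem exists_cayley {k : ℤ} (hk : 1 ≤ k) {X : Matrix (Fin 4) (Fin 4) F}
    (hX : X ∈ D.filtration k) :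
    ∃ Y ∈ D.filtration k, (1 + X + X * Y) * (1 - (2⁻¹ : F) • X) = 1 + (2⁻¹ : F) • X ∧
      ∀ Z, Z * (1 - (2⁻¹ : F) • X) = 1 + (2⁻¹ : F) • X → Z = 1 + X + X * Y := by
  obtain ⟨Y, hY, h1, h2⟩ := D.exists_inv_one_add hk (neg_mem (D.half_mem_filtration hX))
  rw [← sub_eq_add_neg] at h1 h2
  have e : 1 + X + X * Y = 1 + X * (1 + Y) := by noncomm_ring
  have hh := half_add_half D X
  refine ⟨Y, hY, ?_, fun Z hZ => ?_⟩
  · rw [e, add_mul, mul_assoc, h2, one_mul, mul_one]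
    conv_lhs => rw [← hh]
    rw [hh]
    nth_rewrite 2 [← hh]
    abel
  · have : Z = (1 + (2⁻¹ : F) • X) * (1 + Y) := by rw [← hZ, mul_assoc, h1, mul_one]
    rw [this, e, show 1 + (2⁻¹ : F) • X = (1 - (2⁻¹ : F) • X) + X by
      nth_rewrite 3 [← hh]; abel, add_mul, h1]

/-- The Cayley transform of a skew element lies in `G`, which is how enough elements of `G` close to
`1` are obtained. -/
theorem exists_cayley_of_skew {k : ℤ} (hk : 1 ≤ k) {X : Matrix (Fin 4) (Fin 4) F}
    (hX : X ∈ D.filtration k) (hs : D.adj X = -X) :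
    ∃ c : D.U22, D.mat c * (1 - (2⁻¹ : F) • X) = 1 + (2⁻¹ : F) • X ∧
      ∃ Y ∈ D.filtration k, D.mat c = 1 + X + X * Y := by
  obtain ⟨Y, hY, h1, -⟩ := D.exists_cayley hk hX
  obtain ⟨Y', hY', h2, h3⟩ := D.exists_inv_one_add hk (D.half_mem_filtration hX)
  set h := (2⁻¹ : F) • X with hh
  set C := 1 + X + X * Y with hC
  have ha : D.adj h = -h := by rw [hh, adj_smul, D.conj_half, hs, smul_neg]
  have h4 : (1 + h) * D.adj C = 1 - h := by
    have a1 : D.adj (1 - h) = 1 + h := by rw [adj_sub, adj_one, ha, sub_neg_eq_add]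
    have a2 : D.adj (1 + h) = 1 - h := by rw [adj_add, adj_one, ha, ← sub_eq_add_neg]
    rw [← a1, ← adj_mul, h1, a2]
  obtain ⟨c, hc⟩ := D.exists_mat_eq (X := C) (by
    have : D.adj C = (1 + Y') * (1 - h) := by rw [← h4, ← mul_assoc, h3, one_mul]
    have hcomm : (1 + Y') * (1 - h) = (1 - h) * (1 + Y') := by
      have e : (1 - h) * (1 + h) = (1 + h) * (1 - h) := by noncomm_ring
      calc (1 + Y') * (1 - h) = (1 + Y') * ((1 - h) * (1 + h)) * (1 + Y') := by
            rw [mul_assoc, mul_assoc (1 - h), h2, mul_one]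
        _ = (1 - h) * (1 + Y') := by rw [e, ← mul_assoc, h3, one_mul]
    rw [this, hcomm, ← mul_assoc, h1, h2])
  exact ⟨c, by rw [hc, h1], Y, hY, hc⟩

namespace SplitStratum

variable {D} (S : D.SplitStratum)

theorem one_le_n : 1 ≤ S.n := by have := S.m_pos; unfold n; omega

theorem latJ_le : S.latJ ≤ D.filtration S.m := by
  intro X hX
  obtain ⟨Y, Z, h1, -, h3, -, rfl⟩ := (S.mem_latJ_iff X).mp hX
  have := S.m_pos
  rw [S.half_n] at h3
  exact add_mem (D.filtration_anti (by unfold n; omega) h1) h3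

theorem mem_J {g : D.U22} : g ∈ S.J ↔ D.mat g - 1 ∈ S.latJ := Iff.rfl

theorem J_le : S.J ≤ D.congruenceSubgroup S.m := fun _ hg =>
  (D.mem_congruenceSubgroup_of_nonneg (by positivity)).mpr (S.latJ_le hg)

theorem congruenceSubgroup_le_J : D.congruenceSubgroup S.n ≤ S.J := fun _ hg =>
  S.filtration_le_latJ le_rfl hg.2

theorem isOpen_J : IsOpen (S.J : Set D.U22) :=
  Subgroup.isOpen_mono S.congruenceSubgroup_le_J (D.isOpen_congruenceSubgroup _)

theorem isCompact_J : IsCompact (S.J : Set D.U22) :=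
  (D.isCompact_congruenceSubgroup S.m).of_isClosed_subset
    (Subgroup.isClosed_of_isOpen _ S.isOpen_J) S.J_le

theorem Bperp_le_latJ {X : Matrix (Fin 4) (Fin 4) F} (h : X ∈ S.Bperp)
    (h' : X ∈ D.filtration S.m) : X ∈ S.latJ :=
  (S.mem_latJ_iff X).mpr ⟨0, X, zero_mem _, zero_mem _, by rwa [S.half_n], h, by simp⟩

theorem mem_J_of_cayley {c : D.U22} {X Y : Matrix (Fin 4) (Fin 4) F} (hX : X ∈ S.latJ)
    (hY : Y ∈ D.filtration S.m) (hc : D.mat c = 1 + X + X * Y) : c ∈ S.J := by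
  rw [mem_J, hc, show 1 + X + X * Y - 1 = X + X * Y by abel]
  exact add_mem hX (S.filtration_le_latJ (k := S.m + S.m) (by unfold n; omega)
    (D.filtration_mul (S.latJ_le hX) hY))

/-! ### Conjugating small deformations of `β` into `B` -/

theorem continuous_proj : Continuous S.proj := by
  refine continuous_matrix fun i j => ?_
  have h : ∀ a b : Fin 4, Continuous fun X : Matrix (Fin 4) (Fin 4) F => X a b :=
    fun a b => continuous_apply_apply a b
  fin_cases i <;> fin_cases j <;> simp only [proj] <;> simp <;>
    first
      | exact continuous_const
      | exact ((h _ _).add (h _ _)).div_const _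
      | exact ((h _ _).add ((h _ _).div_const _)).div_const _
      | exact ((h _ _).add (continuous_const.mul (h _ _))).div_const _

/-- One step of the approximation: a skew deformation of `β` whose `B^⊥`-part is in `𝔞_{1-s+i}` is
moved by a Cayley transform to one whose `B^⊥`-part is in `𝔞_{2-s+i}`. -/
theorem exists_conj_step {s : ℤ} (hsn : s ≤ S.n) (i : ℕ)
    {X : Matrix (Fin 4) (Fin 4) F} (hskew : D.adj X = -X)
    (h1 : S.proj (X - S.beta) ∈ D.filtration (1 - S.n))
    (h2 : X - S.beta - S.proj (X - S.beta) ∈ D.filtration (1 - s + i)) :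
    ∃ c : D.U22, (∃ x ∈ S.Bperp, x ∈ D.filtration (S.n + 1 - s) ∧ ∃ Y ∈ D.filtration (S.n + 1 - s),
        D.mat c = 1 + x + x * Y) ∧
      S.proj (D.mat c * X * D.mat c⁻¹ - S.beta) ∈ D.filtration (1 - S.n) ∧
      D.mat c * X * D.mat c⁻¹ - S.beta - S.proj (D.mat c * X * D.mat c⁻¹ - S.beta) ∈
        D.filtration (1 - s + (i + 1 : ℕ)) := by
  set b := S.proj (X - S.beta) with hb
  set w := X - S.beta - b with hw
  have hwB : w ∈ S.Bperp := S.sub_proj_mem_Bperp _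
  have hbB : b ∈ S.B := S.proj_mem_B _
  have hskew' : D.adj (X - S.beta) = -(X - S.beta) := by
    rw [adj_sub, hskew, S.adj_beta]; abel
  have hbs : D.adj b = -b := by rw [hb, ← S.proj_adj, hskew', S.proj_neg]
  have hws : D.adj w = -w := by rw [hw, adj_sub, hskew', hbs]; abel
  set t : ℤ := S.n + 1 - s + i with ht
  obtain ⟨x, hxB, hxt, hx⟩ := S.exists_ad_beta (k := t) hwB
    (D.filtration_anti (by omega) h2)
  have hxs : D.adj x = -x := by
    refine eq_neg_of_add_eq_zero_left
      (S.eq_zero_of_commute_beta (add_mem (S.adj_mem_Bperp hxB) hxB) ?_)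
    have := congrArg D.adj hx
    rw [adj_sub, adj_mul, adj_mul, S.adj_beta, hws] at this
    rw [mul_add, add_mul, add_sub_add_comm, hx]
    have e : S.beta * D.adj x - D.adj x * S.beta = D.adj x * -S.beta - -S.beta * D.adj x := by
      noncomm_ring
    rw [e, this, neg_add_cancel]
  have ht1 : 1 ≤ t := by omega
  obtain ⟨c, -, Y, hY, hc⟩ := D.exists_cayley_of_skew ht1 hxt hxs
  have hx0 := D.filtration_anti (show S.n + 1 - s ≤ t by omega) hxt
  have hY0 := D.filtration_anti (show S.n + 1 - s ≤ t by omega) hY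
  have hc' : D.mat c⁻¹ - 1 ∈ D.filtration t := by
    have : D.mat c⁻¹ - 1 = D.adj (x + x * Y) := by
      rw [mat_inv, hc, add_assoc, adj_add, adj_one, add_sub_cancel_left]
    rw [this]
    exact D.adj_mem_filtration (add_mem hxt (D.filtration_anti (by omega) (D.filtration_mul hxt hY)))
  have hci : D.mat c⁻¹ ∈ D.filtration 0 := D.mat_mem_of_sub_one_mem (by omega) hc'
  have hX : X = S.beta + b + w := by rw [hw]; abel
  -- `R` is the difference `c X c⁻¹ - β - b`
  have hR : D.mat c * X * D.mat c⁻¹ - S.beta - b ∈ D.filtration (1 - s + (i + 1 : ℕ)) := by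
    have e1 : D.mat c * X * D.mat c⁻¹ - X = (D.mat c * X - X * D.mat c) * D.mat c⁻¹ := by
      rw [sub_mul, mul_assoc X, D.mat_mul_mat_inv, mul_one]
    set R := (x * Y * S.beta - S.beta * (x * Y)) + ((x + x * Y) * (b + w) - (b + w) * (x + x * Y))
      with hRdef
    have e2 : D.mat c * X - X * D.mat c = -w + R := by
      rw [hc, ← hx, hRdef]
      conv_lhs => rw [hX]
      noncomm_ring
    have e3 : D.mat c * X * D.mat c⁻¹ - S.beta - b =
        -(w * (D.mat c⁻¹ - 1)) + R * D.mat c⁻¹ := by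
      have : D.mat c * X * D.mat c⁻¹ - S.beta - b = D.mat c * X * D.mat c⁻¹ - X + w := by
        nth_rewrite 3 [hX]; abel
      rw [this, e1, e2]
      noncomm_ring
    have hxY : x * Y ∈ D.filtration (t + t) := D.filtration_mul hxt hY
    have hxY' : x + x * Y ∈ D.filtration t := add_mem hxt (D.filtration_anti (by omega) hxY)
    have hbw : b + w ∈ D.filtration (1 - S.n) :=
      add_mem h1 (D.filtration_anti (by omega) h2)
    have hR1 : R ∈ D.filtration (1 - s + (i + 1 : ℕ)) := by
      refine add_mem (sub_mem ?_ ?_) (sub_mem ?_ ?_)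
      · exact D.filtration_anti (by push_cast; omega) (D.filtration_mul hxY S.beta_mem)
      · exact D.filtration_anti (by push_cast; omega) (D.filtration_mul S.beta_mem hxY)
      · exact D.filtration_anti (by push_cast; omega) (D.filtration_mul hxY' hbw)
      · exact D.filtration_anti (by push_cast; omega) (D.filtration_mul hbw hxY')
    rw [e3]
    refine add_mem (neg_mem ?_) ?_
    · exact D.filtration_anti (by push_cast; omega) (D.filtration_mul h2 hc')
    · simpa using D.filtration_mul hR1 hci
  set R := D.mat c * X * D.mat c⁻¹ - S.beta - b with hRdef
  have hsplit : D.mat c * X * D.mat c⁻¹ - S.beta = (b + S.proj R) + (R - S.proj R) := by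
    rw [hRdef]; abel
  have hproj : S.proj (D.mat c * X * D.mat c⁻¹ - S.beta) = b + S.proj R := by
    rw [hsplit]
    exact S.proj_add (add_mem hbB (S.proj_mem_B R)) (S.sub_proj_mem_Bperp R)
  have hpR := S.proj_mem_filtration hR
  refine ⟨c, ⟨x, hxB, hx0, Y, hY0, hc⟩, ?_, ?_⟩
  · rw [hproj]
    exact add_mem h1 (D.filtration_anti (by push_cast; omega) hpR)
  · rw [hproj, hsplit, add_sub_cancel_left]
    exact sub_mem hR hpR

theorem adj_conj_eq_neg {X : Matrix (Fin 4) (Fin 4) F} (h : D.adj X = -X) (g : D.U22) :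
    D.adj (D.mat g * X * D.mat g⁻¹) = -(D.mat g * X * D.mat g⁻¹) := by
  rw [adj_mul, adj_mul, mat_inv, adj_adj, h]
  simp [mul_assoc]

/-- Skew deformations of `β` are conjugate, under a compact group containing enough Cayley
transforms, to deformations inside `B`. -/
theorem exists_conj_mem_B {s : ℤ} (hsn : s ≤ S.n) (K : Subgroup D.U22)
    (hK : IsCompact (K : Set D.U22))
    (hKC : ∀ c : D.U22, ∀ x ∈ S.Bperp, x ∈ D.filtration (S.n + 1 - s) →
      ∀ Y ∈ D.filtration (S.n + 1 - s), D.mat c = 1 + x + x * Y → c ∈ K)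
    {X : Matrix (Fin 4) (Fin 4) F} (hskew : D.adj X = -X)
    (h1 : S.proj (X - S.beta) ∈ D.filtration (1 - S.n))
    (h2 : X - S.beta - S.proj (X - S.beta) ∈ D.filtration (1 - s)) :
    ∃ j ∈ K, D.mat j * X * D.mat j⁻¹ - S.beta ∈ S.B ∧
      D.mat j * X * D.mat j⁻¹ - S.beta ∈ D.filtration (1 - S.n) := by
  haveI := t2Space_field F
  set f : D.U22 → Matrix (Fin 4) (Fin 4) F := fun j => D.mat j * X * D.mat j⁻¹ - S.beta with hf
  have hfc : Continuous f :=
    ((D.continuous_mat.mul continuous_const).mul (D.continuous_mat.comp continuous_inv)).sub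
      continuous_const
  have hpc : Continuous fun j => S.proj (f j) := S.continuous_proj.comp hfc
  let C : ℕ → Set D.U22 := fun i => {j | j ∈ K ∧ S.proj (f j) ∈ D.filtration (1 - S.n) ∧
    f j - S.proj (f j) ∈ D.filtration (1 - s + i)}
  have hcl : ∀ i, IsClosed (C i) := fun i =>
    hK.isClosed.inter (((D.isClosed_filtration _).preimage hpc).inter
      ((D.isClosed_filtration _).preimage (hfc.sub hpc)))
  have hne : ∀ i, (C i).Nonempty := by
    intro i
    induction i with
    | zero => exact ⟨1, one_mem K, by simpa [hf, mat_one] using h1, by simpa [hf, mat_one] using h2⟩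
    | succ i ih =>
      obtain ⟨j, hj, hj1, hj2⟩ := ih
      obtain ⟨c, ⟨x, hx, hx', Y, hY, hc⟩, a1, a2⟩ :=
        S.exists_conj_step hsn i (adj_conj_eq_neg hskew j) hj1 hj2
      have e : D.mat c * (D.mat j * X * D.mat j⁻¹) * D.mat c⁻¹ =
          D.mat (c * j) * X * D.mat (c * j)⁻¹ := by
        rw [_root_.mul_inv_rev, mat_mul, mat_mul]; simp only [mul_assoc]
      rw [e] at a1 a2
      exact ⟨c * j, mul_mem (hKC c x hx hx' Y hY hc) hj, a1, a2⟩
  obtain ⟨j, hj⟩ := IsCompact.nonempty_iInter_of_sequence_nonempty_isCompact_isClosed C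
    (fun i j hj => ⟨hj.1, hj.2.1, D.filtration_anti (by push_cast; omega) hj.2.2⟩) hne
    (hK.of_isClosed_subset (hcl 0) fun j hj => hj.1) hcl
  rw [Set.mem_iInter] at hj
  have hz : f j - S.proj (f j) = 0 := D.eq_zero_of_mem_filtration fun k =>
    D.filtration_anti (by push_cast; omega) (hj (k + s.toNat)).2.2
  refine ⟨j, (hj 0).1, ?_, ?_⟩
  · rw [show D.mat j * X * D.mat j⁻¹ - S.beta = S.proj (f j) from sub_eq_zero.mp hz]
    exact S.proj_mem_B _
  · rw [show D.mat j * X * D.mat j⁻¹ - S.beta = S.proj (f j) from sub_eq_zero.mp hz]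
    exact (hj 0).2.1

end SplitStratum

end UnramifiedQuadratic

namespace UnramifiedQuadratic

variable {F₀ F : Type*} [Field F₀] [ValuativeRel F₀] [TopologicalSpace F₀]
    [IsNonarchimedeanLocalField F₀] [Field F] [ValuativeRel F] [TopologicalSpace F]
    [IsNonarchimedeanLocalField F] [Algebra F₀ F] [ValuativeExtension F₀ F]
    (D : UnramifiedQuadratic F₀ F)

/-! ### Lattice duality and the intertwining of `Ψ` -/

/-- The bilinear form `ϖ⁻¹ tr(XY)` on `A`. It takes values in `𝔬_F` exactly when `tr(XY) ∈ 𝔭_F`. -/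
def scaledTraceForm : LinearMap.BilinForm F (Matrix (Fin 4) (Fin 4) F) :=
  LinearMap.mk₂ F (fun X Y => D.piF⁻¹ * (X * Y).trace)
    (fun X Y Z => by rw [add_mul, trace_add, mul_add])
    (fun c X Y => by rw [smul_mul_assoc, trace_smul, smul_eq_mul, smul_eq_mul]; ring)
    (fun X Y Z => by rw [mul_add, trace_add, mul_add])
    (fun c X Y => by rw [mul_smul_comm, trace_smul, smul_eq_mul, smul_eq_mul]; ring)

theorem scaledTraceForm_apply (X Y : Matrix (Fin 4) (Fin 4) F) :
    D.scaledTraceForm X Y = D.piF⁻¹ * (X * Y).trace := rfl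

/-- The dual `L^* = {X | tr(XY) ∈ 𝔭_F for all Y ∈ L}` of an `𝔬_F`-lattice `L` in `A`. -/
def dualLattice (L : Submodule 𝒪[F] (Matrix (Fin 4) (Fin 4) F)) :
    Submodule 𝒪[F] (Matrix (Fin 4) (Fin 4) F) :=
  D.scaledTraceForm.dualSubmodule L

theorem mem_dualLattice {L : Submodule 𝒪[F] (Matrix (Fin 4) (Fin 4) F)}
    {X : Matrix (Fin 4) (Fin 4) F} :
    X ∈ D.dualLattice L ↔ ∀ Y ∈ L, valuation F (X * Y).trace < 1 := by
  rw [dualLattice, LinearMap.BilinForm.mem_dualSubmodule]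
  refine forall₂_congr fun Y _ => ?_
  rw [scaledTraceForm_apply, D.unif_top, Submodule.mem_one]
  change _ ↔ valuation F _ ≤ valuation F D.piF
  have e : valuation F (D.piF⁻¹ * (X * Y).trace) ≤ 1 ↔
      valuation F (X * Y).trace ≤ valuation F D.piF := by
    rw [map_mul, map_inv₀, inv_mul_le_iff₀ D.val_piF_pos, mul_one]
  rw [← e]
  exact ⟨fun ⟨y, hy⟩ => hy ▸ y.2, fun h => ⟨⟨_, h⟩, rfl⟩⟩

theorem dualLattice_anti {L M : Submodule 𝒪[F] (Matrix (Fin 4) (Fin 4) F)} (h : L ≤ M) :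
    D.dualLattice M ≤ D.dualLattice L := fun X hX => by
  rw [mem_dualLattice] at *
  exact fun Y hY => hX Y (h hY)

/-- Full lattices, expressed by comparison with the filtration. -/
def IsFullLattice (L : Submodule 𝒪[F] (Matrix (Fin 4) (Fin 4) F)) : Prop :=
  ∃ k l : ℤ, D.filtration k ≤ L ∧ L ≤ D.filtration l

theorem fg_filtration (k : ℤ) : (D.filtration k).FG := by
  set e : Fin 4 × Fin 4 → ℤ := fun p => (k + wt p.2 - wt p.1 + 1) / 2 with he
  have h : D.filtration k = Submodule.span 𝒪[F]
      (Set.range fun p : Fin 4 × Fin 4 => Matrix.single p.1 p.2 (D.piF ^ e p)) := by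
    apply le_antisymm
    · intro X hX
      rw [Matrix.matrix_eq_sum_single X]
      refine Submodule.sum_mem _ fun i _ => Submodule.sum_mem _ fun j _ => ?_
      have h0 : D.piF ^ e (i, j) ≠ 0 := zpow_ne_zero _ D.piF_ne_zero
      have hv : valuation F (X i j / D.piF ^ e (i, j)) ≤ 1 := by
        rw [map_div₀, map_zpow₀]
        exact div_le_one_of_le₀ ((D.mem_filtration_iff k X).mp hX i j) zero_le
      have : Matrix.single i j (X i j) = (⟨X i j / D.piF ^ e (i, j), hv⟩ : 𝒪[F]) •
          Matrix.single i j (D.piF ^ e (i, j)) := by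
        rw [Matrix.smul_single]
        congr 1
        exact (div_mul_cancel₀ _ h0).symm
      rw [this]
      exact Submodule.smul_mem _ _ (Submodule.subset_span ⟨(i, j), rfl⟩)
    · rw [Submodule.span_le]
      rintro _ ⟨⟨i, j⟩, rfl⟩
      rw [SetLike.mem_coe, mem_filtration_iff]
      intro a b
      change valuation F (Matrix.single i j (D.piF ^ e (i, j)) a b) ≤ _
      rw [Matrix.single_apply]
      split_ifs with hab
      · obtain ⟨rfl, rfl⟩ := hab
        rw [map_zpow₀]
      · simp
  rw [h]
  exact Submodule.fg_span (Set.finite_range _)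

variable {D}

theorem IsFullLattice.isLattice {L : Submodule 𝒪[F] (Matrix (Fin 4) (Fin 4) F)}
    (hL : D.IsFullLattice L) : Submodule.IsLattice F L := by
  obtain ⟨k, l, h1, h2⟩ := hL
  refine ⟨?_, ?_⟩
  · haveI : Module.Finite 𝒪[F] (D.filtration l) := Module.Finite.iff_fg.mpr (D.fg_filtration l)
    haveI : IsNoetherian 𝒪[F] L := isNoetherian_of_le h2
    exact Module.Finite.iff_fg.mp inferInstance
  · rw [eq_top_iff]
    intro X _
    obtain ⟨r, hr⟩ := D.exists_mem_filtration X
    set t : ℤ := |k| + r with ht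
    have h3 : D.piF ^ t • X ∈ L := h1 (D.filtration_anti (by
      have := le_abs_self k
      have := abs_nonneg k
      omega) (D.smul_mem_filtration (t := t) (by rw [map_zpow₀]) hr))
    have h0 : D.piF ^ t ≠ 0 := zpow_ne_zero _ D.piF_ne_zero
    rw [← inv_smul_smul₀ h0 X]
    exact Submodule.smul_mem _ _ (Submodule.subset_span h3)

theorem IsFullLattice.dual {L : Submodule 𝒪[F] (Matrix (Fin 4) (Fin 4) F)}
    (hL : D.IsFullLattice L) : D.IsFullLattice (D.dualLattice L) := by
  obtain ⟨k, l, h1, h2⟩ := hL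
  refine ⟨1 - l, 1 - k, fun X hX => D.mem_dualLattice.mpr fun Y hY =>
    D.val_trace_mul_lt (by omega) hX (h2 hY), fun X hX => D.mem_filtration_of_trace fun Y hY =>
    D.mem_dualLattice.mp hX Y (h1 hY)⟩

theorem IsFullLattice.sup {L M : Submodule 𝒪[F] (Matrix (Fin 4) (Fin 4) F)}
    (hL : D.IsFullLattice L) (hM : D.IsFullLattice M) : D.IsFullLattice (L ⊔ M) := by
  obtain ⟨k, l, h1, h2⟩ := hL
  obtain ⟨k', l', h1', h2'⟩ := hM
  exact ⟨k, min l l', h1.trans le_sup_left, sup_le (h2.trans (D.filtration_anti (min_le_left _ _)))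
    (h2'.trans (D.filtration_anti (min_le_right _ _)))⟩

theorem IsFullLattice.dual_dual {L : Submodule 𝒪[F] (Matrix (Fin 4) (Fin 4) F)}
    (hL : D.IsFullLattice L) : D.dualLattice (D.dualLattice L) = L := by
  haveI := hL.isLattice
  let b := Module.Free.chooseBasis 𝒪[F] L
  have hb : Submodule.span 𝒪[F] (Set.range (b.extendOfIsLattice F)) = L := by
    have e : Set.range (b.extendOfIsLattice F) = L.subtype '' Set.range b := by
      ext X
      simp
    rw [e, ← Submodule.map_span, b.span_eq, Submodule.map_top, Submodule.range_subtype]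
  have hsymm : D.scaledTraceForm.IsSymm := ⟨fun X Y => by
    simp only [scaledTraceForm_apply, trace_mul_comm X Y]⟩
  have hnd : D.scaledTraceForm.Nondegenerate := by
    refine (LinearMap.IsRefl.nondegenerate_iff_separatingLeft hsymm.isRefl).mpr fun X hX => ?_
    refine SplitStratum.eq_zero_of_trace fun Y => ?_
    exact (mul_eq_zero.mp (hX Y)).resolve_left (inv_ne_zero D.piF_ne_zero)
  have := LinearMap.BilinForm.dualSubmodule_dualSubmodule_of_basis (R := 𝒪[F])
    D.scaledTraceForm hnd hsymm (b.extendOfIsLattice F)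
  rw [hb] at this
  exact this

/-- The dual of an intersection of full lattices is the sum of the duals. -/
theorem IsFullLattice.dual_inf {L M : Submodule 𝒪[F] (Matrix (Fin 4) (Fin 4) F)}
    (hL : D.IsFullLattice L) (hM : D.IsFullLattice M) :
    D.dualLattice (L ⊓ M) ≤ D.dualLattice L ⊔ D.dualLattice M := by
  rw [← (hL.dual.sup hM.dual).dual_dual]
  refine D.dualLattice_anti (le_inf ?_ ?_)
  · conv_rhs => rw [← hL.dual_dual]
    exact D.dualLattice_anti le_sup_left
  · conv_rhs => rw [← hM.dual_dual]
    exact D.dualLattice_anti le_sup_right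

/-- The lattice `g L g⁻¹`. -/
def conjLattice (g : D.U22) (L : Submodule 𝒪[F] (Matrix (Fin 4) (Fin 4) F)) :
    Submodule 𝒪[F] (Matrix (Fin 4) (Fin 4) F) where
  carrier := {X | D.mat g⁻¹ * X * D.mat g ∈ L}
  zero_mem' := by simp
  add_mem' := fun {X Y} hX hY => by
    simp only [Set.mem_ofPred_eq, mul_add, add_mul] at *
    exact add_mem hX hY
  smul_mem' := fun c X hX => by
    simp only [Set.mem_ofPred_eq, mul_smul_comm, smul_mul_assoc] at *
    exact L.smul_mem c hX

theorem mem_conjLattice {g : D.U22} {L : Submodule 𝒪[F] (Matrix (Fin 4) (Fin 4) F)}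
    {X : Matrix (Fin 4) (Fin 4) F} :
    X ∈ conjLattice g L ↔ D.mat g⁻¹ * X * D.mat g ∈ L := Iff.rfl

theorem mat_conj_conj (g : D.U22) (X : Matrix (Fin 4) (Fin 4) F) :
    D.mat g⁻¹ * (D.mat g * X * D.mat g⁻¹) * D.mat g = X := by
  simp only [mul_assoc, D.mat_inv_mul_mat, mul_one]
  rw [← mul_assoc, D.mat_inv_mul_mat, one_mul]

theorem mat_conj_conj' (g : D.U22) (X : Matrix (Fin 4) (Fin 4) F) :
    D.mat g * (D.mat g⁻¹ * X * D.mat g) * D.mat g⁻¹ = X := by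
  simpa using mat_conj_conj g⁻¹ X

theorem IsFullLattice.conj {L : Submodule 𝒪[F] (Matrix (Fin 4) (Fin 4) F)}
    (hL : D.IsFullLattice L) (g : D.U22) : D.IsFullLattice (conjLattice g L) := by
  obtain ⟨k, l, h1, h2⟩ := hL
  obtain ⟨r, hr⟩ := D.exists_mem_filtration (D.mat g)
  have hr' : D.mat g⁻¹ ∈ D.filtration (-(r : ℤ)) := by
    rw [mat_inv]; exact D.adj_mem_filtration hr
  refine ⟨k + 2 * r, l - 2 * r, fun X hX => h1 ?_, fun X hX => ?_⟩
  · exact D.filtration_anti (by omega) (D.filtration_mul (D.filtration_mul hr' hX) hr)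
  · rw [← mat_conj_conj' g X]
    exact D.filtration_anti (by omega) (D.filtration_mul (D.filtration_mul hr (h2 hX)) hr')

theorem mem_dualLattice_conj {g : D.U22} {L : Submodule 𝒪[F] (Matrix (Fin 4) (Fin 4) F)}
    {X : Matrix (Fin 4) (Fin 4) F} (hX : X ∈ D.dualLattice (conjLattice g L)) :
    D.mat g⁻¹ * X * D.mat g ∈ D.dualLattice L := by
  rw [mem_dualLattice] at *
  intro Y hY
  have := hX (D.mat g * Y * D.mat g⁻¹) (by rw [mem_conjLattice, mat_conj_conj]; exact hY)
  rw [mul_assoc, mul_assoc, trace_mul_comm]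
  convert this using 2
  rw [mul_assoc, mul_assoc]

theorem adj_mem_dualLattice {L : Submodule 𝒪[F] (Matrix (Fin 4) (Fin 4) F)}
    (hL : ∀ X ∈ L, D.adj X ∈ L) {X : Matrix (Fin 4) (Fin 4) F} (hX : X ∈ D.dualLattice L) :
    D.adj X ∈ D.dualLattice L := by
  rw [mem_dualLattice] at *
  intro Y hY
  have h : D.adj X * Y = D.adj (D.adj Y * X) := by rw [adj_mul, adj_adj]
  rw [h, trace_adj, D.conj_val, trace_mul_comm]
  exact hX _ (hL Y hY)

theorem half_mem {L : Submodule 𝒪[F] (Matrix (Fin 4) (Fin 4) F)} (D : UnramifiedQuadratic F₀ F)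
    {X : Matrix (Fin 4) (Fin 4) F} (hX : X ∈ L) : (2⁻¹ : F) • X ∈ L :=
  L.smul_mem (⟨2⁻¹, by
    change valuation F (2⁻¹ : F) ≤ 1
    rw [map_inv₀, D.val_two, inv_one]⟩ : 𝒪[F]) hX

namespace SplitStratum

variable (S : D.SplitStratum)

theorem isFullLattice_latJ : D.IsFullLattice S.latJ :=
  ⟨S.n, S.m, S.filtration_le_latJ le_rfl, S.latJ_le⟩

/-- The dual lattice of `𝔍` is contained in `(𝔞_{1-n} ∩ B) ⊕ (𝔞_{1-m} ∩ B^⊥)`. -/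
theorem of_mem_dualLattice_latJ {X : Matrix (Fin 4) (Fin 4) F} (hX : X ∈ D.dualLattice S.latJ) :
    S.proj X ∈ D.filtration (1 - S.n) ∧ X - S.proj X ∈ D.filtration (1 - S.m) := by
  rw [mem_dualLattice] at hX
  have e1 : ∀ Y, (S.proj X * Y).trace = (X * S.proj Y).trace := fun Y => by
    have h1 := S.trace_proj (X := X) (S.proj_mem_B Y)
    have h2 := S.trace_proj (X := Y) (S.proj_mem_B X)
    rw [trace_mul_comm, mul_sub, trace_sub] at h2
    rw [sub_mul, trace_sub] at h1
    exact (sub_eq_zero.mp h2).trans (sub_eq_zero.mp h1).symm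
  refine ⟨D.mem_filtration_of_trace fun Y hY => ?_, D.mem_filtration_of_trace fun Y hY => ?_⟩
  · rw [e1]
    exact hX _ ((S.mem_latJ_iff _).mpr ⟨S.proj Y, 0, S.proj_mem_filtration hY, S.proj_mem_B Y,
      zero_mem _, zero_mem _, add_zero _⟩)
  · rw [sub_mul, trace_sub, e1, ← trace_sub, ← mul_sub]
    exact hX _ (S.Bperp_le_latJ (S.sub_proj_mem_Bperp Y) (sub_mem hY (S.proj_mem_filtration hY)))

/-- On a Cayley transform `1 + X + XY` the function `Ω(tr_{F/F₀} tr(γ(x-1)))` only depends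
on `X`. -/
theorem Ω_cayley {γ X Y : Matrix (Fin 4) (Fin 4) F} {k l : ℤ} (hk : 1 ≤ k + (l + l))
    (hγ : γ ∈ D.filtration k) (hX : X ∈ D.filtration l) (hY : Y ∈ D.filtration l) :
    S.Ω (Algebra.trace F₀ F (γ * (1 + X + X * Y - 1)).trace) =
      S.Ω (Algebra.trace F₀ F (γ * X).trace) := by
  rw [show 1 + X + X * Y - 1 = X + X * Y by abel, mul_add, trace_add, map_add,
    AddChar.map_add_eq_mul, S.Ω_trace (D.val_trace_mul_lt hk hγ (D.filtration_mul hX hY)), mul_one]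

/-- The elements of `G` that intertwine `Ψ` lie in `J G' J`. -/
theorem intertwining {g : D.U22}
    (h : ∀ x ∈ S.J, g⁻¹ * x * g ∈ S.J → S.psi (g⁻¹ * x * g) = S.psi x) :
    ∃ j₁ ∈ S.J, ∃ c ∈ S.Gprime, ∃ j₂ ∈ S.J, g = j₁ * c * j₂ := by
  have hm := S.m_pos
  have hn := S.one_le_n
  set Δ := S.beta - D.mat g * S.beta * D.mat g⁻¹ with hΔ
  have hΔs : D.adj Δ = -Δ := by
    rw [hΔ, adj_sub, adj_conj_eq_neg S.adj_beta, S.adj_beta]; abel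
  have hadj : ∀ X, D.adj (D.mat g⁻¹ * X * D.mat g) = D.mat g⁻¹ * D.adj X * D.mat g := fun X => by
    rw [adj_mul, adj_mul, mat_inv, adj_adj, mul_assoc]
  have hmem : Δ ∈ D.dualLattice (S.latJ ⊓ conjLattice g S.latJ) := by
    rw [mem_dualLattice]
    refine fun X hX => S.val_trace_lt_of_skew hΔs _ ?_ ?_ hX
    · rintro X ⟨h1, h2⟩
      refine ⟨S.adj_mem_latJ h1, ?_⟩
      rw [SetLike.mem_coe, mem_conjLattice] at h2 ⊢
      rw [← hadj]
      exact S.adj_mem_latJ h2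
    · rintro X ⟨h1, h2⟩ hs
      rw [SetLike.mem_coe] at h1
      rw [SetLike.mem_coe, mem_conjLattice] at h2
      set X' := D.mat g⁻¹ * X * D.mat g with hX'
      have hm1 : (1 : ℤ) ≤ S.m := by omega
      obtain ⟨c, hc1, Y, hY, hc⟩ := D.exists_cayley_of_skew hm1 (S.latJ_le h1) hs
      obtain ⟨Y', hY', -, huniq⟩ := D.exists_cayley hm1 (S.latJ_le h2)
      have hc' : D.mat (g⁻¹ * c * g) = 1 + X' + X' * Y' := by
        refine huniq _ ?_
        have a1 : D.mat (g⁻¹ * c * g) = D.mat g⁻¹ * D.mat c * D.mat g := rfl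
        have a2 : ∀ r : F, D.mat g⁻¹ * (1 + r • X) * D.mat g = 1 + r • X' := fun r => by
          rw [mul_add, add_mul, mul_one, D.mat_inv_mul_mat, mul_smul_comm, smul_mul_assoc]
        rw [a1, ← a2, ← hc1, sub_eq_add_neg, ← neg_smul, ← a2, sub_eq_add_neg, ← neg_smul]
        simp only [mul_assoc]
        rw [← mul_assoc (D.mat g) (D.mat g⁻¹), D.mat_mul_mat_inv, one_mul]
      have hJ := S.mem_J_of_cayley h1 hY hc
      have hJ' := S.mem_J_of_cayley h2 hY' hc'
      have key := h c hJ hJ'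
      have hk : (1 : ℤ) ≤ -S.n + (S.m + S.m) := by unfold n; omega
      rw [psi, psi, hc, hc', S.Ω_cayley hk S.beta_mem (S.latJ_le h1) hY,
        S.Ω_cayley hk S.beta_mem (S.latJ_le h2) hY'] at key
      have e : (S.beta * X').trace = (D.mat g * S.beta * D.mat g⁻¹ * X).trace := by
        rw [hX', ← mul_assoc, trace_mul_comm]
        simp only [mul_assoc]
      rw [hΔ, sub_mul, trace_sub, map_sub, ← e, AddChar.map_sub_eq_div, key, div_self']
  obtain ⟨u₁, hu₁, u₂, hu₂, hu⟩ := Submodule.mem_sup.mp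
    (S.isFullLattice_latJ.dual_inf (S.isFullLattice_latJ.conj g) hmem)
  have hu₂' := mem_dualLattice_conj hu₂
  -- pass to the skew parts
  set v₁ := (2⁻¹ : F) • (u₁ - D.adj u₁) with hv₁
  set v₂ := (2⁻¹ : F) • (D.mat g⁻¹ * u₂ * D.mat g - D.adj (D.mat g⁻¹ * u₂ * D.mat g)) with hv₂
  have hJadj : ∀ X ∈ S.latJ, D.adj X ∈ S.latJ := fun X hX => S.adj_mem_latJ hX
  have hv₁d : v₁ ∈ D.dualLattice S.latJ := half_mem D (sub_mem hu₁ (adj_mem_dualLattice hJadj hu₁))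
  have hv₂d : v₂ ∈ D.dualLattice S.latJ :=
    half_mem D (sub_mem hu₂' (adj_mem_dualLattice hJadj hu₂'))
  have skew : ∀ X, D.adj ((2⁻¹ : F) • (X - D.adj X)) = -((2⁻¹ : F) • (X - D.adj X)) := fun X => by
    rw [adj_smul, D.conj_half, adj_sub, adj_adj, ← smul_neg, neg_sub]
  have hsum : Δ = v₁ + D.mat g * v₂ * D.mat g⁻¹ := by
    have e1 : D.mat g * v₂ * D.mat g⁻¹ = (2⁻¹ : F) • (u₂ - D.adj u₂) := by
      rw [hv₂, hadj, ← sub_mul, ← mul_sub, ← smul_mul_assoc, ← mul_smul_comm, mat_conj_conj']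
    rw [e1, hv₁, ← smul_add, sub_add_sub_comm, ← adj_add, hu, hΔs, sub_neg_eq_add, smul_add,
      half_add_half D]
  have hX₁s : D.adj (S.beta - v₁) = -(S.beta - v₁) := by
    rw [adj_sub, S.adj_beta, hv₁, skew]; abel
  have hX₂s : D.adj (S.beta + v₂) = -(S.beta + v₂) := by
    rw [adj_add, S.adj_beta, hv₂, skew]; abel
  have hconj : (S.beta - v₁) * D.mat g = D.mat g * (S.beta + v₂) := by
    have : S.beta - v₁ = D.mat g * (S.beta + v₂) * D.mat g⁻¹ := by
      rw [mul_add, add_mul, sub_eq_iff_eq_add, add_assoc, add_comm _ v₁, ← hsum, hΔ,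
        add_sub_cancel]
    rw [this, mul_assoc, D.mat_inv_mul_mat, mul_one]
  have hsn : (S.m : ℤ) ≤ S.n := by unfold n; omega
  have hKC : ∀ c : D.U22, ∀ x ∈ S.Bperp, x ∈ D.filtration (S.n + 1 - S.m) →
      ∀ Y ∈ D.filtration (S.n + 1 - S.m), D.mat c = 1 + x + x * Y → c ∈ S.J := by
    rw [show S.n + 1 - S.m = S.m by unfold n; omega]
    exact fun c x hx hx' Y hY hc => S.mem_J_of_cayley (S.Bperp_le_latJ hx hx') hY hc
  obtain ⟨a1, a2⟩ := S.of_mem_dualLattice_latJ (neg_mem hv₁d)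
  obtain ⟨a3, a4⟩ := S.of_mem_dualLattice_latJ hv₂d
  obtain ⟨j₁, hj₁, c1, c2⟩ := S.exists_conj_mem_B hsn S.J S.isCompact_J hKC hX₁s
    (by rwa [sub_sub_cancel_left]) (by rwa [sub_sub_cancel_left])
  obtain ⟨j₂, hj₂, c3, c4⟩ := S.exists_conj_mem_B hsn S.J S.isCompact_J hKC hX₂s
    (by rwa [add_sub_cancel_left]) (by rwa [add_sub_cancel_left])
  refine ⟨j₁⁻¹, inv_mem hj₁, j₁ * g * j₂⁻¹, ?_, j₂, hj₂, by group⟩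
  refine S.mem_B_of_intertwine c1 c2 c3 c4 ?_
  rw [add_sub_cancel, add_sub_cancel]
  simp only [mat_mul]
  have f1 := D.mat_inv_mul_mat j₁
  have f2 := D.mat_inv_mul_mat j₂
  calc D.mat j₁ * (S.beta - v₁) * D.mat j₁⁻¹ * (D.mat j₁ * D.mat g * D.mat j₂⁻¹)
      = D.mat j₁ * ((S.beta - v₁) * (D.mat j₁⁻¹ * D.mat j₁) * D.mat g) * D.mat j₂⁻¹ := by
        simp only [mul_assoc]
    _ = D.mat j₁ * (D.mat g * (D.mat j₂⁻¹ * D.mat j₂) * (S.beta + v₂)) * D.mat j₂⁻¹ := by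
        rw [f1, f2, mul_one, mul_one, hconj]
    _ = _ := by simp only [mul_assoc]

end SplitStratum

end UnramifiedQuadratic

namespace HeckeTheory

/-! ### Convolution as a finite sum over cosets -/

section Convolution

variable {G : Type*} [Group G] [TopologicalSpace G] [IsTopologicalGroup G] [LocallyCompactSpace G]
  {J : Subgroup G}

/-- Convolution as a sum over a finite set of representatives of the cosets `yJ` that meet the
support of `f₁`. -/
theorem convolution_eq_sum (hJo : IsOpen (J : Set G)) (hJc : IsCompact (J : Set G)) {f₁ f₂ : G → ℂ}
    {x : G} (T : Finset G) (hT : ∀ a ∈ T, ∀ b ∈ T, a⁻¹ * b ∈ J → a = b)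
    (hs : ∀ y, f₁ y ≠ 0 → ∃ t ∈ T, t⁻¹ * y ∈ J)
    (hinv : ∀ y, ∀ k ∈ J, f₁ (y * k) * f₂ ((y * k)⁻¹ * x) = f₁ y * f₂ (y⁻¹ * x)) :
    convolution J f₁ f₂ x = ∑ t ∈ T, f₁ t * f₂ (t⁻¹ * x) := by
  letI : MeasurableSpace G := borel G
  haveI : BorelSpace G := ⟨rfl⟩
  haveI : (haarNormalized J).IsMulLeftInvariant := by
    unfold haarNormalized; infer_instance
  have hpos : (Measure.haar : Measure G) (J : Set G) ≠ 0 :=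
    (hJo.measure_pos _ ⟨1, one_mem J⟩).ne'
  have hfin : (Measure.haar : Measure G) (J : Set G) ≠ ⊤ := hJc.measure_lt_top.ne
  have hone : haarNormalized J (J : Set G) = 1 := by
    unfold haarNormalized
    rw [Measure.smul_apply, smul_eq_mul, ENNReal.inv_mul_cancel hpos hfin]
  have hset : ∀ t : G, {y | t⁻¹ * y ∈ J} = (fun y => t⁻¹ * y) ⁻¹' (J : Set G) := fun t => rfl
  have hmeas : ∀ t : G, MeasurableSet {y | t⁻¹ * y ∈ J} := fun t => by
    rw [hset]
    exact (hJo.preimage (continuous_const.mul continuous_id)).measurableSet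
  have hvol : ∀ t : G, haarNormalized J {y | t⁻¹ * y ∈ J} = 1 := fun t => by
    rw [hset, measure_preimage_mul, hone]
  have hfun : (fun y => f₁ y * f₂ (y⁻¹ * x)) = fun y => ∑ t ∈ T,
      Set.indicator {y | t⁻¹ * y ∈ J} (fun _ => f₁ t * f₂ (t⁻¹ * x)) y := by
    funext y
    by_cases hy : ∃ t ∈ T, t⁻¹ * y ∈ J
    · obtain ⟨t, ht, hty⟩ := hy
      rw [Finset.sum_eq_single_of_mem t ht]
      · rw [Set.indicator_of_mem (by exact hty)]
        have := hinv t _ hty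
        rwa [mul_inv_cancel_left] at this
      · intro b hb hbt
        refine Set.indicator_of_notMem (fun hby => hbt (hT b hb t ht ?_)) _
        have hby' : b⁻¹ * y ∈ J := hby
        have := mul_mem hby' (inv_mem hty)
        rwa [_root_.mul_inv_rev, inv_inv, mul_assoc, mul_inv_cancel_left] at this
    · have h0 : f₁ y = 0 := by
        by_contra h; exact hy (hs y h)
      rw [h0, zero_mul]
      symm
      exact Finset.sum_eq_zero fun t ht => Set.indicator_of_notMem
        (show y ∉ {y | t⁻¹ * y ∈ J} from fun h => hy ⟨t, ht, h⟩) _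
  unfold convolution
  refine (congrArg (fun φ : G → ℂ => ∫ y, φ y ∂haarNormalized J) hfun).trans ?_
  rw [integral_finsetSum]
  · refine Finset.sum_congr rfl fun t _ => ?_
    rw [integral_indicator_const _ (hmeas t), Measure.real, hvol, ENNReal.toReal_one, one_smul]
  · intro t _
    refine IntegrableOn.integrable_indicator ?_ (hmeas t)
    exact integrableOn_const (by rw [hvol]; exact ENNReal.one_ne_top)

theorem exists_coset_reps (hJo : IsOpen (J : Set G)) {f : G → ℂ} (hf : HasCompactSupport f) :
    ∃ T : Finset G, (∀ a ∈ T, ∀ b ∈ T, a⁻¹ * b ∈ J → a = b) ∧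
      ∀ y, f y ≠ 0 → ∃ t ∈ T, t⁻¹ * y ∈ J := by
  classical
  haveI : DiscreteTopology (G ⧸ J) := QuotientGroup.discreteTopology hJo
  have hfin : ((QuotientGroup.mk : G → G ⧸ J) '' tsupport f).Finite :=
    (hf.isCompact.image QuotientGroup.continuous_mk).finite_of_discrete
  refine ⟨hfin.toFinset.image Quotient.out, ?_, fun y hy => ⟨(QuotientGroup.mk y : G ⧸ J).out, ?_, ?_⟩⟩
  · intro a ha b hb hab
    obtain ⟨c, -, rfl⟩ := Finset.mem_image.mp ha
    obtain ⟨d, -, rfl⟩ := Finset.mem_image.mp hb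
    rw [← QuotientGroup.eq, QuotientGroup.out_eq', QuotientGroup.out_eq'] at hab
    rw [hab]
  · exact Finset.mem_image_of_mem _ (hfin.mem_toFinset.mpr ⟨y, subset_tsupport _ hy, rfl⟩)
  · rw [← QuotientGroup.eq, QuotientGroup.out_eq']

variable {χ : J →* Circle} {f : G → ℂ}

theorem HeckeAlgebra.apply_mul_left (hf : f ∈ HeckeAlgebra J χ) (k : J) (g : G) :
    f (k * g) = ((χ k)⁻¹ : Circle) * f g := by
  have := hf.2 k 1 g
  simpa using this

theorem HeckeAlgebra.apply_mul_right (hf : f ∈ HeckeAlgebra J χ) (g : G) (k : J) :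
    f (g * k) = f g * ((χ k)⁻¹ : Circle) := by
  have := hf.2 1 k g
  simpa using this

theorem HeckeAlgebra.mul_apply_eq_sum (hJo : IsOpen (J : Set G)) (hJc : IsCompact (J : Set G))
    {f₁ f₂ : G → ℂ} (h₁ : f₁ ∈ HeckeAlgebra J χ) (h₂ : f₂ ∈ HeckeAlgebra J χ) (x : G)
    (T : Finset G) (hT : ∀ a ∈ T, ∀ b ∈ T, a⁻¹ * b ∈ J → a = b)
    (hs : ∀ y, f₁ y ≠ 0 → ∃ t ∈ T, t⁻¹ * y ∈ J) :
    convolution J f₁ f₂ x = ∑ t ∈ T, f₁ t * f₂ (t⁻¹ * x) := by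
  refine convolution_eq_sum hJo hJc T hT hs fun y k hk => ?_
  have a := apply_mul_right h₁ y ⟨k, hk⟩
  have b := apply_mul_left h₂ ⟨k, hk⟩⁻¹ (y⁻¹ * x)
  simp only [InvMemClass.coe_inv, map_inv, inv_inv] at a b
  rw [a, _root_.mul_inv_rev, mul_assoc k⁻¹, b, Circle.coe_inv]
  field_simp [Circle.coe_ne_zero]

end Convolution

/-! ### Counting cosets in a chain of subgroups -/

section Count

variable {G : Type*} [Group G]

theorem sum_quotient_out_mem {A B C : Subgroup G} (hBA : B ≤ A) (hCB : C ≤ B)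
    [Fintype (A ⧸ C.subgroupOf A)] [DecidablePred (· ∈ B)] (z : ℂ) :
    (∑ c : A ⧸ C.subgroupOf A, if ((c.out : A) : G) ∈ B then z else 0) = C.relIndex B * z := by
  classical
  let φ := Subgroup.quotientSubgroupOfEmbeddingOfLE C hBA
  haveI : Finite (B ⧸ C.subgroupOf B) := Finite.of_injective φ φ.injective
  haveI := Fintype.ofFinite (B ⧸ C.subgroupOf B)
  have hset : (Finset.univ.filter fun c : A ⧸ C.subgroupOf A => ((c.out : A) : G) ∈ B) =
      Finset.univ.map φ := by
    ext c
    simp only [Finset.mem_filter, Finset.mem_univ, true_and, Finset.mem_map]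
    constructor
    · intro hc
      refine ⟨QuotientGroup.mk ⟨_, hc⟩, ?_⟩
      conv_rhs => rw [← QuotientGroup.out_eq' c]
      rfl
    · rintro ⟨d, rfl⟩
      induction d using QuotientGroup.induction_on with
      | H b =>
        have e : φ (QuotientGroup.mk b) = QuotientGroup.mk (Subgroup.inclusion hBA b) := rfl
        rw [e]
        have h := QuotientGroup.out_eq' (QuotientGroup.mk (Subgroup.inclusion hBA b) :
          A ⧸ C.subgroupOf A)
        have h2 := hCB (Subgroup.mem_subgroupOf.mp (QuotientGroup.eq.mp h.symm))
        have h3 := mul_mem b.2 h2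
        simpa using h3
  rw [← Finset.sum_filter, Finset.sum_const, nsmul_eq_mul, hset, Finset.card_map,
    Subgroup.relIndex, Subgroup.index, Nat.card_eq_fintype_card, Finset.card_univ]

theorem relIndex_chain {N : ℤ → Subgroup G} (hN : Antitone N) {Q : ℕ}
    (hQ : ∀ k, (N (k + 1)).relIndex (N k) = Q) (k : ℤ) (r : ℕ) :
    (N (k + r)).relIndex (N k) = Q ^ r := by
  induction r with
  | zero => simp
  | succ r ih =>
    have h1 := hQ (k + r)
    have := Subgroup.relIndex_mul_relIndex (N (k + r + 1)) (N (k + r)) (N k)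
      (hN (by omega)) (hN (by omega))
    rw [h1, ih] at this
    rw [Nat.cast_succ, ← add_assoc, ← this, pow_succ, mul_comm]

end Count

end HeckeTheory

namespace HeckeTheory

/-! ### Covering data for a character of a compact open subgroup -/

/-- Data that compare the Hecke algebra of a character `χ` of `J` with the one of its restriction to
a subgroup `G'` of a Levi subgroup `M`: opposite unipotent groups `Um`, `Up` normalised by `M`, an
Iwahori decomposition `J = N₀ (J ∩ M) P₀` in which `χ` is trivial on `N₀ ⊆ Um` and `P₀ ⊆ Up`, and
filtrations `N`, `P` of (parts of) `Um`, `Up` that conjugation by `g ∈ G'` shifts by `v g` and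
`-v g`. The last field says that the elements intertwining `χ` lie in `J G' J`. -/
structure Cover {G : Type*} [Group G] (J : Subgroup G) (χ : J →* Circle) (G' : Subgroup G) where
  Um : Subgroup G
  Up : Subgroup G
  M : Subgroup G
  N : ℤ → Subgroup G
  P : ℤ → Subgroup G
  v : G → ℤ
  Q : ℕ
  Q_ne : Q ≠ 0
  N_le : ∀ k, N k ≤ Um
  P_le : ∀ k, P k ≤ Up
  N_anti : Antitone N
  P_anti : Antitone P
  N_zero_le : N 0 ≤ J
  P_zero_le : P 0 ≤ J
  conj_Um : ∀ m ∈ M, ∀ u ∈ Um, m * u * m⁻¹ ∈ Um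
  conj_Up : ∀ m ∈ M, ∀ u ∈ Up, m * u * m⁻¹ ∈ Up
  unique : ∀ u ∈ Um, ∀ m ∈ M, ∀ p ∈ Up, u * m * p = 1 → u = 1 ∧ m = 1 ∧ p = 1
  decomp : ∀ j ∈ J, ∃ q ∈ N 0, ∃ l ∈ J ⊓ M, ∃ p ∈ P 0, j = q * l * p
  conj_N : ∀ l ∈ J ⊓ M, ∀ k, ∀ q ∈ N k, l * q * l⁻¹ ∈ N k
  conj_P : ∀ l ∈ J ⊓ M, ∀ k, ∀ q ∈ P k, l * q * l⁻¹ ∈ P k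
  le_M : G' ≤ M
  conj_L : ∀ g ∈ G', ∀ l ∈ J ⊓ M, g * l * g⁻¹ ∈ J
  v_mul : ∀ g ∈ G', ∀ h ∈ G', v (g * h) = v g + v h
  v_J : ∀ g ∈ G', g ∈ J → v g = 0
  shift_N : ∀ g ∈ G', ∀ k, ∀ q ∈ N k, g * q * g⁻¹ ∈ N (k + v g)
  shift_P : ∀ g ∈ G', ∀ k, ∀ q ∈ P k, g * q * g⁻¹ ∈ P (k - v g)
  index_N : ∀ k, (N (k + 1)).relIndex (N k) = Q
  index_P : ∀ k, (P (k + 1)).relIndex (P k) = Q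
  χ_N : ∀ j : J, (j : G) ∈ N 0 → χ j = 1
  χ_P : ∀ j : J, (j : G) ∈ P 0 → χ j = 1
  χ_conj : ∀ g ∈ G', ∀ x y : J, (y : G) = g⁻¹ * x * g → χ y = χ x
  intertwine : ∀ g, (∀ x y : J, (y : G) = g⁻¹ * x * g → χ y = χ x) →
    ∃ j₁ ∈ J, ∃ c ∈ G', ∃ j₂ ∈ J, g = j₁ * c * j₂

namespace Cover

variable {G : Type*} [Group G] {J : Subgroup G} {χ : J →* Circle} {G' : Subgroup G}

/-- Exchange of the two opposite unipotent groups. -/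
def symm (C : Cover J χ G') : Cover J χ G' where
  Um := C.Up
  Up := C.Um
  M := C.M
  N := C.P
  P := C.N
  v g := -C.v g
  Q := C.Q
  Q_ne := C.Q_ne
  N_le := C.P_le
  P_le := C.N_le
  N_anti := C.P_anti
  P_anti := C.N_anti
  N_zero_le := C.P_zero_le
  P_zero_le := C.N_zero_le
  conj_Um := C.conj_Up
  conj_Up := C.conj_Um
  unique := fun u hu m hm p hp h => by
    obtain ⟨h1, h2, h3⟩ := C.unique _ (inv_mem hp) _ (inv_mem hm) _ (inv_mem hu) (by
      rw [← _root_.inv_inj, inv_one, ← h]; group)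
    exact ⟨inv_eq_one.mp h3, inv_eq_one.mp h2, inv_eq_one.mp h1⟩
  decomp := fun j hj => by
    obtain ⟨q, hq, l, hl, p, hp, e⟩ := C.decomp _ (inv_mem hj)
    exact ⟨p⁻¹, inv_mem hp, l⁻¹, inv_mem hl, q⁻¹, inv_mem hq, by
      rw [← _root_.inv_inj, e]; group⟩
  conj_N := C.conj_P
  conj_P := C.conj_N
  le_M := C.le_M
  conj_L := C.conj_L
  v_mul := fun g hg h hh => by rw [C.v_mul g hg h hh]; ring
  v_J := fun g hg h => by rw [C.v_J g hg h, neg_zero]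
  shift_N := fun g hg k q hq => by rw [← sub_eq_add_neg]; exact C.shift_P g hg k q hq
  shift_P := fun g hg k q hq => by rw [sub_neg_eq_add]; exact C.shift_N g hg k q hq
  index_N := C.index_P
  index_P := C.index_N
  χ_N := C.χ_P
  χ_P := C.χ_N
  χ_conj := C.χ_conj
  intertwine := C.intertwine

variable (C : Cover J χ G')

theorem v_one : C.v 1 = 0 := C.v_J 1 (one_mem _) (one_mem _)

theorem v_inv {g : G} (hg : g ∈ G') : C.v g⁻¹ = -C.v g := by
  have := C.v_mul g hg g⁻¹ (inv_mem hg)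
  rw [mul_inv_cancel, C.v_one] at this
  omega

theorem conj_L_inv {g l : G} (hg : g ∈ G') (hl : l ∈ J ⊓ C.M) : g⁻¹ * l * g ∈ J ⊓ C.M := by
  refine ⟨by simpa using C.conj_L _ (inv_mem hg) l hl, ?_⟩
  exact C.M.mul_mem (C.M.mul_mem (C.M.inv_mem (C.le_M hg)) hl.2) (C.le_M hg)

/-- For `v g ≥ 0` one has `J g J = N₀ g (J ∩ M) P₀`. -/
theorem exists_of_mem_doubleCoset {g : G} (hg : g ∈ G') (hv : 0 ≤ C.v g) {j₁ j₂ : G} (h₁ : j₁ ∈ J)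
    (h₂ : j₂ ∈ J) : ∃ q ∈ C.N 0, ∃ l ∈ J ⊓ C.M, ∃ p ∈ C.P 0, j₁ * g * j₂ = q * (g * l) * p := by
  obtain ⟨q, hq, l, hl, p, hp, rfl⟩ := C.decomp _ h₁
  have hp' : g⁻¹ * p * g ∈ C.P 0 := by
    have := C.shift_P _ (inv_mem hg) 0 p hp
    rw [C.v_inv hg, inv_inv] at this
    exact C.P_anti (by omega) this
  have hl' := C.conj_L_inv hg hl
  obtain ⟨q', hq', l', hl', p', hp', e⟩ := C.decomp _
    (mul_mem (mul_mem hl'.1 (C.P_zero_le hp')) h₂)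
  have hq'' : g * q' * g⁻¹ ∈ C.N 0 := C.N_anti (by omega) (C.shift_N g hg 0 q' hq')
  refine ⟨q * (g * q' * g⁻¹), mul_mem hq hq'', l', hl', p', hp', ?_⟩
  calc q * l * p * g * j₂ = q * g * (g⁻¹ * l * g * (g⁻¹ * p * g) * j₂) := by group
    _ = _ := by rw [e]; group

theorem eq_of_mul_eq {q m q' m' p : G} (hq : q ∈ C.Um) (hm : m ∈ C.M) (hq' : q' ∈ C.Um)
    (hm' : m' ∈ C.M) (hp : p ∈ C.Up) (h : q * m = q' * m' * p) : q = q' ∧ m = m' ∧ p = 1 := by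
  have hx : m⁻¹ * (q⁻¹ * q') * m ∈ C.Um := by
    simpa using C.conj_Um _ (inv_mem hm) _ (mul_mem (inv_mem hq) hq')
  obtain ⟨h1, h2, h3⟩ := C.unique _ hx _ (mul_mem (inv_mem hm) hm') p hp (by
    calc m⁻¹ * (q⁻¹ * q') * m * (m⁻¹ * m') * p = m⁻¹ * q⁻¹ * (q' * m' * p) := by group
      _ = 1 := by rw [← h]; group)
  refine ⟨?_, inv_mul_eq_one.mp h2, h3⟩
  have : q⁻¹ * q' = 1 := by
    rw [← conj_eq_one_iff (a := m⁻¹), inv_inv]; exact h1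
  exact inv_mul_eq_one.mp this

/-- An element `q m` of `Um M` lies in the double coset `J h J` of `h ∈ G'` only in the obvious
cases. -/
theorem of_mem_doubleCoset {q m h j₁ j₂ : G} (hq : q ∈ C.Um) (hm : m ∈ C.M) (hh : h ∈ G')
    (h₁ : j₁ ∈ J) (h₂ : j₂ ∈ J) (e : q * m = j₁ * h * j₂) :
    ∃ l ∈ J ⊓ C.M, m = h * l ∧ (q ∈ C.N 0 ∨ q ∈ C.N (C.v h)) := by
  rcases le_total 0 (C.v h) with hv | hv
  · obtain ⟨q', hq', l, hl, p, hp, e'⟩ := C.exists_of_mem_doubleCoset hh hv h₁ h₂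
    rw [e'] at e
    obtain ⟨rfl, rfl, -⟩ := C.eq_of_mul_eq hq hm (C.N_le _ hq') (mul_mem (C.le_M hh) hl.2)
      (C.P_le _ hp) e
    exact ⟨l, hl, rfl, Or.inl hq'⟩
  · have hv' : 0 ≤ C.symm.v h := by change 0 ≤ -C.v h; omega
    obtain ⟨p, hp, l, hl, q', hq', e'⟩ := C.symm.exists_of_mem_doubleCoset hh hv' h₁ h₂
    replace hp : p ∈ C.P 0 := hp
    replace hl : l ∈ J ⊓ C.M := hl
    replace hq' : q' ∈ C.N 0 := hq'
    have hhl : h * l ∈ C.M := mul_mem (C.le_M hh) hl.2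
    rw [e'] at e
    set q'' := h * l * q' * (h * l)⁻¹ with hq''
    have hmem : q'' ∈ C.N (C.v h) := by
      have := C.shift_N h hh 0 _ (C.conj_N l hl 0 q' hq')
      rw [zero_add] at this
      convert this using 1
      rw [hq'']; group
    have e2 : q'' * (h * l) = q * m * (q * m)⁻¹ * p⁻¹ * (q * m) := by
      rw [e, hq'']; group
    -- move `p` to the right, through `q m`
    have e3 : p⁻¹ = q'' * (h * l * m⁻¹) * q⁻¹ := by
      have : p⁻¹ * (q * m) = q'' * (h * l) := by rw [e2]; group
      calc p⁻¹ = p⁻¹ * (q * m) * m⁻¹ * q⁻¹ := by group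
        _ = _ := by rw [this]; group
    set y := h * l * m⁻¹ with hy
    have hyM : y ∈ C.M := mul_mem hhl (inv_mem hm)
    have hqy : y * q⁻¹ * y⁻¹ ∈ C.Um := C.conj_Um y hyM _ (inv_mem hq)
    obtain ⟨a1, a2, -⟩ := C.unique _ (mul_mem (C.N_le _ hmem) hqy) y hyM p (C.P_le _ hp) (by
      calc q'' * (y * q⁻¹ * y⁻¹) * y * p = q'' * y * q⁻¹ * p := by group
        _ = 1 := by rw [← e3]; group)
    have a3 : m = h * l := by rw [eq_comm, ← mul_inv_eq_one]; exact a2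
    rw [a2, one_mul, inv_one, mul_one, mul_inv_eq_one] at a1
    exact ⟨l, hl, a3, Or.inr (a1 ▸ hmem)⟩

theorem mem_J_of_mem_doubleCoset (C : Cover J χ G') {g h j₁ j₂ : G} (hg : g ∈ G') (hh : h ∈ G') (h₁ : j₁ ∈ J)
    (h₂ : j₂ ∈ J) (e : g = j₁ * h * j₂) : h⁻¹ * g ∈ J := by
  obtain ⟨l, hl, e', -⟩ := C.of_mem_doubleCoset (one_mem _) (C.le_M hg) hh h₁ h₂
    (by rw [one_mul, e])
  rw [e', inv_mul_cancel_left]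
  exact hl.1

theorem v_eq_of_inv_mul_mem {g h : G} (hg : g ∈ G') (hh : h ∈ G') (e : h⁻¹ * g ∈ J) :
    C.v g = C.v h := by
  have h1 := C.v_J _ (mul_mem (inv_mem hh) hg) e
  rw [C.v_mul _ (inv_mem hh) _ hg, C.v_inv hh] at h1
  omega

/-- If `g⁻¹ j g` with `j ∈ J` and `v g ≥ 0` lies in `J G' J`, then it lies in `J`. -/
theorem conj_mem_J (C : Cover J χ G') {g j : G} (hg : g ∈ G') (hv : 0 ≤ C.v g) (hj : j ∈ J) {h j₁ j₂ : G}
    (hh : h ∈ G') (h₁ : j₁ ∈ J) (h₂ : j₂ ∈ J) (e : g⁻¹ * j * g = j₁ * h * j₂) :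
    g⁻¹ * j * g ∈ J := by
  obtain ⟨q, hq, l, hl, p, hp, rfl⟩ := C.decomp _ hj
  have hp' : g⁻¹ * p * g ∈ C.P 0 := by
    have := C.shift_P _ (inv_mem hg) 0 p hp
    rw [C.v_inv hg, inv_inv] at this
    exact C.P_anti (by omega) this
  have hl' := C.conj_L_inv hg hl
  have hq' : g⁻¹ * q * g ∈ C.Um := by
    simpa using C.conj_Um _ (inv_mem (C.le_M hg)) _ (C.N_le _ hq)
  have hpJ := C.P_zero_le hp'
  have e0 : g⁻¹ * (q * l * p) * g = g⁻¹ * q * g * (g⁻¹ * l * g) * (g⁻¹ * p * g) := by group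
  rw [e0] at e ⊢
  obtain ⟨l', hl'', e', hor⟩ := C.of_mem_doubleCoset hq' hl'.2 hh h₁ (mul_mem h₂ (inv_mem hpJ))
    (by rw [← mul_assoc (j₁ * h), ← e, mul_inv_cancel_right])
  refine mul_mem (mul_mem ?_ hl'.1) hpJ
  have hhJ : h ∈ J := by
    have : h = g⁻¹ * l * g * l'⁻¹ := by rw [e', mul_inv_cancel_right]
    rw [this]
    exact mul_mem hl'.1 (inv_mem hl''.1)
  rw [C.v_J h hh hhJ, or_self] at hor
  exact C.N_zero_le hor

end Cover

end HeckeTheory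

namespace HeckeTheory

namespace Cover

/-! ### The support-preserving isomorphism of Hecke algebras -/

section Reps

variable {G : Type*} [Group G] [TopologicalSpace G] [IsTopologicalGroup G] [LocallyCompactSpace G]
  {J : Subgroup G} {χ : J →* Circle} {G' : Subgroup G} (C : Cover J χ G')

theorem exists_of_apply_ne_zero (C : Cover J χ G') {f : G → ℂ} (hf : f ∈ HeckeAlgebra J χ) {g : G}
    (hg : f g ≠ 0) : ∃ j₁ ∈ J, ∃ c ∈ G', ∃ j₂ ∈ J, g = j₁ * c * j₂ := by
  refine C.intertwine g fun x y hxy => ?_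
  have h1 := HeckeAlgebra.apply_mul_left hf x g
  have h2 := HeckeAlgebra.apply_mul_right hf g y
  have e : (x : G) * g = g * y := by rw [hxy]; group
  rw [e, h2, mul_comm] at h1
  have h3 := mul_right_cancel₀ hg h1
  exact inv_injective (Circle.ext h3)

/-- A function in the Hecke algebra is determined by its restriction to `G'`. -/
theorem ext_of_forall_mem (C : Cover J χ G') {f₁ f₂ : G → ℂ} (h₁ : f₁ ∈ HeckeAlgebra J χ)
    (h₂ : f₂ ∈ HeckeAlgebra J χ) (h : ∀ g ∈ G', f₁ g = f₂ g) : f₁ = f₂ := by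
  funext x
  by_cases hx : ∃ j₁ ∈ J, ∃ c ∈ G', ∃ j₂ ∈ J, x = j₁ * c * j₂
  · obtain ⟨j₁, hj₁, c, hc, j₂, hj₂, rfl⟩ := hx
    have a := h₁.2 ⟨j₁, hj₁⟩ ⟨j₂, hj₂⟩ c
    have b := h₂.2 ⟨j₁, hj₁⟩ ⟨j₂, hj₂⟩ c
    rw [a, b, h c hc]
  · have a : f₁ x = 0 := by
      by_contra h0; exact hx (C.exists_of_apply_ne_zero h₁ h0)
    have b : f₂ x = 0 := by
      by_contra h0; exact hx (C.exists_of_apply_ne_zero h₂ h0)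
    rw [a, b]

theorem apply_mul_of_mem_N {f : G → ℂ} (hf : f ∈ HeckeAlgebra J χ) {q : G} (hq : q ∈ C.N 0)
    (g : G) : f (q * g) = f g := by
  have := HeckeAlgebra.apply_mul_left hf ⟨q, C.N_zero_le hq⟩ g
  rw [C.χ_N _ hq] at this
  simpa using this

theorem apply_mul_N {f : G → ℂ} (hf : f ∈ HeckeAlgebra J χ) (g : G) {q : G} (hq : q ∈ C.N 0) :
    f (g * q) = f g := by
  have := HeckeAlgebra.apply_mul_right hf g ⟨q, C.N_zero_le hq⟩
  rw [C.χ_N _ hq] at this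
  simpa using this

/-- The function vanishes unless `q * m` lies in a double coset of an element of `G'`, which
restricts `q` to the larger of `N 0` and `N (v m)`. -/
theorem apply_Um_mul {f : G → ℂ} (hf : f ∈ HeckeAlgebra J χ) {q m : G} (hq : q ∈ C.Um)
    (hm : m ∈ G') [Decidable (q ∈ C.N 0 ∨ q ∈ C.N (C.v m))] :
    f (q * m) = if q ∈ C.N 0 ∨ q ∈ C.N (C.v m) then f m else 0 := by
  split_ifs with h
  · rcases h with h | h
    · exact C.apply_mul_of_mem_N hf h m
    · have h' : m⁻¹ * q * m ∈ C.N 0 := by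
        have := C.shift_N _ (inv_mem hm) _ _ h
        rw [C.v_inv hm, inv_inv, add_neg_cancel] at this
        exact this
      rw [show q * m = m * (m⁻¹ * q * m) by group]
      exact C.apply_mul_N hf m h'
  · by_contra h0
    obtain ⟨j₁, hj₁, c, hc, j₂, hj₂, e⟩ := C.exists_of_apply_ne_zero hf h0
    obtain ⟨l, hl, e', hor⟩ := C.of_mem_doubleCoset hq (C.le_M hm) hc hj₁ hj₂ e
    have : C.v m = C.v c := C.v_eq_of_inv_mul_mem hm hc (by
      rw [e', inv_mul_cancel_left]; exact hl.1)
    rw [← this] at hor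
    exact h hor

/-- The normalising factor `c(g) = Q^{-|v g|/2}`, the inverse square root of the number of cosets
of `J` in `J g J`. -/
def factor (g : G) : ℝ := √(C.Q : ℝ) ^ (-|C.v g|)

theorem sqrt_Q_pos : 0 < √(C.Q : ℝ) :=
  Real.sqrt_pos.mpr (by exact_mod_cast Nat.pos_of_ne_zero C.Q_ne)

theorem factor_pos (g : G) : 0 < C.factor g := zpow_pos C.sqrt_Q_pos _

theorem factor_ne_zero (g : G) : (C.factor g : ℂ) ≠ 0 := by
  exact_mod_cast (C.factor_pos g).ne'

theorem symm_factor (g : G) : C.symm.factor g = C.factor g := by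
  unfold factor
  rw [show C.symm.v g = -C.v g from rfl, abs_neg]
  rfl

theorem factor_congr {g h : G} (e : C.v g = C.v h) : C.factor g = C.factor h := by
  rw [factor, factor, e]

theorem factor_inv {g : G} (hg : g ∈ G') : C.factor g⁻¹ = C.factor g := by
  rw [factor, factor, C.v_inv hg, abs_neg]

/-- Representatives `q * g`, `q ∈ N 0 / N (v g)`, of the left cosets of `J` in `J g J`. Counting the
`q` for which `f ((q * g)⁻¹ * x)` does not vanish gives the multiplicativity, up to the normalising
factors, of convolution with a function supported on `J g J`. -/
theorem exists_reps_of_nonneg {g : G} (hg : g ∈ G') (hv : 0 ≤ C.v g) : ∃ T : Finset G,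
    (∀ t ∈ T, ∃ j ∈ J, t = j * g ∧ ∀ f ∈ HeckeAlgebra J χ, f t = f g) ∧
    (∀ a ∈ T, ∀ b ∈ T, a⁻¹ * b ∈ J → a = b) ∧
    (∀ j₁ ∈ J, ∀ j₂ ∈ J, ∃ t ∈ T, t⁻¹ * (j₁ * g * j₂) ∈ J) ∧
    ∀ f ∈ HeckeAlgebra J χ, ∀ x ∈ G',
      (C.factor g : ℂ) * C.factor (g⁻¹ * x) * ∑ t ∈ T, f (t⁻¹ * x) =
        C.factor x * f (g⁻¹ * x) := by
  classical
  obtain ⟨a, ha⟩ := Int.eq_ofNat_of_zero_le hv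
  have hidx : (C.N a).relIndex (C.N 0) = C.Q ^ a := by
    simpa using relIndex_chain C.N_anti C.index_N 0 a
  haveI : Finite (C.N 0 ⧸ (C.N a).subgroupOf (C.N 0)) :=
    Nat.finite_of_card_ne_zero (by
      rw [← Subgroup.index, ← Subgroup.relIndex, hidx]; exact pow_ne_zero _ C.Q_ne)
  letI := Fintype.ofFinite (C.N 0 ⧸ (C.N a).subgroupOf (C.N 0))
  have hconj : ∀ q : G, ∀ k : ℤ, g⁻¹ * q * g ∈ C.N k ↔ q ∈ C.N (k + a) := by
    intro q k
    constructor
    · intro h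
      have := C.shift_N g hg _ _ h
      rw [ha] at this
      convert this using 1
      group
    · intro h
      have := C.shift_N _ (inv_mem hg) _ _ h
      rw [C.v_inv hg, ha, inv_inv, add_neg_cancel_right] at this
      exact this
  let φ : C.N 0 ⧸ (C.N a).subgroupOf (C.N 0) → G := fun c => (c.out : G) * g
  have hφ : ∀ c d, (φ c)⁻¹ * φ d ∈ J → c = d := by
    intro c d h
    have e : (φ c)⁻¹ * φ d = g⁻¹ * ((c.out : G)⁻¹ * d.out) * g := by
      simp only [φ]; group
    rw [e] at h
    have hU : g⁻¹ * ((c.out : G)⁻¹ * d.out) * g ∈ C.Um := by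
      simpa using C.conj_Um _ (inv_mem (C.le_M hg)) _ (C.N_le 0 (mul_mem (inv_mem c.out.2) d.out.2))
    obtain ⟨l, hl, -, hor⟩ := C.of_mem_doubleCoset hU (one_mem C.M) (one_mem G') h (one_mem J)
      (by group)
    rw [C.v_one, or_self, hconj, zero_add] at hor
    rw [← QuotientGroup.out_eq' c, ← QuotientGroup.out_eq' d, QuotientGroup.eq,
      Subgroup.mem_subgroupOf]
    exact hor
  refine ⟨Finset.univ.image φ, ?_, ?_, ?_, ?_⟩
  · intro t ht
    obtain ⟨c, -, rfl⟩ := Finset.mem_image.mp ht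
    exact ⟨c.out, C.N_zero_le c.out.2, rfl, fun f hf => C.apply_mul_of_mem_N hf c.out.2 g⟩
  · intro s hs t ht hst
    obtain ⟨c, -, rfl⟩ := Finset.mem_image.mp hs
    obtain ⟨d, -, rfl⟩ := Finset.mem_image.mp ht
    rw [hφ c d hst]
  · intro j₁ h₁ j₂ h₂
    obtain ⟨q, hq, l, hl, p, hp, e⟩ := C.exists_of_mem_doubleCoset hg hv h₁ h₂
    set c : C.N 0 ⧸ (C.N a).subgroupOf (C.N 0) := QuotientGroup.mk ⟨q, hq⟩ with hc
    refine ⟨φ c, Finset.mem_image_of_mem _ (Finset.mem_univ _), ?_⟩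
    have h1 : (c.out : G)⁻¹ * q ∈ C.N a := by
      have := QuotientGroup.eq.mp ((QuotientGroup.out_eq' c).trans hc)
      exact Subgroup.mem_subgroupOf.mp this
    have h2 : g⁻¹ * ((c.out : G)⁻¹ * q) * g ∈ C.N 0 := by rw [hconj, zero_add]; exact h1
    have e2 : (φ c)⁻¹ * (j₁ * g * j₂) = g⁻¹ * ((c.out : G)⁻¹ * q) * g * l * p := by
      rw [e]; simp only [φ]; group
    rw [e2]
    exact mul_mem (mul_mem (C.N_zero_le h2) hl.1) (C.P_zero_le hp)
  · intro f hf x hx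
    have hgx : g⁻¹ * x ∈ G' := mul_mem (inv_mem hg) hx
    have hvgx : C.v (g⁻¹ * x) = C.v x - a := by
      rw [C.v_mul _ (inv_mem hg) _ hx, C.v_inv hg, ha]; ring
    obtain ⟨j, hj⟩ : ∃ j : ℕ, (j : ℤ) = max 0 (min (a : ℤ) (C.v x)) :=
      ⟨(max 0 (min (a : ℤ) (C.v x))).toNat, Int.toNat_of_nonneg (le_max_left _ _)⟩
    have hja : j ≤ a := by omega
    rw [Finset.sum_image fun c _ d _ h => hφ c d (by rw [h, inv_mul_cancel]; exact one_mem J)]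
    have hterm : ∀ c, f ((φ c)⁻¹ * x) =
        if ((c.out : C.N 0) : G) ∈ C.N j then f (g⁻¹ * x) else 0 := by
      intro c
      have e : (φ c)⁻¹ * x = g⁻¹ * (c.out : G)⁻¹ * g * (g⁻¹ * x) := by simp only [φ]; group
      have hU : g⁻¹ * (c.out : G)⁻¹ * g ∈ C.Um := by
        simpa using C.conj_Um _ (inv_mem (C.le_M hg)) _ (inv_mem (C.N_le 0 c.out.2))
      rw [e, C.apply_Um_mul hf hU hgx]
      refine if_congr ?_ rfl rfl
      rw [hconj, hconj, hvgx, zero_add, sub_add_cancel, inv_mem_iff, inv_mem_iff]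
      constructor
      · rintro (h | h)
        · exact C.N_anti (by omega) h
        · rcases le_total 0 (C.v x) with h0 | h0
          · exact C.N_anti (by omega) h
          · exact C.N_anti (by omega) c.out.2
      · intro h
        by_cases h0 : (a : ℤ) ≤ C.v x
        · exact Or.inl (C.N_anti (by omega) h)
        · exact Or.inr (C.N_anti (by omega) h)
    rw [Finset.sum_congr rfl fun c _ => hterm c,
      sum_quotient_out_mem (C.N_anti (by omega)) (C.N_anti (by omega))]
    have hrel : (C.N a).relIndex (C.N j) = C.Q ^ (a - j) := by
      have := relIndex_chain C.N_anti C.index_N j (a - j)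
      rwa [show (j : ℤ) + (a - j : ℕ) = a by omega] at this
    rw [hrel]
    have hr := C.sqrt_Q_pos.ne'
    have hQ : ((C.Q ^ (a - j) : ℕ) : ℝ) = √(C.Q : ℝ) ^ (2 * ((a : ℤ) - j)) := by
      rw [_root_.zpow_mul, show √(C.Q : ℝ) ^ (2 : ℤ) = C.Q by
        rw [zpow_ofNat]; exact Real.sq_sqrt (Nat.cast_nonneg _),
        show (a : ℤ) - j = ((a - j : ℕ) : ℤ) by omega, zpow_natCast]
      push_cast
      rfl
    have key : C.factor g * C.factor (g⁻¹ * x) * ((C.Q ^ (a - j) : ℕ) : ℝ) = C.factor x := by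
      rw [hQ, factor, factor, factor, ← zpow_add₀ hr, ← zpow_add₀ hr, hvgx, ha]
      congr 1
      rcases abs_cases ((a : ℤ) : ℤ) with h1 | h1 <;> rcases abs_cases (C.v x - a) with h2 | h2 <;>
        rcases abs_cases (C.v x) with h3 | h3 <;> omega
    rw [← key]
    push_cast
    ring

/-- Representatives of `J g J / J` for `g ∈ G'`, and the resulting value of a convolution. -/
theorem exists_reps {g : G} (hg : g ∈ G') : ∃ T : Finset G,
    (∀ t ∈ T, ∃ j ∈ J, t = j * g ∧ ∀ f ∈ HeckeAlgebra J χ, f t = f g) ∧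
    (∀ a ∈ T, ∀ b ∈ T, a⁻¹ * b ∈ J → a = b) ∧
    (∀ j₁ ∈ J, ∀ j₂ ∈ J, ∃ t ∈ T, t⁻¹ * (j₁ * g * j₂) ∈ J) ∧
    ∀ f ∈ HeckeAlgebra J χ, ∀ x ∈ G',
      (C.factor g : ℂ) * C.factor (g⁻¹ * x) * ∑ t ∈ T, f (t⁻¹ * x) =
        C.factor x * f (g⁻¹ * x) := by
  rcases le_total 0 (C.v g) with hv | hv
  · exact C.exists_reps_of_nonneg hg hv
  · have := C.symm.exists_reps_of_nonneg hg (by change 0 ≤ -C.v g; omega)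
    simpa only [symm_factor] using this

end Reps

end Cover

end HeckeTheory

namespace HeckeTheory

namespace Cover

section Iso

variable {G : Type*} [Group G] [TopologicalSpace G] [IsTopologicalGroup G] [LocallyCompactSpace G]
  {J : Subgroup G} {χ : J →* Circle} {G' : Subgroup G} [LocallyCompactSpace G']
  (C : Cover J χ G')

/-- The restriction of `χ` to `J ∩ G'`, as a character of a subgroup of `G'`. -/
abbrev restrict (χ : J →* Circle) (G' : Subgroup G) : J.subgroupOf G' →* Circle :=
  χ.comp (G'.subtype.subgroupComap J)

open Classical in
/-- The function on `G` supported on `J G' J` attached to a function on `G'`. -/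
def extend (f : G' → ℂ) (x : G) : ℂ :=
  if h : ∃ (j₁ : J) (g : G') (j₂ : J), x = j₁ * g * j₂ then
    C.factor h.choose_spec.choose * (((χ h.choose)⁻¹ : Circle) * f h.choose_spec.choose *
      ((χ h.choose_spec.choose_spec.choose)⁻¹ : Circle))
  else 0

theorem extend_apply {f : G' → ℂ} (hf : f ∈ HeckeAlgebra (J.subgroupOf G') (restrict χ G'))
    (j₁ : J) (g : G') (j₂ : J) : C.extend f (j₁ * g * j₂) =
      C.factor g * (((χ j₁)⁻¹ : Circle) * f g * ((χ j₂)⁻¹ : Circle)) := by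
  have h : ∃ (k₁ : J) (c : G') (k₂ : J), (j₁ * g * j₂ : G) = k₁ * c * k₂ := ⟨j₁, g, j₂, rfl⟩
  rw [extend, dif_pos h]
  have e := h.choose_spec.choose_spec.choose_spec
  set k₁ := h.choose
  set c := h.choose_spec.choose
  set k₂ := h.choose_spec.choose_spec.choose
  -- `c = a g b` with `a, b ∈ J`
  have e1 : (c : G) = ((k₁⁻¹ * j₁ : J) : G) * g * ((j₂ * k₂⁻¹ : J) : G) := by
    have : (c : G) = (k₁ : G)⁻¹ * (k₁ * c * k₂) * (k₂ : G)⁻¹ := by group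
    rw [this, ← e]
    push_cast
    group
  have hJ := C.mem_J_of_mem_doubleCoset c.2 g.2 (k₁⁻¹ * j₁).2 (j₂ * k₂⁻¹).2 e1
  let l : J.subgroupOf G' := ⟨g⁻¹ * c, hJ⟩
  have hfc : f c = f g * ((restrict χ G' l)⁻¹ : Circle) := by
    rw [← HeckeAlgebra.apply_mul_right hf g l]
    congr 1
    exact (mul_inv_cancel_left g c).symm
  have hχ : restrict χ G' l = χ (k₁⁻¹ * j₁) * χ (j₂ * k₂⁻¹) := by
    have h1 := C.χ_conj g g.2 (k₁⁻¹ * j₁) (⟨g⁻¹ * c, hJ⟩ * (j₂ * k₂⁻¹)⁻¹) (by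
      change (g : G)⁻¹ * c * ((j₂ * k₂⁻¹ : J) : G)⁻¹ = _
      rw [e1]; group)
    rw [← h1, ← map_mul, inv_mul_cancel_right]
    rfl
  rw [hfc, hχ, C.factor_congr (C.v_eq_of_inv_mul_mem c.2 g.2 hJ)]
  congr 1
  simp only [map_mul, map_inv, _root_.mul_inv_rev, inv_inv, Circle.coe_mul, Circle.coe_inv]
  have h1 := Circle.coe_ne_zero (χ k₁)
  have h2 := Circle.coe_ne_zero (χ k₂)
  field_simp
  exact mul_comm _ _

theorem extend_apply_coe {f : G' → ℂ} (hf : f ∈ HeckeAlgebra (J.subgroupOf G') (restrict χ G'))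
    (g : G') : C.extend f g = C.factor g * f g := by
  have := C.extend_apply hf 1 g 1
  simpa using this

theorem exists_of_extend_ne_zero {f : G' → ℂ} {x : G} (hx : C.extend f x ≠ 0) :
    ∃ (j₁ : J) (g : G') (j₂ : J), x = j₁ * g * j₂ := by
  by_contra h
  exact hx (dif_neg h)

theorem support_extend {f : G' → ℂ} (hf : f ∈ HeckeAlgebra (J.subgroupOf G') (restrict χ G')) :
    Function.support (C.extend f) =
      (J : Set G) * (Subtype.val '' Function.support f : Set G) * (J : Set G) := by
  ext x
  constructor
  · intro hx
    obtain ⟨j₁, g, j₂, rfl⟩ := C.exists_of_extend_ne_zero hx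
    rw [Function.mem_support, C.extend_apply hf] at hx
    refine Set.mul_mem_mul (Set.mul_mem_mul j₁.2 ⟨g, ?_, rfl⟩) j₂.2
    exact right_ne_zero_of_mul (left_ne_zero_of_mul (right_ne_zero_of_mul hx))
  · rintro ⟨_, ⟨j₁, hj₁, _, ⟨g, hg, rfl⟩, rfl⟩, j₂, hj₂, rfl⟩
    have := C.extend_apply hf ⟨j₁, hj₁⟩ g ⟨j₂, hj₂⟩
    simp only at this
    rw [Function.mem_support]
    change C.extend f (j₁ * g * j₂) ≠ 0
    rw [this]
    exact mul_ne_zero (C.factor_ne_zero _) (mul_ne_zero (mul_ne_zero (Circle.coe_ne_zero _) hg)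
      (Circle.coe_ne_zero _))

theorem extend_mem (hJ : IsCompact (J : Set G)) {f : G' → ℂ}
    (hf : f ∈ HeckeAlgebra (J.subgroupOf G') (restrict χ G')) :
    C.extend f ∈ HeckeAlgebra J χ := by
  refine ⟨?_, fun k k' x => ?_⟩
  · refine HasCompactSupport.of_support_subset_isCompact
      ((hJ.mul (hf.1.isCompact.image continuous_subtype_val)).mul hJ) ?_
    rw [C.support_extend hf]
    exact Set.mul_subset_mul_right (Set.mul_subset_mul_left (Set.image_mono (subset_tsupport _)))
  · by_cases hx : ∃ (j₁ : J) (g : G') (j₂ : J), x = j₁ * g * j₂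
    · obtain ⟨j₁, g, j₂, rfl⟩ := hx
      have e : (k * (j₁ * g * j₂) * k' : G) = ((k * j₁ : J) : G) * g * ((j₂ * k' : J) : G) := by
        push_cast; group
      rw [e, C.extend_apply hf, C.extend_apply hf]
      simp only [map_mul, _root_.mul_inv_rev, Circle.coe_mul]
      ring
    · have h0 : C.extend f x = 0 := dif_neg hx
      have h1 : C.extend f (k * x * k') = 0 := by
        by_contra h
        obtain ⟨j₁, g, j₂, e⟩ := C.exists_of_extend_ne_zero h
        refine hx ⟨k⁻¹ * j₁, g, j₂ * k'⁻¹, ?_⟩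
        have : x = (k : G)⁻¹ * (k * x * k') * (k' : G)⁻¹ := by group
        rw [this, e]
        push_cast
        group
      rw [h0, h1, mul_zero, zero_mul]

theorem restrict_mem (hG' : IsClosed (G' : Set G)) {f : G → ℂ} (hf : f ∈ HeckeAlgebra J χ) :
    (fun g : G' => (C.factor g : ℂ)⁻¹ * f g) ∈ HeckeAlgebra (J.subgroupOf G') (restrict χ G') := by
  refine ⟨?_, fun k k' g => ?_⟩
  · exact (hf.1.comp_isClosedEmbedding hG'.isClosedEmbedding_subtypeVal).mul_left
  · have hv : C.v (((k : G') : G) * g * ((k' : G') : G)) = C.v g := by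
      rw [C.v_mul _ (mul_mem (k : G').2 g.2) _ (k' : G').2, C.v_mul _ (k : G').2 _ g.2,
        C.v_J _ (k : G').2 k.2, C.v_J _ (k' : G').2 k'.2, zero_add, add_zero]
    have := hf.2 ⟨_, k.2⟩ ⟨_, k'.2⟩ g
    change (C.factor (((k : G') : G) * g * ((k' : G') : G)) : ℂ)⁻¹ *
      f (((k : G') : G) * g * ((k' : G') : G)) = _
    rw [C.factor_congr hv]
    change f (((k : G') : G) * g * ((k' : G') : G)) = _ at this
    rw [this]
    change _ = ((χ ⟨_, k.2⟩)⁻¹ : Circle) * ((C.factor g : ℂ)⁻¹ * f g) * ((χ ⟨_, k'.2⟩)⁻¹ : Circle)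
    ring

/-- Functions supported on one coset of `J'` span the Hecke algebra of `G'`, so the coset count for
a single double coset `J g J` suffices. -/
theorem extend_convolution (hJo : IsOpen (J : Set G)) (hJc : IsCompact (J : Set G))
    (hG' : IsClosed (G' : Set G)) {f₁ f₂ : G' → ℂ}
    (h₁ : f₁ ∈ HeckeAlgebra (J.subgroupOf G') (restrict χ G'))
    (h₂ : f₂ ∈ HeckeAlgebra (J.subgroupOf G') (restrict χ G')) :
    C.extend (convolution (J.subgroupOf G') f₁ f₂) =
      convolution J (C.extend f₁) (C.extend f₂) := by
  classical
  have hJo' : IsOpen (J.subgroupOf G' : Set G') := hJo.preimage continuous_subtype_val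
  have hJc' : IsCompact (J.subgroupOf G' : Set G') :=
    hG'.isClosedEmbedding_subtypeVal.isCompact_preimage hJc
  have h₁₂ := convolution_mem _ _ h₁ h₂
  have m₁ := C.extend_mem hJc h₁
  have m₂ := C.extend_mem hJc h₂
  refine C.ext_of_forall_mem (C.extend_mem hJc h₁₂) (convolution_mem _ _ m₁ m₂) fun x hx => ?_
  obtain ⟨T', hT', hs'⟩ := exists_coset_reps hJo' h₁.1
  choose R hR1 hR2 hR3 hR4 using fun g : G' => C.exists_reps g.2
  -- distinct elements of `T'` have disjoint double cosets
  have hdis : ∀ g ∈ T', ∀ h ∈ T', ∀ s ∈ R g, ∀ t ∈ R h, s⁻¹ * t ∈ J → g = h := by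
    intro g hg h hh s hs t ht hst
    obtain ⟨j, hj, rfl, -⟩ := hR1 g s hs
    obtain ⟨j', hj', rfl, -⟩ := hR1 h t ht
    refine hT' g hg h hh ?_
    refine C.mem_J_of_mem_doubleCoset h.2 g.2 (mul_mem (inv_mem hj') hj) hst ?_
    group
  have hx' := HeckeAlgebra.mul_apply_eq_sum hJo' hJc' h₁ h₂ ⟨x, hx⟩ T' hT' hs'
  have hX := HeckeAlgebra.mul_apply_eq_sum hJo hJc m₁ m₂ x (T'.biUnion R) (by
    intro s hs t ht hst
    obtain ⟨g, hg, hs⟩ := Finset.mem_biUnion.mp hs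
    obtain ⟨h, hh, ht⟩ := Finset.mem_biUnion.mp ht
    obtain rfl := hdis g hg h hh s hs t ht hst
    exact hR2 g s hs t ht hst) (by
    intro y hy
    obtain ⟨j₁, g, j₂, rfl⟩ := C.exists_of_extend_ne_zero hy
    rw [C.extend_apply h₁] at hy
    obtain ⟨t, ht, htg⟩ := hs' g
      (right_ne_zero_of_mul (left_ne_zero_of_mul (right_ne_zero_of_mul hy)))
    obtain ⟨r, hr, hr'⟩ := hR3 t j₁ j₁.2 ((t⁻¹ * g : G') * j₂ : G) (mul_mem htg j₂.2)
    refine ⟨r, Finset.mem_biUnion.mpr ⟨t, ht, hr⟩, ?_⟩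
    convert hr' using 1
    push_cast
    group)
  rw [hX, Finset.sum_biUnion fun g hg h hh hgh => Finset.disjoint_left.mpr fun t ht ht' =>
    hgh (hdis g hg h hh t ht t ht' (by rw [inv_mul_cancel]; exact one_mem J))]
  rw [C.extend_apply_coe h₁₂ ⟨x, hx⟩, hx', Finset.mul_sum]
  refine Finset.sum_congr rfl fun g _ => ?_
  have h4 := hR4 g _ m₂ x hx
  have e2 : C.extend f₂ ((g : G)⁻¹ * x) = C.factor ((g : G)⁻¹ * x) * f₂ (g⁻¹ * ⟨x, hx⟩) :=
    C.extend_apply_coe h₂ (g⁻¹ * ⟨x, hx⟩)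
  have e3 : ∀ t ∈ R g, C.extend f₁ t * C.extend f₂ (t⁻¹ * x) =
      C.factor g * f₁ g * C.extend f₂ (t⁻¹ * x) := fun t ht => by
    obtain ⟨j, -, -, hf⟩ := hR1 g t ht
    rw [hf _ m₁, C.extend_apply_coe h₁]
  rw [Finset.sum_congr rfl e3, ← Finset.mul_sum]
  rw [e2] at h4
  refine mul_left_cancel₀ (C.factor_ne_zero ((g : G)⁻¹ * x)) ?_
  linear_combination (-f₁ g) * h4

/-- The `*`-isomorphism `ℋ(G'//J', χ') ≃ ℋ(G//J, χ)`. -/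
def heckeEquiv (hJo : IsOpen (J : Set G)) (hJc : IsCompact (J : Set G))
    (hG' : IsClosed (G' : Set G)) :
    HeckeAlgebra (J.subgroupOf G') (restrict χ G') ≃⋆ₐ[ℂ] HeckeAlgebra J χ where
  toFun f := ⟨C.extend f, C.extend_mem hJc f.2⟩
  invFun f := ⟨_, C.restrict_mem hG' f.2⟩
  left_inv f := by
    ext g
    change (C.factor g : ℂ)⁻¹ * C.extend f g = f.1 g
    rw [C.extend_apply_coe f.2, inv_mul_cancel_left₀ (C.factor_ne_zero _)]
  right_inv f := by
    refine Subtype.ext (C.ext_of_forall_mem (C.extend_mem hJc (C.restrict_mem hG' f.2)) f.2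
      fun g hg => ?_)
    change C.extend (fun g : G' => (C.factor g : ℂ)⁻¹ * f.1 g) g = f.1 g
    rw [C.extend_apply_coe (C.restrict_mem hG' f.2) ⟨g, hg⟩,
      mul_inv_cancel_left₀ (C.factor_ne_zero _)]
  map_mul' f₁ f₂ := Subtype.ext (C.extend_convolution hJo hJc hG' f₁.2 f₂.2)
  map_add' f₁ f₂ := by
    refine Subtype.ext (C.ext_of_forall_mem (C.extend_mem hJc (f₁ + f₂).2)
      (add_mem (C.extend_mem hJc f₁.2) (C.extend_mem hJc f₂.2)) fun g hg => ?_)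
    change C.extend (f₁ + f₂).1 g = C.extend f₁ g + C.extend f₂ g
    rw [C.extend_apply_coe (f₁ + f₂).2 ⟨g, hg⟩, C.extend_apply_coe f₁.2 ⟨g, hg⟩,
      C.extend_apply_coe f₂.2 ⟨g, hg⟩, ← mul_add]
    rfl
  map_star' f := by
    have hstar := (star (⟨C.extend f, C.extend_mem hJc f.2⟩ : HeckeAlgebra J χ)).2
    refine Subtype.ext (C.ext_of_forall_mem (C.extend_mem hJc (star f).2) hstar fun g hg => ?_)
    refine (C.extend_apply_coe (star f).2 ⟨g, hg⟩).trans ?_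
    change (C.factor g : ℂ) * starRingEnd ℂ (f.1 (⟨g, hg⟩⁻¹ : G')) =
      starRingEnd ℂ (C.extend f ((⟨g, hg⟩⁻¹ : G') : G))
    rw [C.extend_apply_coe f.2, map_mul, Complex.conj_ofReal]
    congr 2
    exact (C.factor_inv hg).symm
  map_smul' r f := by
    refine Subtype.ext (C.ext_of_forall_mem (C.extend_mem hJc (r • f).2)
      (Submodule.smul_mem _ r (C.extend_mem hJc f.2)) fun g hg => ?_)
    change C.extend (r • f).1 g = r * C.extend f g
    rw [C.extend_apply_coe (r • f).2 ⟨g, hg⟩, C.extend_apply_coe f.2 ⟨g, hg⟩, mul_left_comm]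
    rfl

theorem support_heckeEquiv (hJo : IsOpen (J : Set G)) (hJc : IsCompact (J : Set G))
    (hG' : IsClosed (G' : Set G)) (f : HeckeAlgebra (J.subgroupOf G') (restrict χ G')) :
    Function.support (C.heckeEquiv hJo hJc hG' f : G → ℂ) =
      (J : Set G) * (Subtype.val '' Function.support (f : G' → ℂ) : Set G) * (J : Set G) :=
  C.support_extend f.2

end Iso

end Cover

end HeckeTheory

namespace UnramifiedQuadratic

variable {F₀ F : Type*} [Field F₀] [ValuativeRel F₀] [TopologicalSpace F₀]
    [IsNonarchimedeanLocalField F₀] [Field F] [ValuativeRel F] [TopologicalSpace F]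
    [IsNonarchimedeanLocalField F] [Algebra F₀ F] [ValuativeExtension F₀ F]
    (D : UnramifiedQuadratic F₀ F)

/-! ### The torus `G'` -/

theorem exists_val_eq_zpow {x : F} (hx : x ≠ 0) :
    ∃ t : ℤ, valuation F x = valuation F D.piF ^ t := by
  obtain ⟨k, hk⟩ := D.exists_val_le_zpow x
  obtain ⟨l, hl⟩ := D.exists_val_le_zpow x⁻¹
  have hx' : 0 < valuation F x := by simpa [zero_lt_iff] using hx
  have hb : ∀ t : ℤ, valuation F x ≤ valuation F D.piF ^ t → t ≤ l := by
    intro t ht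
    rw [map_inv₀, _root_.zpow_neg] at hl
    exact D.val_zpow_le_iff.mp (((inv_le_inv₀ hx' (zpow_pos D.val_piF_pos _)).mp hl).trans ht)
  obtain ⟨t, ht, hmax⟩ := Int.exists_greatest_of_bdd ⟨(l : ℤ), hb⟩ ⟨_, hk⟩
  refine ⟨t, le_antisymm ht (not_lt.mp fun h => ?_)⟩
  have := hmax _ ((D.val_lt_zpow_iff x t).mp h)
  omega

/-- The Levi subgroup of the elements of `G` that preserve `F e₁ ⊕ F e₃` and `F e₂ ⊕ F e₄`. -/
def levi : Subgroup D.U22 where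
  carrier := {g | D.mat g * idem₁ F = idem₁ F * D.mat g}
  one_mem' := by simp [mat_one]
  mul_mem' := by
    intro a b ha hb
    simp only [Set.mem_ofPred_eq, mat_mul] at *
    rw [mul_assoc, hb, ← mul_assoc, ha, mul_assoc]
  inv_mem' := by
    intro a ha
    simp only [Set.mem_ofPred_eq] at *
    calc D.mat a⁻¹ * idem₁ F = D.mat a⁻¹ * (idem₁ F * D.mat a) * D.mat a⁻¹ := by
          rw [mul_assoc, mul_assoc, D.mat_mul_mat_inv, mul_one]
      _ = _ := by rw [← ha, ← mul_assoc, D.mat_inv_mul_mat, one_mul]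

theorem mem_levi {g : D.U22} : g ∈ D.levi ↔ D.mat g * idem₁ F = idem₁ F * D.mat g := Iff.rfl

theorem idem₂_eq : idem₂ F = 1 - idem₁ F := by rw [← idem₁_add_idem₂]; abel

theorem mul_idem₂_of_mem_levi {g : D.U22} (hg : g ∈ D.levi) :
    D.mat g * idem₂ F = idem₂ F * D.mat g := by
  rw [idem₂_eq, mul_sub, sub_mul, D.mem_levi.mp hg, mul_one, one_mul]

/-- The element `g` of the Levi subgroup maps `Λ(i) ∩ (F e₁ ⊕ F e₃)` into `Λ(i - t)` and
`Λ(i) ∩ (F e₂ ⊕ F e₄)` into `Λ(i + t)`. -/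
def Shifts (t : ℤ) (g : D.U22) : Prop :=
  idem₁ F * D.mat g ∈ D.filtration (-t) ∧ idem₂ F * D.mat g ∈ D.filtration t

variable {D}

theorem Shifts.mul {s t : ℤ} {g h : D.U22} (hg : g ∈ D.levi) (hs : D.Shifts s g)
    (ht : D.Shifts t h) : D.Shifts (s + t) (g * h) := by
  constructor
  · have := D.filtration_mul hs.1 ht.1
    rw [mul_assoc, ← mul_assoc (D.mat g), D.mem_levi.mp hg, mul_assoc, ← mul_assoc,
      idem₁_mul_idem₁, ← mat_mul] at this
    rwa [neg_add]
  · have := D.filtration_mul hs.2 ht.2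
    rwa [mul_assoc, ← mul_assoc (D.mat g), D.mul_idem₂_of_mem_levi hg, mul_assoc, ← mul_assoc,
      idem₂_mul_idem₂, ← mat_mul] at this

theorem Shifts.inv {t : ℤ} {g : D.U22} (hg : g ∈ D.levi) (h : D.Shifts t g) :
    D.Shifts (-t) g⁻¹ := by
  have hi := inv_mem hg
  constructor
  · rw [neg_neg, ← D.mem_levi.mp hi, mat_inv, ← D.adj_idem₂, ← adj_mul]
    exact D.adj_mem_filtration h.2
  · rw [← D.mul_idem₂_of_mem_levi hi, mat_inv, ← D.adj_idem₁, ← adj_mul]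
    exact D.adj_mem_filtration h.1

theorem shifts_zero_iff {g : D.U22} : D.Shifts 0 g ↔ D.mat g ∈ D.filtration 0 := by
  constructor
  · intro h
    have := add_mem h.2 (by simpa using h.1)
    rwa [← add_mul, add_comm, idem₁_add_idem₂, one_mul] at this
  · intro h
    exact ⟨by simpa using D.filtration_mul D.idem₁_mem h,
      by simpa using D.filtration_mul D.idem₂_mem h⟩

theorem le_zero_of_idem₁_mem {t : ℤ} (h : idem₁ F ∈ D.filtration t) : t ≤ 0 := by
  have := (D.mem_filtration_iff _ _).mp h 0 0
  have h1 : (t + wt 0 - wt 0 + 1) / 2 ≤ 0 := by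
    rw [← D.val_zpow_le_iff]; simpa [idem₁] using this
  omega

theorem le_zero_of_idem₂_mem {t : ℤ} (h : idem₂ F ∈ D.filtration t) : t ≤ 0 := by
  have := D.adj_mem_filtration h
  rw [D.adj_idem₂] at this
  exact le_zero_of_idem₁_mem this

theorem Shifts.unique {s t : ℤ} {g : D.U22} (hg : g ∈ D.levi) (hs : D.Shifts s g)
    (ht : D.Shifts t g) : s = t := by
  have h := hs.mul hg (ht.inv hg)
  rw [mul_inv_cancel] at h
  have h1 := le_zero_of_idem₁_mem (D := D) (by simpa [mat_one] using h.1)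
  have h2 := le_zero_of_idem₂_mem (D := D) (by simpa [mat_one] using h.2)
  omega

namespace SplitStratum

variable (S : D.SplitStratum)

theorem mul_comm_of_mem_B {X Y : Matrix (Fin 4) (Fin 4) F} (hX : X ∈ S.B) (hY : Y ∈ S.B) :
    X * Y = Y * X := by
  obtain ⟨⟨a1, a2, a3, a4, a5, a6, a7, a8⟩, b1, b2, b3, b4⟩ := S.entries_of_mem_B hX
  obtain ⟨⟨c1, c2, c3, c4, c5, c6, c7, c8⟩, d1, d2, d3, d4⟩ := S.entries_of_mem_B hY
  ext i j
  fin_cases i <;> fin_cases j <;>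
    simp [Matrix.mul_apply, Fin.sum_univ_four, a1, a2, a3, a4, a5, a6, a7, a8, b1, b2, b3, b4, c1,
      c2, c3, c4, c5, c6, c7, c8, d1, d2, d3, d4] <;> ring

theorem mem_Gprime {g : D.U22} : g ∈ S.Gprime ↔ D.mat g ∈ S.B := Iff.rfl

theorem mul_comm_of_mem_Gprime {g h : D.U22} (hg : g ∈ S.Gprime) (hh : h ∈ S.Gprime) :
    g * h = h * g :=
  D.mat_injective (by rw [mat_mul, mat_mul, S.mul_comm_of_mem_B hg hh])

theorem Gprime_le_levi : S.Gprime ≤ D.levi := fun _ hg =>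
  S.mul_comm_of_mem_B hg S.idem₁_mem_B

theorem idem₁_mul_mem_filtration {X : Matrix (Fin 4) (Fin 4) F} (hX : X ∈ S.B) {t : ℤ}
    (h1 : valuation F (X 0 0) ≤ valuation F D.piF ^ ((t + 1) / 2))
    (h2 : valuation F (X 0 2) ≤ valuation F D.piF ^ (t / 2)) :
    idem₁ F * X ∈ D.filtration t := by
  obtain ⟨⟨a1, a2, a3, a4, a5, a6, a7, a8⟩, b1, b2, b3, b4⟩ := S.entries_of_mem_B hX
  have h3 : valuation F (D.piF * S.lam * X 0 2) ≤ valuation F D.piF ^ ((t + 2) / 2) := by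
    rw [map_mul, map_mul, S.val_lam, mul_one, show (t + 2) / 2 = 1 + t / 2 by omega,
      zpow_one_add₀ D.val_piF_pos.ne']
    exact mul_le_mul_right h2 _
  rw [mem_filtration_iff]
  intro i j
  fin_cases i <;> fin_cases j <;> simp [idem₁, wt, a1, a2, a5, a6, b3, ← b1]
  · exact h1
  · exact h2
  · simpa [add_assoc] using h3
  · exact h1

/-- An element of `G'` acts on `V₁` as `a + c ϖ^m β`, and the two terms `a²`, `ϖ λ c²` of
its determinant have valuations of different parity, so one of them dominates. The unitary condition
makes the action on `V₂` the conjugate inverse. -/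
theorem exists_shifts {g : D.U22} (hg : g ∈ S.Gprime) : ∃ t : ℤ, D.Shifts t g := by
  have hg' : D.mat g⁻¹ ∈ S.B := inv_mem hg
  have hi := D.mat_mul_mat_inv g
  obtain ⟨⟨a1, a2, a3, a4, a5, a6, a7, a8⟩, b1, b2, b3, b4⟩ := S.entries_of_mem_B hg
  obtain ⟨⟨c1, c2, c3, c4, c5, c6, c7, c8⟩, d1, d2, d3, d4⟩ := S.entries_of_mem_B hg'
  have e00 := congrFun (congrFun hi 0) 0
  have e02 := congrFun (congrFun hi 0) 2
  simp [Matrix.mul_apply, Fin.sum_univ_four, a1, a2, d3, ← d1] at e00 e02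
  set a := D.mat g 0 0
  set c := D.mat g 0 2
  set a' := D.mat g⁻¹ 0 0 with ha'
  set c' := D.mat g⁻¹ 0 2 with hc'
  set w := D.piF * S.lam with hw
  have hvw : valuation F w = valuation F D.piF := by rw [hw, map_mul, S.val_lam, mul_one]
  set d := a ^ 2 - w * c ^ 2 with hd
  have h1 : a' * d = a := by rw [hd]; linear_combination a * e00 - w * c * e02
  have h2 : c' * d = -c := by rw [hd]; linear_combination a * e02 - c * e00
  have hsq : ∀ (x : F) (i : ℤ), valuation F x = valuation F D.piF ^ i →
      valuation F (x ^ 2) = valuation F D.piF ^ (2 * i) := fun x i h => by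
    rw [map_pow, h, ← zpow_natCast, ← _root_.zpow_mul]; congr 1; push_cast; ring
  have hsq' : ∀ (x : F) (i : ℤ), valuation F x = valuation F D.piF ^ i →
      valuation F (w * x ^ 2) = valuation F D.piF ^ (2 * i + 1) := fun x i h => by
    rw [map_mul, hvw, hsq x i h, zpow_add_one₀ D.val_piF_pos.ne', mul_comm]
  have hp0 := D.val_piF_pos
  -- the two terms of `d` have valuations of different parity
  obtain ⟨t, ht, hat, hct⟩ : ∃ t : ℤ, valuation F d = valuation F D.piF ^ t ∧
      valuation F a ≤ valuation F D.piF ^ ((t + 1) / 2) ∧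
      valuation F c ≤ valuation F D.piF ^ (t / 2) := by
    by_cases ha : a = 0
    · have hc : c ≠ 0 := by rintro hc; simp [ha, hc] at e00
      obtain ⟨j, hj⟩ := D.exists_val_eq_zpow hc
      refine ⟨2 * j + 1, ?_, by simp [ha], ?_⟩
      · rw [hd, ha, zero_pow two_ne_zero, zero_sub, Valuation.map_neg, hsq' c j hj]
      · rw [hj]; exact D.val_zpow_anti (by omega)
    obtain ⟨i, hi⟩ := D.exists_val_eq_zpow ha
    by_cases hc : c = 0
    · refine ⟨2 * i, ?_, ?_, by simp [hc]⟩
      · rw [hd, hc, zero_pow two_ne_zero, mul_zero, sub_zero, hsq a i hi]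
      · rw [hi]; exact D.val_zpow_anti (by omega)
    obtain ⟨j, hj⟩ := D.exists_val_eq_zpow hc
    have hlt : ∀ s t : ℤ, s < t → valuation F D.piF ^ t < valuation F D.piF ^ s := fun s t h =>
      lt_of_not_ge fun h' => by have := D.val_zpow_le_iff.mp h'; omega
    rcases lt_or_ge j i with hij | hij
    · refine ⟨2 * j + 1, ?_, ?_, ?_⟩
      · rw [hd, Valuation.map_sub_eq_of_lt_right, hsq' c j hj]
        rw [hsq' c j hj, hsq a i hi]
        exact hlt _ _ (by omega)
      · rw [hi]; exact D.val_zpow_anti (by omega)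
      · rw [hj]; exact D.val_zpow_anti (by omega)
    · refine ⟨2 * i, ?_, ?_, ?_⟩
      · rw [hd, Valuation.map_sub_eq_of_lt_left, hsq a i hi]
        rw [hsq' c j hj, hsq a i hi]
        exact hlt _ _ (by omega)
      · rw [hi]; exact D.val_zpow_anti (by omega)
      · rw [hj]; exact D.val_zpow_anti (by omega)
  have hq : ∀ {x y : F} {s : ℤ}, valuation F (x * d) = valuation F y →
      valuation F y ≤ valuation F D.piF ^ s →
      valuation F x ≤ valuation F D.piF ^ (s - t) := fun {x y s} h h' => by
    rw [map_mul, ht] at h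
    rw [zpow_sub₀ hp0.ne', le_div_iff₀ (zpow_pos hp0 _), h]
    exact h'
  refine ⟨-t, by rw [neg_neg]; exact S.idem₁_mul_mem_filtration hg hat hct, ?_⟩
  have hinv : idem₁ F * D.mat g⁻¹ ∈ D.filtration (-t) := by
    refine S.idem₁_mul_mem_filtration hg' ?_ ?_
    · exact (hq (by rw [h1]) hat).trans (D.val_zpow_anti (by omega))
    · exact (hq (by rw [h2, Valuation.map_neg]) hct).trans (D.val_zpow_anti (by omega))
  rw [← D.mul_idem₂_of_mem_levi (S.Gprime_le_levi hg), ← D.adj_idem₁, ← D.adj_adj (D.mat g),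
    ← adj_mul, ← mat_inv]
  exact D.adj_mem_filtration hinv

open Classical in
/-- The homomorphism `G' → ℤ` with kernel `B'` that maps `ζ` to `1`; its value at the elements
outside `G'` is `0`. -/
def shift (g : D.U22) : ℤ := if h : g ∈ S.Gprime then (S.exists_shifts h).choose else 0

theorem shifts_shift {g : D.U22} (hg : g ∈ S.Gprime) : D.Shifts (S.shift g) g := by
  rw [shift, dif_pos hg]
  exact (S.exists_shifts hg).choose_spec

theorem shift_eq {g : D.U22} (hg : g ∈ S.Gprime) {t : ℤ} (h : D.Shifts t g) : S.shift g = t :=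
  (S.shifts_shift hg).unique (S.Gprime_le_levi hg) h

theorem shift_mul {g h : D.U22} (hg : g ∈ S.Gprime) (hh : h ∈ S.Gprime) :
    S.shift (g * h) = S.shift g + S.shift h :=
  S.shift_eq (mul_mem hg hh) ((S.shifts_shift hg).mul (S.Gprime_le_levi hg) (S.shifts_shift hh))

theorem shift_inv {g : D.U22} (hg : g ∈ S.Gprime) : S.shift g⁻¹ = -S.shift g :=
  S.shift_eq (inv_mem hg) ((S.shifts_shift hg).inv (S.Gprime_le_levi hg))

theorem shift_eq_zero_iff {g : D.U22} (hg : g ∈ S.Gprime) :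
    S.shift g = 0 ↔ D.mat g ∈ D.filtration 0 := by
  rw [← shifts_zero_iff]
  exact ⟨fun h => h ▸ S.shifts_shift hg, S.shift_eq hg⟩

theorem shift_pow {g : D.U22} (hg : g ∈ S.Gprime) (k : ℕ) : S.shift (g ^ k) = k * S.shift g := by
  induction k with
  | zero =>
    rw [pow_zero, Nat.cast_zero, zero_mul, S.shift_eq_zero_iff (one_mem _)]
    exact D.one_mem_filtration
  | succ k ih =>
    rw [pow_succ, S.shift_mul (pow_mem hg k) hg, ih]; push_cast; ring

theorem shift_zpow {g : D.U22} (hg : g ∈ S.Gprime) (k : ℤ) : S.shift (g ^ k) = k * S.shift g := by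
  obtain ⟨k, rfl | rfl⟩ := k.eq_nat_or_neg
  · rw [zpow_natCast, S.shift_pow hg]
  · rw [_root_.zpow_neg, zpow_natCast, S.shift_inv (pow_mem hg k), S.shift_pow hg]; ring

theorem zeta_mem_B : S.zeta ∈ S.B := by
  have h1 := S.lam_ne_zero
  have h3 := D.piF_ne_zero
  rw [mem_B, beta, smul_mul_assoc, mul_smul_comm]
  congr 1
  ext i j
  fin_cases i <;> fin_cases j <;>
    simp [zeta, Matrix.mul_apply, Fin.sum_univ_four] <;> field_simp

theorem exists_mat_eq_zeta : ∃ z : D.U22, D.mat z = S.zeta := by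
  have h1 := S.lam_ne_zero
  have h2 := S.conj_lam_ne_zero
  have h3 := D.piF_ne_zero
  refine D.exists_mat_eq ?_
  ext i j
  fin_cases i <;> fin_cases j <;>
    simp [zeta, Matrix.mul_apply, Fin.sum_univ_four, adj_apply, Fin.rev, D.conj_piF, D.conj_conj] <;>
    field_simp

theorem exists_mem_Gprime_shift_eq_one : ∃ z ∈ S.Gprime, D.mat z = S.zeta ∧ S.shift z = 1 := by
  obtain ⟨z, hz⟩ := S.exists_mat_eq_zeta
  have hzG : z ∈ S.Gprime := by rw [mem_Gprime, hz]; exact S.zeta_mem_B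
  refine ⟨z, hzG, hz, ?_⟩
  obtain ⟨t, ht⟩ := S.exists_shifts hzG
  refine S.shift_eq hzG ⟨?_, ?_⟩
  · rw [hz]
    refine S.idem₁_mul_mem_filtration S.zeta_mem_B ?_ ?_
    · simp [zeta]
    · simp [zeta, S.val_lam]
  · rw [hz, mem_filtration_iff]
    have : valuation F (D.conj S.lam) = 1 := by rw [D.conj_val, S.val_lam]
    intro i j
    fin_cases i <;> fin_cases j <;> simp [zeta, idem₂, wt, this]

/-- `G' = ⟨ζ⟩ B'`. -/
theorem Gprime_eq {z : D.U22} (hz : z ∈ S.Gprime) (h1 : S.shift z = 1) :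
    (S.Gprime : Set D.U22) = (Subgroup.zpowers z : Set D.U22) * S.Bzero := by
  ext g
  constructor
  · intro hg
    have hm : z ^ (-S.shift g) * g ∈ S.Gprime := mul_mem (zpow_mem hz _) hg
    refine ⟨z ^ S.shift g, ⟨_, rfl⟩, z ^ (-S.shift g) * g, ⟨hm, ?_⟩, ?_⟩
    · rw [← S.shift_eq_zero_iff hm, S.shift_mul (zpow_mem hz _) hg, S.shift_zpow hz, h1]
      ring
    · change z ^ S.shift g * (z ^ (-S.shift g) * g) = g
      rw [_root_.zpow_neg, mul_inv_cancel_left]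
  · rintro ⟨_, ⟨k, rfl⟩, h, hh, rfl⟩
    exact mul_mem (zpow_mem hz k) hh.1

/-- A compact subset of `G` is bounded. -/
theorem _root_.UnramifiedQuadratic.exists_forall_mem_filtration {K : Set D.U22}
    (hK : IsCompact K) : ∃ k : ℕ, ∀ g ∈ K, D.mat g ∈ D.filtration (-(k : ℤ)) := by
  obtain ⟨k, hk⟩ := hK.elim_directed_cover
    (fun k : ℕ => {g : D.U22 | D.mat g ∈ D.filtration (-(k : ℤ))})
    (fun k => (D.isOpen_filtration _).preimage D.continuous_mat)
    (fun g _ => Set.mem_iUnion.mpr (D.exists_mem_filtration (D.mat g)))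
    (directed_of_isDirected_le fun i j hij g hg => D.filtration_anti (by omega) hg)
  exact ⟨k, fun g hg => hk hg⟩

theorem shift_le_of_mem {g : D.U22} (hg : g ∈ S.Gprime) {k : ℤ}
    (h : D.mat g ∈ D.filtration (-k)) : S.shift g ≤ k := by
  have h1 := D.filtration_mul D.idem₁_mem h
  have h2 := ((S.shifts_shift hg).inv (S.Gprime_le_levi hg)).1
  have h3 := D.filtration_mul h1 h2
  rw [mul_assoc, ← mul_assoc (D.mat g), D.mem_levi.mp (S.Gprime_le_levi hg), mul_assoc,
    D.mat_mul_mat_inv, mul_one, idem₁_mul_idem₁] at h3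
  have := le_zero_of_idem₁_mem h3
  omega

theorem not_isCompact_Gprime : ¬ IsCompact (S.Gprime : Set D.U22) := by
  intro hc
  obtain ⟨k, hk⟩ := D.exists_forall_mem_filtration hc
  obtain ⟨z, hz, -, h1⟩ := S.exists_mem_Gprime_shift_eq_one
  have := S.shift_le_of_mem (zpow_mem hz _) (hk _ (zpow_mem hz ((k : ℤ) + 1)))
  rw [S.shift_zpow hz, h1] at this
  omega

end SplitStratum

end UnramifiedQuadratic

namespace HeckeTheory

/-! ### Indices of subgroups -/

theorem map_conj_eq {G : Type*} [Group G] {H K : Subgroup G} {g : G}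
    (h₁ : ∀ x ∈ H, g * x * g⁻¹ ∈ K) (h₂ : ∀ x ∈ K, g⁻¹ * x * g ∈ H) :
    H.map (MulAut.conj g).toMonoidHom = K := by
  ext x
  rw [Subgroup.mem_map]
  constructor
  · rintro ⟨y, hy, rfl⟩
    exact h₁ y hy
  · exact fun hx => ⟨_, h₂ x hx, by simp [mul_assoc]⟩

theorem relIndex_eq_of_conj {G : Type*} [Group G] {H₁ H₂ K₁ K₂ : Subgroup G} {g : G}
    (h₁ : H₁.map (MulAut.conj g).toMonoidHom = K₁) (h₂ : H₂.map (MulAut.conj g).toMonoidHom = K₂) :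
    K₁.relIndex K₂ = H₁.relIndex H₂ := by
  rw [← h₁, ← h₂]
  exact Subgroup.relIndex_map_map_of_injective _ _ (MulAut.conj g).injective

theorem relIndex_ne_zero_of_isOpen {G : Type*} [Group G] [TopologicalSpace G]
    [IsTopologicalGroup G] {U K : Subgroup G} (hU : IsOpen (U : Set G))
    (hK : IsCompact (K : Set G)) : U.relIndex K ≠ 0 := by
  haveI : CompactSpace K := isCompact_iff_compactSpace.mp hK
  haveI : Finite (K ⧸ U.subgroupOf K) :=
    Subgroup.quotient_finite_of_isOpen _ (hU.preimage continuous_subtype_val)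
  exact Subgroup.index_ne_zero_of_finite

end HeckeTheory

namespace UnramifiedQuadratic

variable {F₀ F : Type*} [Field F₀] [ValuativeRel F₀] [TopologicalSpace F₀]
    [IsNonarchimedeanLocalField F₀] [Field F] [ValuativeRel F] [TopologicalSpace F]
    [IsNonarchimedeanLocalField F] [Algebra F₀ F] [ValuativeExtension F₀ F]
    (D : UnramifiedQuadratic F₀ F)

/-! ### The unipotent subgroups -/

/-- The group of the elements `1 + x` of `G` with `x ∈ e A f`, where `f e = 0`. -/
def unip {e f : Matrix (Fin 4) (Fin 4) F} (h : f * e = 0) : Subgroup D.U22 where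
  carrier := {g | D.mat g - 1 = e * (D.mat g - 1) * f}
  one_mem' := by simp [mat_one]
  mul_mem' := by
    intro a b ha hb
    simp only [Set.mem_ofPred_eq] at *
    have h0 : (D.mat a - 1) * (D.mat b - 1) = 0 := by
      rw [ha, hb]
      calc e * (D.mat a - 1) * f * (e * (D.mat b - 1) * f)
          = e * (D.mat a - 1) * (f * e) * ((D.mat b - 1) * f) := by noncomm_ring
        _ = 0 := by rw [h]; simp
    have h1 : D.mat (a * b) - 1 = (D.mat a - 1) + (D.mat b - 1) := by
      rw [← sub_eq_zero, ← h0, mat_mul]; noncomm_ring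
    rw [h1, mul_add, add_mul, ← ha, ← hb]
  inv_mem' := by
    intro a ha
    simp only [Set.mem_ofPred_eq] at *
    have h0 : (D.mat a - 1) * (D.mat a - 1) = 0 := by
      rw [ha]
      calc e * (D.mat a - 1) * f * (e * (D.mat a - 1) * f)
          = e * (D.mat a - 1) * (f * e) * ((D.mat a - 1) * f) := by noncomm_ring
        _ = 0 := by rw [h]; simp
    have h1 : D.mat a⁻¹ - 1 = -(D.mat a - 1) := by
      have h2 : D.mat a * (2 - D.mat a) = 1 := by
        rw [← sub_eq_zero, ← neg_eq_zero, ← h0]; noncomm_ring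
      have h3 : D.mat a⁻¹ = 2 - D.mat a := by
        calc D.mat a⁻¹ = D.mat a⁻¹ * (D.mat a * (2 - D.mat a)) := by rw [h2, mul_one]
          _ = _ := by rw [← mul_assoc, D.mat_inv_mul_mat, one_mul]
      rw [h3, neg_sub, ← one_add_one_eq_two]; abel
    rw [h1, mul_neg, neg_mul, ← ha]

variable {D} {e f : Matrix (Fin 4) (Fin 4) F}

theorem mem_unip {h : f * e = 0} {g : D.U22} :
    g ∈ D.unip h ↔ D.mat g - 1 = e * (D.mat g - 1) * f := Iff.rfl

theorem mat_conj_sub_one (g q : D.U22) :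
    D.mat (g * q * g⁻¹) - 1 = D.mat g * (D.mat q - 1) * D.mat g⁻¹ := by
  rw [mat_mul, mat_mul, mul_sub, sub_mul, mul_one, D.mat_mul_mat_inv]

theorem mat_inv_mul_of_mat_mul {e' : Matrix (Fin 4) (Fin 4) F} {g : D.U22}
    (h : D.mat g * e = e' * D.mat g) : e * D.mat g⁻¹ = D.mat g⁻¹ * e' := by
  calc e * D.mat g⁻¹ = D.mat g⁻¹ * (D.mat g * e) * D.mat g⁻¹ := by
        rw [← mul_assoc (D.mat g⁻¹), D.mat_inv_mul_mat, one_mul]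
    _ = _ := by rw [h, mul_assoc, mul_assoc, D.mat_mul_mat_inv, mul_one]

theorem conj_mem_unip {e' f' : Matrix (Fin 4) (Fin 4) F} {h : f * e = 0} {h' : f' * e' = 0}
    {g q : D.U22} (he : D.mat g * e = e' * D.mat g) (hf : D.mat g * f = f' * D.mat g)
    (hq : q ∈ D.unip h) : g * q * g⁻¹ ∈ D.unip h' := by
  rw [mem_unip, mat_conj_sub_one]
  calc D.mat g * (D.mat q - 1) * D.mat g⁻¹
      = (D.mat g * e) * (D.mat q - 1) * (f * D.mat g⁻¹) := by
        conv_lhs => rw [mem_unip.mp hq]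
        noncomm_ring
    _ = _ := by rw [he, mat_inv_mul_of_mat_mul hf]; noncomm_ring

variable (D) in
/-- The intersection of `unip` with `1 + 𝔞_k`. -/
def unipFiltration (h : f * e = 0) (k : ℤ) : Subgroup D.U22 where
  carrier := {g | g ∈ D.unip h ∧ D.mat g - 1 ∈ D.filtration k}
  one_mem' := ⟨one_mem _, by simp [mat_one]⟩
  mul_mem' := by
    rintro a b ⟨ha, ha'⟩ ⟨hb, hb'⟩
    refine ⟨mul_mem ha hb, ?_⟩
    have h0 : (D.mat a - 1) * (D.mat b - 1) = 0 := by
      rw [mem_unip.mp ha, mem_unip.mp hb]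
      calc e * (D.mat a - 1) * f * (e * (D.mat b - 1) * f)
          = e * (D.mat a - 1) * (f * e) * ((D.mat b - 1) * f) := by noncomm_ring
        _ = 0 := by rw [h]; simp
    have h1 : D.mat (a * b) - 1 = (D.mat a - 1) + (D.mat b - 1) := by
      rw [← sub_eq_zero, ← h0, mat_mul]; noncomm_ring
    rw [h1]
    exact add_mem ha' hb'
  inv_mem' := by
    rintro a ⟨ha, ha'⟩
    refine ⟨inv_mem ha, ?_⟩
    have : D.mat a⁻¹ - 1 = D.adj (D.mat a - 1) := by rw [mat_inv, adj_sub, adj_one]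
    rw [this]
    exact D.adj_mem_filtration ha'

theorem unipFiltration_anti (h : f * e = 0) : Antitone (D.unipFiltration h) :=
  fun _ _ hkl _ hg => ⟨hg.1, D.filtration_anti hkl hg.2⟩

theorem conj_mem_unipFiltration {h : f * e = 0} {g q : D.U22} (he : D.mat g * e = e * D.mat g)
    (hf : D.mat g * f = f * D.mat g) {k s t : ℤ} (hs : e * D.mat g ∈ D.filtration s)
    (ht : f * D.mat g⁻¹ ∈ D.filtration t) (hq : q ∈ D.unipFiltration h k) :
    g * q * g⁻¹ ∈ D.unipFiltration h (k + (s + t)) := by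
  refine ⟨conj_mem_unip he hf hq.1, ?_⟩
  have h1 : D.mat g * (D.mat q - 1) * D.mat g⁻¹ =
      e * D.mat g * (D.mat q - 1) * (f * D.mat g⁻¹) := by
    conv_lhs => rw [mem_unip.mp hq.1]
    rw [← he]
    noncomm_ring
  rw [mat_conj_sub_one, h1, show k + (s + t) = s + k + t by ring]
  exact D.filtration_mul (D.filtration_mul hs hq.2) ht

/-- Conjugation by the permutation matrix of `(1 2)(3 4)` exchanges the two unipotent groups. -/
theorem exists_swap (D : UnramifiedQuadratic F₀ F) :
    ∃ s : D.U22, s⁻¹ = s ∧ D.mat s ∈ D.filtration 0 ∧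
    D.mat s * idem₁ F = idem₂ F * D.mat s ∧ D.mat s * idem₂ F = idem₁ F * D.mat s := by
  set X : Matrix (Fin 4) (Fin 4) F := !![0, 1, 0, 0; 1, 0, 0, 0; 0, 0, 0, 1; 0, 0, 1, 0] with hX
  have hadj : D.adj X = X := by
    ext i j
    fin_cases i <;> fin_cases j <;> simp [hX, adj_apply, Fin.rev]
  have hXX : X * X = 1 := by
    ext i j
    fin_cases i <;> fin_cases j <;> simp [hX, Matrix.mul_apply, Fin.sum_univ_four]
  obtain ⟨s, hs⟩ := D.exists_mat_eq (X := X) (by rw [hadj, hXX])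
  refine ⟨s, ?_, ?_, ?_, ?_⟩
  · exact D.mat_injective (by rw [mat_inv, hs, hadj])
  · rw [hs, mem_filtration_iff]
    intro i j
    fin_cases i <;> fin_cases j <;> simp [hX, wt]
  · rw [hs]
    ext i j
    fin_cases i <;> fin_cases j <;> simp [hX, idem₁, idem₂]
  · rw [hs]
    ext i j
    fin_cases i <;> fin_cases j <;> simp [hX, idem₁, idem₂]

theorem conj_swap_mem {h : f * e = 0} {h' : e * f = 0} {s : D.U22} (hs : s⁻¹ = s)
    (h0 : D.mat s ∈ D.filtration 0) (he : D.mat s * e = f * D.mat s)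
    (hf : D.mat s * f = e * D.mat s) {k : ℤ} {q : D.U22} (hq : q ∈ D.unipFiltration h k) :
    s * q * s⁻¹ ∈ D.unipFiltration h' k := by
  refine ⟨conj_mem_unip he hf hq.1, ?_⟩
  rw [mat_conj_sub_one, hs]
  simpa using D.filtration_mul (D.filtration_mul h0 hq.2) h0

/-- Uniqueness of the decomposition with respect to lower unipotent, block diagonal and upper
unipotent matrices. -/
theorem unip_levi_unip_unique {x L y : Matrix (Fin 4) (Fin 4) F}
    (hx : x = idem₂ F * x * idem₁ F) (hy : y = idem₁ F * y * idem₂ F)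
    (hL : L * idem₁ F = idem₁ F * L) (h : (1 + x) * L * (1 + y) = 1) : x = 0 ∧ y = 0 ∧ L = 1 := by
  have e12 := idem₁_mul_idem₂ (F := F)
  have e21 := idem₂_mul_idem₁ (F := F)
  have e11 := idem₁_mul_idem₁ (F := F)
  have e22 := idem₂_mul_idem₂ (F := F)
  have hxx : x * x = 0 := by
    rw [hx]
    calc idem₂ F * x * idem₁ F * (idem₂ F * x * idem₁ F)
        = idem₂ F * x * (idem₁ F * idem₂ F) * (x * idem₁ F) := by noncomm_ring
      _ = 0 := by rw [e12]; simp
  have hyy : y * y = 0 := by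
    rw [hy]
    calc idem₁ F * y * idem₂ F * (idem₁ F * y * idem₂ F)
        = idem₁ F * y * (idem₂ F * idem₁ F) * (y * idem₂ F) := by noncomm_ring
      _ = 0 := by rw [e21]; simp
  have hL' : L = 1 - x - y + x * y := by
    calc L = (1 - x * x) * L * (1 - y * y) := by rw [hxx, hyy]; simp
      _ = (1 - x) * ((1 + x) * L * (1 + y)) * (1 - y) := by noncomm_ring
      _ = _ := by rw [h]; noncomm_ring
  have h1x : idem₁ F * x = 0 := by
    rw [hx, ← mul_assoc, ← mul_assoc, e12]; simp
  have hx2 : x * idem₂ F = 0 := by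
    rw [hx, mul_assoc, e12, mul_zero]
  have h2y : idem₂ F * y = 0 := by
    rw [hy, ← mul_assoc, ← mul_assoc, e21]; simp
  have hy1 : y * idem₁ F = 0 := by
    rw [hy, mul_assoc, e21, mul_zero]
  have h1y : idem₁ F * y = y := by
    rw [hy, ← mul_assoc, ← mul_assoc, e11]
  have hx1 : x * idem₁ F = x := by
    rw [hx, mul_assoc, e11]
  have hy0 : y = 0 := by
    have h1 : idem₁ F * L * idem₂ F = 0 := by rw [← hL, mul_assoc, e12, mul_zero]
    have hy2 : y * idem₂ F = y := by rw [hy, mul_assoc, e22]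
    have h2 : idem₁ F * L * idem₂ F = -y := by
      rw [hL']
      calc idem₁ F * (1 - x - y + x * y) * idem₂ F
          = idem₁ F * idem₂ F - (idem₁ F * x) * idem₂ F - (idem₁ F * y) * idem₂ F +
              (idem₁ F * x) * (y * idem₂ F) := by noncomm_ring
        _ = -y := by rw [e12, h1x, h1y, hy2]; simp
    rw [h2] at h1
    exact neg_eq_zero.mp h1
  have hx0 : x = 0 := by
    have h1 : idem₂ F * L * idem₁ F = 0 := by
      rw [mul_assoc, hL, ← mul_assoc, e21, zero_mul]
    have h2x : idem₂ F * x = x := by rw [hx, ← mul_assoc, ← mul_assoc, e22]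
    rw [hL', hy0] at h1
    have h2 : idem₂ F * (1 - x - 0 + x * 0) * idem₁ F = -x := by
      calc idem₂ F * (1 - x - 0 + x * 0) * idem₁ F
          = idem₂ F * idem₁ F - (idem₂ F * x) * idem₁ F := by noncomm_ring
        _ = -x := by rw [e21, h2x, hx1]; simp
    rw [h2] at h1
    exact neg_eq_zero.mp h1
  exact ⟨hx0, hy0, by rw [hL', hx0, hy0]; simp⟩

end UnramifiedQuadratic

namespace UnramifiedQuadratic

variable {F₀ F : Type*} [Field F₀] [ValuativeRel F₀] [TopologicalSpace F₀]
    [IsNonarchimedeanLocalField F₀] [Field F] [ValuativeRel F] [TopologicalSpace F]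
    [IsNonarchimedeanLocalField F] [Algebra F₀ F] [ValuativeExtension F₀ F]
    (D : UnramifiedQuadratic F₀ F)

/-! ### The Iwahori decomposition -/

theorem commute_idem₁_of_block {L : Matrix (Fin 4) (Fin 4) F} (h1 : idem₁ F * L * idem₂ F = 0)
    (h2 : idem₂ F * L * idem₁ F = 0) : L * idem₁ F = idem₁ F * L := by
  have e1 : L * idem₁ F = idem₁ F * L * idem₁ F + idem₂ F * L * idem₁ F := by
    rw [← add_mul, ← add_mul, idem₁_add_idem₂, one_mul]
  have e2 : idem₁ F * L = idem₁ F * L * idem₁ F + idem₁ F * L * idem₂ F := by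
    rw [← mul_add, idem₁_add_idem₂, mul_one]
  rw [e1, h2, add_zero]
  rw [h1, add_zero] at e2
  exact e2.symm

/-- The `LDU` factorisation of `1 + Y` with respect to `V₁ ⊕ V₂`: the diagonal blocks of `1 + Y` are
invertible since `Y` is topologically nilpotent. -/
theorem exists_lower_block_upper {k : ℤ} (hk : 1 ≤ k) {Y : Matrix (Fin 4) (Fin 4) F}
    (hY : Y ∈ D.filtration k) :
    ∃ x ∈ D.filtration k, ∃ y ∈ D.filtration k, ∃ L : Matrix (Fin 4) (Fin 4) F,
      x = idem₂ F * x * idem₁ F ∧ y = idem₁ F * y * idem₂ F ∧ L * idem₁ F = idem₁ F * L ∧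
      1 + Y = (1 + x) * L * (1 + y) := by
  have e12 := idem₁_mul_idem₂ (F := F)
  have e21 := idem₂_mul_idem₁ (F := F)
  have e11 := idem₁_mul_idem₁ (F := F)
  have e22 := idem₂_mul_idem₂ (F := F)
  have m1 := D.idem₁_mem
  have m2 := D.idem₂_mem
  have sand : ∀ {e f X : Matrix (Fin 4) (Fin 4) F}, e ∈ D.filtration 0 → f ∈ D.filtration 0 →
      X ∈ D.filtration k → e * X * f ∈ D.filtration k := fun he hf hX => by
    simpa using D.filtration_mul (D.filtration_mul he hX) hf
  obtain ⟨Z, hZ, hZ1, hZ2⟩ := D.exists_inv_one_add hk (sand m1 m1 hY)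
  have hZ0 : 1 + Z ∈ D.filtration 0 :=
    add_mem D.one_mem_filtration (D.filtration_anti (by omega) hZ)
  set x := idem₂ F * Y * idem₁ F * (1 + Z) * idem₁ F with hx
  set y := idem₁ F * (1 + Z) * idem₁ F * Y * idem₂ F with hy
  have hx' : x ∈ D.filtration k := by
    have := D.filtration_mul (D.filtration_mul (sand m2 m1 hY) hZ0) m1
    simpa using this
  have hy' : y ∈ D.filtration k := by
    have := D.filtration_mul (D.filtration_mul (D.filtration_mul (D.filtration_mul m1 hZ0) m1) hY)
      m2
    simpa using this
  have hxx : x * x = 0 := by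
    calc x * x = idem₂ F * Y * idem₁ F * (1 + Z) * (idem₁ F * idem₂ F) * (Y * idem₁ F * (1 + Z) *
          idem₁ F) := by rw [hx]; noncomm_ring
      _ = 0 := by rw [e12]; simp
  have hyy : y * y = 0 := by
    calc y * y = idem₁ F * (1 + Z) * idem₁ F * Y * (idem₂ F * idem₁ F) * ((1 + Z) * idem₁ F * Y *
          idem₂ F) := by rw [hy]; noncomm_ring
      _ = 0 := by rw [e21]; simp
  -- `1 + Z` inverts the block `e (1 + Y) e`, `e = idem₁ F`
  have hA : idem₁ F * (1 + Y) * idem₁ F * (1 + Z) * idem₁ F = idem₁ F := by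
    have : idem₁ F * (1 + Y) * idem₁ F = idem₁ F * (1 + idem₁ F * Y * idem₁ F) := by
      simp only [mul_add, add_mul, mul_one, ← mul_assoc, e11]
    rw [this, mul_assoc (idem₁ F), hZ1, mul_one, e11]
  have hA' : idem₁ F * (1 + Z) * idem₁ F * (1 + Y) * idem₁ F = idem₁ F := by
    have : idem₁ F * (1 + Y) * idem₁ F = (1 + idem₁ F * Y * idem₁ F) * idem₁ F := by
      simp only [mul_add, add_mul, mul_one, one_mul, mul_assoc, e11]
    calc idem₁ F * (1 + Z) * idem₁ F * (1 + Y) * idem₁ F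
        = idem₁ F * (1 + Z) * (idem₁ F * (1 + Y) * idem₁ F) := by noncomm_ring
      _ = idem₁ F * ((1 + Z) * (1 + idem₁ F * Y * idem₁ F)) * idem₁ F := by
        rw [this]; noncomm_ring
      _ = _ := by rw [hZ2, mul_one, e11]
  refine ⟨x, hx', y, hy', (1 - x) * (1 + Y) * (1 - y), ?_, ?_, ?_, ?_⟩
  · rw [hx]
    simp only [mul_assoc, e11]
    rw [← mul_assoc (idem₂ F) (idem₂ F), e22]
  · rw [hy]
    simp only [mul_assoc, e22]
    rw [← mul_assoc (idem₁ F) (idem₁ F), e11]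
  · apply commute_idem₁_of_block
    · have h1 : idem₁ F * (1 - x) = idem₁ F := by
        rw [mul_sub, mul_one, hx]
        simp only [← mul_assoc, e12, zero_mul, sub_zero]
      have h2 : y * idem₂ F = y := by rw [hy, mul_assoc, e22]
      calc idem₁ F * ((1 - x) * (1 + Y) * (1 - y)) * idem₂ F
          = (idem₁ F * (1 - x)) * (1 + Y) * (idem₂ F - y * idem₂ F) := by noncomm_ring
        _ = idem₁ F * idem₂ F + idem₁ F * Y * idem₂ F -
            (idem₁ F * (1 + Y) * idem₁ F * (1 + Z) * idem₁ F) * Y * idem₂ F := by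
          rw [h1, h2, hy]; noncomm_ring
        _ = 0 := by rw [hA, e12]; noncomm_ring
    · have h1 : (1 - y) * idem₁ F = idem₁ F := by
        rw [sub_mul, one_mul, hy]
        simp only [mul_assoc, e21, mul_zero, sub_zero]
      have h2 : idem₂ F * x = x := by rw [hx]; simp only [← mul_assoc, e22]
      calc idem₂ F * ((1 - x) * (1 + Y) * (1 - y)) * idem₁ F
          = (idem₂ F - idem₂ F * x) * (1 + Y) * ((1 - y) * idem₁ F) := by noncomm_ring
        _ = idem₂ F * idem₁ F + idem₂ F * Y * idem₁ F -
            idem₂ F * Y * (idem₁ F * (1 + Z) * idem₁ F * (1 + Y) * idem₁ F) := by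
          rw [h1, h2, hx]; noncomm_ring
        _ = 0 := by rw [hA', e21]; noncomm_ring
  · calc 1 + Y = (1 - x * x) * (1 + Y) * (1 - y * y) := by rw [hxx, hyy]; simp
      _ = _ := by noncomm_ring

variable {D}

theorem adj_idem_sandwich (D : UnramifiedQuadratic F₀ F) {e f x : Matrix (Fin 4) (Fin 4) F}
    (he : D.adj e = f) (hx : x = e * x * f) : D.adj x = e * D.adj x * f := by
  have hf : D.adj f = e := by rw [← he, adj_adj]
  conv_lhs => rw [hx]
  rw [adj_mul, adj_mul, he, hf, mul_assoc]

/-- The factors of a unitary matrix are unitary, by uniqueness of the decomposition. -/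
theorem exists_unip_levi_unip {k : ℤ} (hk : 1 ≤ k) {j : D.U22}
    (hj : D.mat j - 1 ∈ D.filtration k) :
    ∃ q ∈ D.unipFiltration (idem₁_mul_idem₂ (F := F)) k, ∃ l ∈ D.levi,
      ∃ p ∈ D.unipFiltration (idem₂_mul_idem₁ (F := F)) k, j = q * l * p := by
  obtain ⟨x, hx, y, hy, L, hx', hy', hL, e⟩ := D.exists_lower_block_upper hk hj
  rw [add_sub_cancel] at e
  have e12 := idem₁_mul_idem₂ (F := F)
  have e21 := idem₂_mul_idem₁ (F := F)
  have ax := adj_idem_sandwich D D.adj_idem₂ hx'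
  have ay := adj_idem_sandwich D D.adj_idem₁ hy'
  have mul0 : ∀ {e f a b : Matrix (Fin 4) (Fin 4) F}, f * e = 0 → a = e * a * f → b = e * b * f →
      a * b = 0 := fun {e f a b} h ha hb => by
    rw [ha, hb]
    calc e * a * f * (e * b * f) = e * a * (f * e) * (b * f) := by noncomm_ring
      _ = 0 := by rw [h]; simp
  have hL2 : L * idem₂ F = idem₂ F * L := by rw [idem₂_eq, mul_sub, sub_mul, hL, mul_one, one_mul]
  obtain ⟨L', hL'⟩ : ∃ L', L' = D.adj L := ⟨_, rfl⟩
  have aL1 : L' * idem₁ F = idem₁ F * L' := by rw [hL', ← D.adj_idem₂, ← adj_mul, ← adj_mul, hL2]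
  have aL2 : L' * idem₂ F = idem₂ F * L' := by rw [hL', ← D.adj_idem₁, ← adj_mul, ← adj_mul, hL]
  obtain ⟨w, hw⟩ : ∃ w, w = x + D.adj x := ⟨_, rfl⟩
  obtain ⟨u, hu⟩ : ∃ u, u = y + D.adj y := ⟨_, rfl⟩
  have hw' : w = idem₂ F * w * idem₁ F := by
    rw [hw, mul_add, add_mul, ← hx', ← ax]
  have hu' : u = idem₁ F * u * idem₂ F := by
    rw [hu, mul_add, add_mul, ← hy', ← ay]
  have h1 : (1 + D.adj x) * (1 + x) = 1 + w := by
    calc (1 + D.adj x) * (1 + x) = 1 + (x + D.adj x) + D.adj x * x := by noncomm_ring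
      _ = _ := by rw [mul0 e12 ax hx', add_zero, hw]
  have h2 : (1 + y) * (1 + D.adj y) = 1 + u := by
    calc (1 + y) * (1 + D.adj y) = 1 + (y + D.adj y) + y * D.adj y := by noncomm_ring
      _ = _ := by rw [mul0 e21 hy' ay, add_zero, hu]
  have h3 : (1 + w) * (L * (1 + u) * L') = 1 := by
    have hjj : D.mat j * D.adj (D.mat j) = 1 := j.2
    rw [e, adj_mul, adj_mul, adj_add, adj_add, adj_one] at hjj
    have h4 : (1 + x) * (L * (1 + u) * L') * (1 + D.adj x) = 1 := by
      refine Eq.trans ?_ hjj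
      rw [← h2, hL']
      simp only [mul_assoc]
    rw [← h1, mul_assoc]
    exact mul_eq_one_comm.mp h4
  obtain ⟨R, hR⟩ : ∃ R, R = (1 + w) * L * (1 + u) := ⟨_, rfl⟩
  have hRL : R * L' = 1 := by
    rw [hR]
    simpa only [mul_assoc] using h3
  have hLR : L' * R = 1 := mul_eq_one_comm.mp hRL
  have hR1 : R * idem₁ F = idem₁ F * R := by
    calc R * idem₁ F = R * (idem₁ F * L') * R := by rw [mul_assoc, mul_assoc, hLR, mul_one]
      _ = _ := by rw [← aL1, ← mul_assoc, hRL, one_mul]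
  obtain ⟨hw0, hu0, hLL⟩ := unip_levi_unip_unique (x := L' * w * R) (y := u) (L := L' * L)
    (by
      conv_lhs => rw [hw']
      calc L' * (idem₂ F * w * idem₁ F) * R = (L' * idem₂ F) * w * (idem₁ F * R) := by noncomm_ring
        _ = _ := by rw [aL2, ← hR1]; noncomm_ring) hu' (by rw [mul_assoc, hL, ← mul_assoc, aL1,
          mul_assoc]) (by
      calc (1 + L' * w * R) * (L' * L) * (1 + u)
          = L' * L * (1 + u) + L' * w * (R * L') * (L * (1 + u)) := by noncomm_ring
        _ = L' * R := by rw [hRL, hR]; noncomm_ring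
        _ = 1 := hLR)
  have hw00 : w = 0 := by
    calc w = (R * L') * w * (R * L') := by rw [hRL]; simp
      _ = R * (L' * w * R) * L' := by noncomm_ring
      _ = 0 := by rw [hw0]; simp
  obtain ⟨q, hq⟩ := D.exists_mat_eq (X := 1 + x) (by
    apply mul_eq_one_comm.mp
    rw [adj_add, adj_one, h1, hw00, add_zero])
  obtain ⟨p, hp⟩ := D.exists_mat_eq (X := 1 + y) (by rw [adj_add, adj_one, h2, hu0, add_zero])
  obtain ⟨l, hl⟩ := D.exists_mat_eq (X := L) (mul_eq_one_comm.mp (hL' ▸ hLL))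
  refine ⟨q, ⟨?_, ?_⟩, l, ?_, p, ⟨?_, ?_⟩, ?_⟩
  · rw [mem_unip, hq, add_sub_cancel_left, ← hx']
  · rwa [hq, add_sub_cancel_left]
  · rw [mem_levi, hl, hL]
  · rw [mem_unip, hp, add_sub_cancel_left, ← hy']
  · rwa [hp, add_sub_cancel_left]
  · exact D.mat_injective (by rw [mat_mul, mat_mul, hq, hl, hp, e])

/-! ### The cover -/

namespace SplitStratum

variable (S : D.SplitStratum)

theorem idem_sandwich_mem_Bperp {e f X : Matrix (Fin 4) (Fin 4) F} (he : e ∈ S.B) (hfe : f * e = 0)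
    : e * X * f ∈ S.Bperp := fun Y hY => by
  rw [trace_mul_comm, ← mul_assoc, ← mul_assoc, S.mul_comm_of_mem_B hY he, trace_mul_comm,
    ← mul_assoc, ← mul_assoc, hfe]
  simp

theorem unipFiltration_le_J {e f : Matrix (Fin 4) (Fin 4) F} (he : e ∈ S.B) (h : f * e = 0) :
    D.unipFiltration h S.m ≤ S.J := fun g hg => by
  rw [mem_J]
  refine S.Bperp_le_latJ ?_ hg.2
  rw [mem_unip.mp hg.1]
  exact S.idem_sandwich_mem_Bperp he h

theorem psi_eq_one_of_mem_unip {e f : Matrix (Fin 4) (Fin 4) F} (he : e ∈ S.B) {h : f * e = 0}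
    {g : D.U22} (hg : g ∈ D.unip h) : S.psi g = 1 := by
  have h0 := S.idem_sandwich_mem_Bperp (X := D.mat g - 1) he h S.beta S.beta_mem_B
  rw [psi, mem_unip.mp hg, trace_mul_comm, h0, map_zero, AddChar.map_zero_eq_one]

theorem psi_conj {g x : D.U22} (hg : g ∈ S.Gprime) : S.psi (g⁻¹ * x * g) = S.psi x := by
  have hb : S.beta * D.mat g⁻¹ = D.mat g⁻¹ * S.beta := S.mem_B.mp (inv_mem hg)
  have e : S.beta * (D.mat (g⁻¹ * x * g) - 1) =
      D.mat g⁻¹ * (S.beta * (D.mat x - 1)) * D.mat g := by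
    have := mat_conj_sub_one (D := D) g⁻¹ x
    rw [inv_inv] at this
    rw [this, ← mul_assoc, ← mul_assoc, hb]
    noncomm_ring
  rw [psi, psi, e, trace_mul_comm, ← mul_assoc, D.mat_mul_mat_inv, one_mul]

theorem mul_idem₁_of_mem_Gprime {g : D.U22} (hg : g ∈ S.Gprime) :
    D.mat g * idem₁ F = idem₁ F * D.mat g := S.Gprime_le_levi hg

theorem mul_idem₂_of_mem_Gprime {g : D.U22} (hg : g ∈ S.Gprime) :
    D.mat g * idem₂ F = idem₂ F * D.mat g := D.mul_idem₂_of_mem_levi (S.Gprime_le_levi hg)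

/-- `G'` normalises `J ∩ M`: conjugation is trivial on the component in `B` and preserves the
filtration on block diagonal matrices. -/
theorem conj_mem_J_of_mem_levi {g l : D.U22} (hg : g ∈ S.Gprime) (hl : l ∈ S.J) (hl' : l ∈ D.levi) :
    g * l * g⁻¹ ∈ S.J := by
  rw [mem_J] at *
  have hgi : D.mat g⁻¹ ∈ S.B := inv_mem hg
  obtain ⟨b, c, hb, hbB, hc, hcB, e⟩ := (S.mem_latJ_iff _).mp hl
  rw [S.half_n] at hc
  have hc1 : c * idem₁ F = idem₁ F * c := by
    have h1 : c = D.mat l - 1 - b := by rw [← e]; abel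
    rw [h1, sub_mul, sub_mul, mul_sub, mul_sub, D.mem_levi.mp hl',
      S.mul_comm_of_mem_B hbB S.idem₁_mem_B, one_mul, mul_one]
  have hc2 : c * idem₂ F = idem₂ F * c := by
    rw [idem₂_eq, mul_sub, sub_mul, hc1, mul_one, one_mul]
  have hbb : D.mat g * b * D.mat g⁻¹ = b := by
    rw [S.mul_comm_of_mem_B hg hbB, mul_assoc, D.mat_mul_mat_inv, mul_one]
  obtain ⟨s1, s2⟩ := S.shifts_shift hg
  obtain ⟨t1, t2⟩ := (S.shifts_shift hg).inv (S.Gprime_le_levi hg)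
  rw [mat_conj_sub_one, ← e, mul_add, add_mul, hbb]
  refine add_mem ((S.mem_latJ_iff b).mpr ⟨b, 0, hb, hbB, zero_mem _, zero_mem _, add_zero b⟩)
    (S.Bperp_le_latJ (S.Bperp_mul_B (S.B_mul_Bperp hg hcB) hgi) ?_)
  have e1 : D.mat g * c * D.mat g⁻¹ = idem₁ F * D.mat g * c * (idem₁ F * D.mat g⁻¹) +
      idem₂ F * D.mat g * c * (idem₂ F * D.mat g⁻¹) := by
    have h1 : idem₁ F * D.mat g * c * (idem₁ F * D.mat g⁻¹) =
        idem₁ F * (D.mat g * c * D.mat g⁻¹) := by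
      rw [← mul_assoc, mul_assoc _ c, hc1, ← mul_assoc _ (idem₁ F), mul_assoc _ (D.mat g),
        S.mul_idem₁_of_mem_Gprime hg, ← mul_assoc, idem₁_mul_idem₁]
      noncomm_ring
    have h2 : idem₂ F * D.mat g * c * (idem₂ F * D.mat g⁻¹) =
        idem₂ F * (D.mat g * c * D.mat g⁻¹) := by
      rw [← mul_assoc, mul_assoc _ c, hc2, ← mul_assoc _ (idem₂ F), mul_assoc _ (D.mat g),
        S.mul_idem₂_of_mem_Gprime hg, ← mul_assoc, idem₂_mul_idem₂]
      noncomm_ring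
    rw [h1, h2, ← add_mul, idem₁_add_idem₂, one_mul]
  rw [e1]
  have m1 := D.filtration_mul (D.filtration_mul s1 hc) t1
  have m2 := D.filtration_mul (D.filtration_mul s2 hc) t2
  exact add_mem (by simpa using m1) (by simpa using m2)

/-- The groups `N k = Um ∩ (1 + 𝔞_{m+2k})` and `P k = Up ∩ (1 + 𝔞_{m+2k})` have the same index for
all `k`, since `ζ` permutes each of these families and a permutation matrix exchanges them. -/
theorem exists_relIndex_eq : ∃ Q : ℕ, Q ≠ 0 ∧ ∀ k : ℤ,
    (D.unipFiltration (idem₁_mul_idem₂ (F := F)) (S.m + 2 * (k + 1))).relIndex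
      (D.unipFiltration idem₁_mul_idem₂ (S.m + 2 * k)) = Q ∧
    (D.unipFiltration (idem₂_mul_idem₁ (F := F)) (S.m + 2 * (k + 1))).relIndex
      (D.unipFiltration idem₂_mul_idem₁ (S.m + 2 * k)) = Q := by
  obtain ⟨z, hz, -, h1⟩ := S.exists_mem_Gprime_shift_eq_one
  set N := D.unipFiltration (idem₁_mul_idem₂ (F := F))
  set P := D.unipFiltration (idem₂_mul_idem₁ (F := F))
  obtain ⟨s, hs, hs0, hs1, hs2⟩ := D.exists_swap
  have hNP : ∀ k, (N k).map (MulAut.conj s).toMonoidHom = P k := fun k =>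
    HeckeTheory.map_conj_eq (fun x hx => conj_swap_mem hs hs0 hs2 hs1 hx) fun x hx => by
      have := conj_swap_mem (h' := idem₁_mul_idem₂ (F := F)) hs hs0 hs1 hs2 hx
      rw [hs] at this ⊢
      exact this
  have hconj : ∀ g ∈ S.Gprime, ∀ k, ∀ x ∈ N k, g * x * g⁻¹ ∈ N (k + 2 * S.shift g) :=
    fun g hg k x hx => by
      rw [two_mul]
      have ht := ((S.shifts_shift hg).inv (S.Gprime_le_levi hg)).1
      rw [neg_neg] at ht
      exact conj_mem_unipFiltration (S.mul_idem₂_of_mem_Gprime hg) (S.mul_idem₁_of_mem_Gprime hg)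
        (S.shifts_shift hg).2 ht hx
  have hz' : ∀ k r : ℤ, (N r).map (MulAut.conj (z ^ k)).toMonoidHom = N (r + 2 * k) := fun k r => by
    have hk : S.shift (z ^ k) = k := by rw [S.shift_zpow hz, h1, mul_one]
    refine HeckeTheory.map_conj_eq (fun x hx => ?_) fun x hx => ?_
    · have := hconj _ (zpow_mem hz k) r x hx
      rwa [hk] at this
    · have := hconj _ (inv_mem (zpow_mem hz k)) _ x hx
      rwa [S.shift_inv (zpow_mem hz k), hk, inv_inv,
        show r + 2 * k + 2 * -k = r by ring] at this
  refine ⟨(N (S.m + 2)).relIndex (N S.m), ?_, fun k => ?_⟩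
  · have hle : N S.m ≤ D.congruenceSubgroup S.m := fun g hg =>
      (D.mem_congruenceSubgroup_of_nonneg (by positivity)).mpr hg.2
    have h0 := HeckeTheory.relIndex_ne_zero_of_isOpen (D.isOpen_congruenceSubgroup (S.m + 2))
      (D.isCompact_congruenceSubgroup S.m)
    have h1 : (D.congruenceSubgroup (S.m + 2)).relIndex (N S.m) ≠ 0 :=
      fun h => h0 (Subgroup.relIndex_eq_zero_of_le_right hle h)
    rw [← Subgroup.inf_relIndex_right] at h1
    have h2 : D.congruenceSubgroup (S.m + 2) ⊓ N S.m ≤ N (S.m + 2) := fun g hg =>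
      ⟨hg.2.1, hg.1.2⟩
    exact fun h => h1 (Subgroup.relIndex_eq_zero_of_le_left h2 h)
  · have hN : (N (S.m + 2 * (k + 1))).relIndex (N (S.m + 2 * k)) =
        (N (S.m + 2)).relIndex (N S.m) :=
      HeckeTheory.relIndex_eq_of_conj (g := z ^ k)
        (by rw [hz', show (S.m : ℤ) + 2 + 2 * k = S.m + 2 * (k + 1) by ring]) (hz' k _)
    exact ⟨hN, by rw [← hN]; exact HeckeTheory.relIndex_eq_of_conj (hNP _) (hNP _)⟩

/-- The covering data for `(J, Ψ)` and `G'`: the Levi subgroup is the stabiliser of the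
decomposition `V = (F e₁ ⊕ F e₃) ⊕ (F e₂ ⊕ F e₄)`. -/
def cover : HeckeTheory.Cover S.J S.Psi S.Gprime where
  Um := D.unip idem₁_mul_idem₂
  Up := D.unip idem₂_mul_idem₁
  M := D.levi
  N k := D.unipFiltration idem₁_mul_idem₂ (S.m + 2 * k)
  P k := D.unipFiltration idem₂_mul_idem₁ (S.m + 2 * k)
  v := S.shift
  Q := S.exists_relIndex_eq.choose
  Q_ne := S.exists_relIndex_eq.choose_spec.1
  N_le _ _ h := h.1
  P_le _ _ h := h.1
  N_anti _ _ h := unipFiltration_anti _ (by omega)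
  P_anti _ _ h := unipFiltration_anti _ (by omega)
  N_zero_le := by
    simpa using S.unipFiltration_le_J S.idem₂_mem_B (idem₁_mul_idem₂ (F := F))
  P_zero_le := by
    simpa using S.unipFiltration_le_J S.idem₁_mem_B (idem₂_mul_idem₁ (F := F))
  conj_Um m hm u hu := conj_mem_unip (D.mul_idem₂_of_mem_levi hm) (D.mem_levi.mp hm) hu
  conj_Up m hm u hu := conj_mem_unip (D.mem_levi.mp hm) (D.mul_idem₂_of_mem_levi hm) hu
  unique u hu m hm p hp h := by
    have h' := congrArg D.mat h
    rw [mat_mul, mat_mul, mat_one] at h'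
    obtain ⟨h1, h2, h3⟩ := unip_levi_unip_unique (x := D.mat u - 1) (y := D.mat p - 1) hu hp hm
      (by rwa [add_sub_cancel, add_sub_cancel])
    exact ⟨D.mat_injective (sub_eq_zero.mp h1), D.mat_injective h3,
      D.mat_injective (sub_eq_zero.mp h2)⟩
  decomp j hj := by
    have hm := S.m_pos
    obtain ⟨q, hq, l, hl, p, hp, e⟩ := exists_unip_levi_unip (by omega) (S.J_le hj).2
    have hq' := S.unipFiltration_le_J S.idem₂_mem_B _ hq
    have hp' := S.unipFiltration_le_J S.idem₁_mem_B _ hp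
    refine ⟨q, by simpa using hq, l, Subgroup.mem_inf.mpr ⟨?_, hl⟩, p, by simpa using hp, e⟩
    have : l = q⁻¹ * j * p⁻¹ := by rw [e]; group
    rw [this]
    exact mul_mem (mul_mem (inv_mem hq') hj) (inv_mem hp')
  conj_N l hl k q hq := by
    have h0 := (S.J_le hl.1).1
    have h1 := (S.J_le (inv_mem hl.1)).1
    have := conj_mem_unipFiltration (D.mul_idem₂_of_mem_levi hl.2) (D.mem_levi.mp hl.2)
      (D.filtration_mul D.idem₂_mem h0) (D.filtration_mul D.idem₁_mem h1) hq
    simpa using this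
  conj_P l hl k q hq := by
    have h0 := (S.J_le hl.1).1
    have h1 := (S.J_le (inv_mem hl.1)).1
    have := conj_mem_unipFiltration (D.mem_levi.mp hl.2) (D.mul_idem₂_of_mem_levi hl.2)
      (D.filtration_mul D.idem₁_mem h0) (D.filtration_mul D.idem₂_mem h1) hq
    simpa using this
  le_M := S.Gprime_le_levi
  conj_L g hg l hl := S.conj_mem_J_of_mem_levi hg hl.1 hl.2
  v_mul g hg h hh := S.shift_mul hg hh
  v_J g hg h := (S.shift_eq_zero_iff hg).mpr (S.J_le h).1
  shift_N g hg k q hq := by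
    have ht := ((S.shifts_shift hg).inv (S.Gprime_le_levi hg)).1
    rw [neg_neg] at ht
    have := conj_mem_unipFiltration (S.mul_idem₂_of_mem_Gprime hg) (S.mul_idem₁_of_mem_Gprime hg)
      (S.shifts_shift hg).2 ht hq
    rwa [show (S.m : ℤ) + 2 * k + (S.shift g + S.shift g) = S.m + 2 * (k + S.shift g) by ring]
      at this
  shift_P g hg k q hq := by
    have ht := ((S.shifts_shift hg).inv (S.Gprime_le_levi hg)).2
    have := conj_mem_unipFiltration (S.mul_idem₁_of_mem_Gprime hg) (S.mul_idem₂_of_mem_Gprime hg)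
      (S.shifts_shift hg).1 ht hq
    rwa [show (S.m : ℤ) + 2 * k + (-S.shift g + -S.shift g) = S.m + 2 * (k - S.shift g) by ring]
      at this
  index_N k := (S.exists_relIndex_eq.choose_spec.2 k).1
  index_P k := (S.exists_relIndex_eq.choose_spec.2 k).2
  χ_N j hj := S.psi_eq_one_of_mem_unip S.idem₂_mem_B hj.1
  χ_P j hj := S.psi_eq_one_of_mem_unip S.idem₁_mem_B hj.1
  χ_conj g hg x y h := by
    change S.psi y = S.psi x
    rw [h, S.psi_conj hg]
  intertwine g h := S.intertwining fun x hx hx' => h ⟨x, hx⟩ ⟨_, hx'⟩ rfl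

theorem isClosed_Gprime : IsClosed (S.Gprime : Set D.U22) := by
  haveI := t2Space_field F
  have : (S.Gprime : Set D.U22) = {g | S.beta * D.mat g = D.mat g * S.beta} := by
    ext g; exact S.mem_B
  rw [this]
  exact isClosed_eq (continuous_const.mul D.continuous_mat) (D.continuous_mat.mul continuous_const)

theorem exists_heckeAlgebra_equiv :
    ∃ η : HeckeTheory.HeckeAlgebra S.Jprime S.PsiPrime ≃⋆ₐ[ℂ] HeckeTheory.HeckeAlgebra S.J S.Psi,
      ∀ f : HeckeTheory.HeckeAlgebra S.Jprime S.PsiPrime,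
        Function.support (η f : D.U22 → ℂ) = (S.J : Set D.U22) *
          (Subtype.val '' Function.support (f : S.Gprime → ℂ) : Set D.U22) * (S.J : Set D.U22) :=
  ⟨S.cover.heckeEquiv S.isOpen_J S.isCompact_J S.isClosed_Gprime,
    S.cover.support_heckeEquiv S.isOpen_J S.isCompact_J S.isClosed_Gprime⟩

end SplitStratum

end UnramifiedQuadratic

namespace HeckeTheory

/-! ### Matrix coefficients of representations containing a character with a cover -/

/-- Among countably many nonzero vectors infinitely many are not in the kernel of a suitable linear
functional. -/
theorem exists_dual_infinite {X : Type*} [AddCommGroup X] [Module ℂ X] {u : ℕ → X}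
    (hu : ∀ k, u k ≠ 0) : ∃ ξ : Module.Dual ℂ X, {k | ξ (u k) ≠ 0}.Infinite := by
  obtain ⟨b, hb, hspan, hli⟩ := exists_linearIndependent ℂ (Set.range u)
  replace hli : LinearIndepOn ℂ id b := hli
  set B := Module.Basis.extend hli with hB
  have hsub := hli.subset_extend (Set.subset_univ b)
  have hBb : ∀ x ∈ b, ∃ i, B i = x := fun x hx =>
    ⟨⟨x, hsub hx⟩, Module.Basis.extend_apply_self hli _⟩
  rcases Set.finite_or_infinite b with hfin | hinf
  · -- pigeonhole for the finitely many coordinates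
    have h1 : ∀ k, ∃ x : b, ∃ ξ : Module.Dual ℂ X, ξ = B.coord ⟨x, hsub x.2⟩ ∧
        ξ (u k) ≠ 0 := by
      intro k
      by_contra hcon
      push Not at hcon
      refine hu k (B.ext_elem fun i => ?_)
      rw [map_zero, Finsupp.zero_apply]
      have hk : u k ∈ Submodule.span ℂ b := by
        rw [hspan]; exact Submodule.subset_span ⟨k, rfl⟩
      by_cases hi : (i : X) ∈ b
      · exact hcon ⟨i, hi⟩ _ rfl
      · have h2 : Submodule.span ℂ b ≤ LinearMap.ker (B.coord i) := by
          rw [Submodule.span_le]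
          intro x hx
          have : B.repr x i = 0 := by
            have e : B ⟨x, hsub hx⟩ = x := Module.Basis.extend_apply_self hli _
            rw [← e, B.repr_self, Finsupp.single_eq_of_ne]
            rintro rfl
            exact hi hx
          exact this
        exact h2 hk
    choose x ξ hξ hne using h1
    haveI := hfin.to_subtype
    obtain ⟨y, hy⟩ := Finite.exists_infinite_fiber x
    refine ⟨B.coord ⟨y, hsub y.2⟩, (Set.infinite_coe_iff.mp hy).mono ?_⟩
    intro k hk
    have := hne k
    rwa [hξ k, show x k = y from hk] at this
  · refine ⟨B.constr ℂ fun _ => (1 : ℂ), fun hf => hinf ((hf.image u).subset ?_)⟩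
    intro x hx
    obtain ⟨k, rfl⟩ := hb hx
    obtain ⟨i, hi⟩ := hBb _ hx
    refine ⟨k, ?_, rfl⟩
    change B.constr ℂ _ (u k) ≠ 0
    rw [← hi, B.constr_basis]
    exact one_ne_zero

section

variable {G : Type*} [Group G] [TopologicalSpace G] [IsTopologicalGroup G] {J : Subgroup G}
  {χ : J →* Circle} {W : Type*} [AddCommGroup W] [Module ℂ W] {π : Representation ℂ G W}

variable (χ) in
/-- Linear functionals on which `J` acts through `χ`. -/
def IsEquivariant (π : Representation ℂ G W) (ξ : Module.Dual ℂ W) : Prop :=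
  ∀ (j : J) (w : W), ξ (π j w) = χ j * ξ w

theorem IsEquivariant.isSmoothFunctional (hJ : IsOpen (J : Set G))
    (hχ : ∃ U : Subgroup G, IsOpen (U : Set G) ∧ ∀ j : J, (j : G) ∈ U → χ j = 1)
    {ξ : Module.Dual ℂ W} (hξ : IsEquivariant χ π ξ) : IsSmoothFunctional π ξ := by
  obtain ⟨U, hU, h⟩ := hχ
  refine ⟨U ⊓ J, hU.inter hJ, fun u hu w => ?_⟩
  rw [hξ ⟨u, hu.2⟩ w, h ⟨u, hu.2⟩ hu.1, Circle.coe_one, one_mul]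

theorem continuous_coefficient
    (hχ : ∃ U : Subgroup G, IsOpen (U : Set G) ∧ ∀ j : J, (j : G) ∈ U → χ j = 1)
    (hπ : IsSmoothRep π) (ξ : Module.Dual ℂ W) (w : W) :
    Continuous fun j : J => (χ j : ℂ) * ξ (π (j⁻¹ : J) w) := by
  obtain ⟨U, hU, h⟩ := hχ
  obtain ⟨V, hV, h'⟩ := hπ w
  refine IsLocallyConstant.continuous ((IsLocallyConstant.iff_eventually_eq _).mpr fun j => ?_)
  have hopen : IsOpen {y : J | (y * j⁻¹ : G) ∈ U ⊓ V} :=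
    (hU.inter hV).preimage (continuous_subtype_val.mul continuous_const)
  filter_upwards [hopen.mem_nhds (by
    change (j * j⁻¹ : G) ∈ U ⊓ V
    rw [← Subgroup.coe_mul, mul_inv_cancel]
    exact one_mem _)] with y hy
  have e1 : χ y = χ j := by
    have := h (y * j⁻¹) hy.1
    rwa [map_mul, map_inv, mul_inv_eq_one] at this
  have e2 : π ((y⁻¹ : J) : G) w = π ((j⁻¹ : J) : G) w := by
    have := h' _ (inv_mem hy.2)
    conv_rhs => rw [← this]
    rw [← Module.End.mul_apply, ← map_mul]
    congr 2
    push_cast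
    group
  rw [e1, e2]

/-- The projection of a linear functional to the functionals on which `J` acts through `χ`. -/
theorem exists_isEquivariant (hJ : IsCompact (J : Set G))
    (hχ : ∃ U : Subgroup G, IsOpen (U : Set G) ∧ ∀ j : J, (j : G) ∈ U → χ j = 1)
    (hπ : IsSmoothRep π) (ξ : Module.Dual ℂ W) :
    ∃ ξ' : Module.Dual ℂ W, IsEquivariant χ π ξ' ∧ ∀ (w : W) (s : Set J) (c : ℂ),
      IsOpen s → 1 ∈ s → c ≠ 0 →
      (∀ j ∈ s, (χ j : ℂ) * ξ (π (j⁻¹ : J) w) = c) →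
      (∀ j ∉ s, (χ j : ℂ) * ξ (π (j⁻¹ : J) w) = 0) → ξ' w ≠ 0 := by
  haveI : CompactSpace J := isCompact_iff_compactSpace.mp hJ
  letI : MeasurableSpace J := borel J
  haveI : BorelSpace J := ⟨rfl⟩
  set μ : Measure J := Measure.haar
  have hint : ∀ w, Integrable (fun j : J => (χ j : ℂ) * ξ (π (j⁻¹ : J) w)) μ := fun w =>
    (continuous_coefficient hχ hπ ξ w).integrable_of_hasCompactSupport
      (HasCompactSupport.of_compactSpace _)
  let ξ' : Module.Dual ℂ W :=
    { toFun := fun w => ∫ j : J, (χ j : ℂ) * ξ (π (j⁻¹ : J) w) ∂μ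
      map_add' := fun v w => by
        rw [← integral_add (hint v) (hint w)]
        simp only [map_add, mul_add]
      map_smul' := fun c w => by
        rw [RingHom.id_apply, smul_eq_mul, ← integral_const_mul]
        simp only [map_smul, smul_eq_mul, mul_left_comm] }
  refine ⟨ξ', fun j w => ?_, fun w s c hs h1 hc hin hout => ?_⟩
  · change ∫ i : J, (χ i : ℂ) * ξ (π (i⁻¹ : J) (π j w)) ∂μ =
      χ j * ∫ i : J, (χ i : ℂ) * ξ (π (i⁻¹ : J) w) ∂μ
    rw [← integral_mul_left_eq_self (μ := μ) _ j, ← integral_const_mul]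
    congr 1
    ext i
    rw [map_mul, Circle.coe_mul, mul_assoc, ← Module.End.mul_apply, ← map_mul]
    congr 5
    push_cast
    group
  · change ∫ j : J, (χ j : ℂ) * ξ (π (j⁻¹ : J) w) ∂μ ≠ 0
    have e : (fun j : J => (χ j : ℂ) * ξ (π (j⁻¹ : J) w)) = s.indicator fun _ => c := by
      ext j
      by_cases hj : j ∈ s
      · rw [Set.indicator_of_mem hj, hin j hj]
      · rw [Set.indicator_of_notMem hj, hout j hj]
    rw [e, integral_indicator_const c hs.measurableSet]
    refine smul_ne_zero ?_ hc
    rw [Measure.real, ENNReal.toReal_ne_zero]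
    exact ⟨(hs.measure_pos μ ⟨1, h1⟩).ne', measure_ne_top μ s⟩

/-- A nonzero vector on which `J` acts through `χ` is not killed by all functionals of the same
type. -/
theorem exists_isEquivariant_apply_ne_zero (hJ : IsCompact (J : Set G))
    (hχ : ∃ U : Subgroup G, IsOpen (U : Set G) ∧ ∀ j : J, (j : G) ∈ U → χ j = 1)
    (hπ : IsSmoothRep π) {w : W} (hw : w ≠ 0) (hw' : ∀ j : J, π j w = (χ j : ℂ) • w) :
    ∃ ξ : Module.Dual ℂ W, IsEquivariant χ π ξ ∧ ξ w ≠ 0 := by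
  obtain ⟨ξ, hξ⟩ : ∃ ξ : Module.Dual ℂ W, ξ w ≠ 0 := by
    by_contra h
    push Not at h
    exact hw ((Module.forall_dual_apply_eq_zero_iff ℂ w).mp h)
  obtain ⟨ξ', h1, h2⟩ := exists_isEquivariant hJ hχ hπ ξ
  refine ⟨ξ', h1, h2 w Set.univ (ξ w) isOpen_univ trivial hξ (fun j _ => ?_) fun j hj =>
    absurd trivial hj⟩
  rw [hw', map_smul, smul_eq_mul, ← mul_assoc, ← Circle.coe_mul, ← map_mul, mul_inv_cancel,
    map_one, Circle.coe_one, one_mul]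

/-- The translates `π(g)w` with `v g ≥ 0` of an eigenvector `w` of type `χ` survive in the
coinvariants of type `χ`: by the intertwining property the average of `j ↦ χ(j) ξ(π(g⁻¹j⁻¹g)w)`
only involves the `j` with `g⁻¹jg ∈ J`. -/
theorem Cover.exists_isEquivariant_apply_ne_zero {G' : Subgroup G} (C : Cover J χ G')
    (hJo : IsOpen (J : Set G)) (hJ : IsCompact (J : Set G))
    (hχ : ∃ U : Subgroup G, IsOpen (U : Set G) ∧ ∀ j : J, (j : G) ∈ U → χ j = 1)
    (hπ : IsSmoothRep π) {w : W} (hw : w ≠ 0) (hw' : ∀ j : J, π j w = (χ j : ℂ) • w) {g : G}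
    (hg : g ∈ G') (hv : 0 ≤ C.v g) :
    ∃ ξ : Module.Dual ℂ W, IsEquivariant χ π ξ ∧ ξ (π g w) ≠ 0 := by
  obtain ⟨ξ, hξ, hξw⟩ := HeckeTheory.exists_isEquivariant_apply_ne_zero hJ hχ hπ hw hw'
  obtain ⟨ξ', h1, h2⟩ := exists_isEquivariant (χ := χ) hJ hχ hπ (ξ ∘ₗ π g⁻¹)
  have hval : ∀ j : J, (ξ ∘ₗ π g⁻¹) (π (j⁻¹ : J) (π g w)) = ξ (π (g⁻¹ * (j : G)⁻¹ * g) w) := by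
    intro j
    rw [LinearMap.comp_apply, ← Module.End.mul_apply, ← Module.End.mul_apply, ← map_mul,
      ← map_mul]
    congr 3
  have hsupp : ∀ x, ξ (π x w) ≠ 0 → ∃ j₁ ∈ J, ∃ c ∈ G', ∃ j₂ ∈ J, x = j₁ * c * j₂ := by
    intro x hx
    refine C.intertwine x fun y y' hy => ?_
    have e1 : ξ (π (y * x) w) = χ y * ξ (π x w) := by
      rw [map_mul, Module.End.mul_apply, hξ]
    have e2 : ξ (π (y * x) w) = χ y' * ξ (π x w) := by
      have : (y * x : G) = x * y' := by rw [hy]; group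
      rw [this, map_mul, Module.End.mul_apply, hw', map_smul, map_smul, smul_eq_mul]
    exact Circle.ext (mul_right_cancel₀ hx (e2.symm.trans e1))
  refine ⟨ξ', h1, h2 _ {j | g⁻¹ * (j : G)⁻¹ * g ∈ J} (ξ w) ?_ ?_ hξw (fun j hj => ?_)
    fun j hj => ?_⟩
  · exact hJo.preimage ((continuous_const.mul continuous_subtype_val.inv).mul continuous_const)
  · change g⁻¹ * ((1 : J) : G)⁻¹ * g ∈ J
    simp
  · have e1 := C.χ_conj g hg j⁻¹ ⟨_, hj⟩ rfl
    have e2 : π (g⁻¹ * (j : G)⁻¹ * g) w = _ := hw' ⟨_, hj⟩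
    rw [hval, e2, e1, map_smul, smul_eq_mul, ← mul_assoc, ← Circle.coe_mul, ← map_mul,
      mul_inv_cancel, map_one, Circle.coe_one, one_mul]
  · rw [hval]
    by_contra hne
    obtain ⟨j₁, hj₁, c, hc, j₂, hj₂, e⟩ := hsupp _ (right_ne_zero_of_mul hne)
    exact hj (C.conj_mem_J hg hv (inv_mem j.2) hc hj₁ hj₂ e)

/-- A smooth representation with a nonzero vector of type `χ` has, for all sequences in
`{g ∈ G' | v g ≥ 0}`, a matrix coefficient that is not zero at infinitely many members. -/
theorem Cover.exists_coefficient_infinite {G' : Subgroup G} (C : Cover J χ G')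
    (hJo : IsOpen (J : Set G)) (hJ : IsCompact (J : Set G))
    (hχ : ∃ U : Subgroup G, IsOpen (U : Set G) ∧ ∀ j : J, (j : G) ∈ U → χ j = 1)
    (hπ : IsSmoothRep π) {w : W} (hw : w ≠ 0) (hw' : ∀ j : J, π j w = (χ j : ℂ) • w) {g : ℕ → G}
    (hg : ∀ k, g k ∈ G') (hv : ∀ k, 0 ≤ C.v (g k)) :
    ∃ ξ : Module.Dual ℂ W, IsSmoothFunctional π ξ ∧ {k | ξ (π (g k) w) ≠ 0}.Infinite := by
  set K : Submodule ℂ W := Submodule.span ℂ {x | ∃ (j : J) (w : W), x = π j w - (χ j : ℂ) • w}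
  have hK : ∀ ξ : Module.Dual ℂ W, IsEquivariant χ π ξ → K ≤ LinearMap.ker ξ := fun ξ hξ => by
    rw [Submodule.span_le]
    rintro _ ⟨j, w, rfl⟩
    change ξ (π j w - (χ j : ℂ) • w) = 0
    rw [map_sub, hξ, map_smul, smul_eq_mul, sub_self]
  obtain ⟨ξ, hξ⟩ := exists_dual_infinite (u := fun k => K.mkQ (π (g k) w)) fun k h0 => by
    obtain ⟨ξ, h1, h2⟩ := C.exists_isEquivariant_apply_ne_zero hJo hJ hχ hπ hw hw' (hg k) (hv k)
    rw [Submodule.mkQ_apply, Submodule.Quotient.mk_eq_zero] at h0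
    exact h2 (hK ξ h1 h0)
  refine ⟨ξ ∘ₗ K.mkQ, IsEquivariant.isSmoothFunctional hJo hχ fun j w => ?_, hξ⟩
  have h0 : K.mkQ (π j w - (χ j : ℂ) • w) = 0 := by
    rw [Submodule.mkQ_apply, Submodule.Quotient.mk_eq_zero]
    exact Submodule.subset_span ⟨j, w, rfl⟩
  rw [map_sub, sub_eq_zero] at h0
  rw [LinearMap.comp_apply, h0, map_smul, map_smul, smul_eq_mul]
  rfl

end

end HeckeTheory

namespace HeckeTheory

/-! ### Eigenvectors of compact groups -/

/-- Fourier inversion: if the characters `θ c` of `H` separate the classes modulo `N` in the sense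
of the orthogonality relations, then the space generated by a vector fixed by `N` contains an
eigenvector of `H` for one of them. -/
theorem exists_eigenvector_of_sum_eq_zero {G W Γ : Type*} [Group G] [AddCommGroup W] [Module ℂ W]
    (π : Representation ℂ G W) {N H : Subgroup G} (hfin : N.relIndex H ≠ 0) [Fintype Γ] [Nonempty Γ]
    (θ : Γ → H →* Circle) (hN : ∀ c, ∀ h : H, (h : G) ∈ N → θ c h = 1)
    (hsum : ∀ h : H, (h : G) ∉ N → ∑ c, (θ c h : ℂ) = 0) {w : W} (hw : w ≠ 0)
    (hwN : ∀ g ∈ N, π g w = w) :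
    ∃ c, ∃ w' ∈ Submodule.span ℂ (Set.range fun h : H => π h w), w' ≠ 0 ∧
      ∀ h : H, π h w' = (θ c h : ℂ) • w' := by
  classical
  haveI : (N.subgroupOf H).FiniteIndex := ⟨hfin⟩
  haveI : Finite (H ⧸ N.subgroupOf H) := Subgroup.finite_quotient_of_finiteIndex
  letI := Fintype.ofFinite (H ⧸ N.subgroupOf H)
  have hlift : ∀ c, ∀ a b : H, QuotientGroup.leftRel (N.subgroupOf H) a b →
      (θ c a⁻¹ : ℂ) • π a w = (θ c b⁻¹ : ℂ) • π b w := by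
    intro c a b hab
    rw [QuotientGroup.leftRel_apply] at hab
    have h1 := hN c (a⁻¹ * b) hab
    have h2 := hwN _ hab
    have e1 : b = a * (a⁻¹ * b) := by group
    have e2 : θ c b⁻¹ = θ c a⁻¹ := by
      rw [map_mul, map_inv, inv_mul_eq_one] at h1
      rw [map_inv, map_inv, h1]
    have e3 : π b w = π a w := by
      conv_lhs => rw [e1]
      rw [Subgroup.coe_mul, map_mul, Module.End.mul_apply]
      exact congrArg _ h2
    rw [e2, e3]
  let f : Γ → H ⧸ N.subgroupOf H → W := fun c =>
    Quotient.lift (fun h : H => (θ c h⁻¹ : ℂ) • π h w) (hlift c)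
  have hf : ∀ c (h : H), f c (QuotientGroup.mk h) = (θ c h⁻¹ : ℂ) • π h w := fun _ _ => rfl
  have htot : ∑ c, ∑ q, f c q = (Fintype.card Γ : ℂ) • w := by
    rw [Finset.sum_comm, Finset.sum_eq_single (QuotientGroup.mk 1)]
    · simp [hf, Nat.cast_smul_eq_nsmul]
    · intro q _ hq
      induction q using QuotientGroup.induction_on with
      | _ h =>
        simp only [hf]
        rw [← Finset.sum_smul, hsum h⁻¹, zero_smul]
        intro hh
        refine hq (QuotientGroup.eq.mpr ?_)
        rw [mul_one]
        exact hh
    · exact fun h => absurd (Finset.mem_univ _) h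
  obtain ⟨c, hc⟩ : ∃ c, ∑ q, f c q ≠ 0 := by
    by_contra h
    push Not at h
    rw [Finset.sum_eq_zero fun c _ => h c] at htot
    exact smul_ne_zero (Nat.cast_ne_zero.mpr Fintype.card_ne_zero) hw htot.symm
  refine ⟨c, _, Submodule.sum_mem _ fun q _ => ?_, hc, fun h => ?_⟩
  · induction q using QuotientGroup.induction_on with
    | _ h => exact Submodule.smul_mem _ _ (Submodule.subset_span ⟨h, rfl⟩)
  · rw [map_sum, Finset.smul_sum, ← Equiv.sum_comp (MulAction.toPerm h)
      fun q => (θ c h : ℂ) • f c q]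
    refine Finset.sum_congr rfl fun q _ => ?_
    induction q using QuotientGroup.induction_on with
    | _ x =>
      change π h (f c (QuotientGroup.mk x)) = (θ c h : ℂ) • f c (QuotientGroup.mk (h * x))
      rw [hf, hf, map_smul, smul_smul, Subgroup.coe_mul, map_mul, Module.End.mul_apply,
        _root_.mul_inv_rev, map_mul, Circle.coe_mul, mul_left_comm, ← Circle.coe_mul, ← map_mul,
        mul_inv_cancel, map_one, Circle.coe_one, mul_one]

end HeckeTheory

namespace UnramifiedQuadratic

variable {F₀ F : Type*} [Field F₀] [ValuativeRel F₀] [TopologicalSpace F₀]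
    [IsNonarchimedeanLocalField F₀] [Field F] [ValuativeRel F] [TopologicalSpace F]
    [IsNonarchimedeanLocalField F] [Algebra F₀ F] [ValuativeExtension F₀ F]
    {D : UnramifiedQuadratic F₀ F}

/-! ### The centre of `G` -/

/-- The centre of `G` is bounded: it commutes with a regular diagonal element and with `H`. -/
theorem mat_mem_filtration_of_mem_center {z : D.U22} (hz : z ∈ Subgroup.center D.U22) :
    D.mat z ∈ D.filtration 0 := by
  have h3 := D.piF_ne_zero
  let e : Fin 4 → ℤ := ![1, 2, -2, -1]
  have he : ∀ i, e i + e (Fin.rev i) = 0 := by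
    intro i; fin_cases i <;> simp [e, Fin.rev]
  have heinj : Function.Injective e := by
    intro i j; fin_cases i <;> fin_cases j <;> simp [e]
  set X : Matrix (Fin 4) (Fin 4) F := Matrix.diagonal fun i => D.piF ^ e i with hX
  have hadj : D.adj X = Matrix.diagonal fun i => D.piF ^ e (Fin.rev i) := by
    ext i j
    rw [adj_apply, hX, Matrix.diagonal_apply, Matrix.diagonal_apply]
    by_cases hij : i = j
    · subst hij
      simp [D.conj_piF]
    · rw [if_neg hij, if_neg fun h => hij (Fin.rev_injective h).symm, map_zero]
  obtain ⟨x, hx⟩ := D.exists_mat_eq (X := X) (by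
    rw [hadj, hX, Matrix.diagonal_mul_diagonal, ← Matrix.diagonal_one]
    congr 1
    ext i
    rw [← zpow_add₀ h3, he, zpow_zero])
  obtain ⟨y, hy⟩ := D.exists_mat_eq (X := gramMatrix F) (by
    have : D.adj (gramMatrix F) = gramMatrix F := by
      ext i j
      rw [adj_apply]
      fin_cases i <;> fin_cases j <;> simp [gramMatrix, Fin.rev]
    rw [this, gram_mul_gram])
  have hzx := congrArg D.mat (Subgroup.mem_center_iff.mp hz x)
  have hzy := congrArg D.mat (Subgroup.mem_center_iff.mp hz y)
  rw [mat_mul, mat_mul, hx] at hzx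
  rw [mat_mul, mat_mul, hy] at hzy
  have hoff : ∀ i j, i ≠ j → D.mat z i j = 0 := by
    intro i j hij
    have := congrFun (congrFun hzx i) j
    rw [hX, Matrix.diagonal_mul, Matrix.mul_diagonal, mul_comm] at this
    by_contra h0
    have h1 := congrArg (valuation F) (mul_left_cancel₀ h0 this)
    rw [map_zpow₀, map_zpow₀] at h1
    have h2 := D.val_zpow_le_iff.mp h1.le
    have h3 := D.val_zpow_le_iff.mp h1.ge
    exact hij (heinj (le_antisymm h3 h2))
  have hrev : ∀ i, D.mat z (Fin.rev i) (Fin.rev i) = D.mat z i i := by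
    intro i
    have := congrFun (congrFun hzy i) (Fin.rev i)
    simp only [Matrix.mul_apply, Fin.sum_univ_four] at this
    fin_cases i <;> simpa [gramMatrix, Fin.rev] using this
  have hone : ∀ i, valuation F (D.mat z i i) ≤ 1 := by
    intro i
    have := congrFun (congrFun (D.mat_mul_mat_inv z) i) i
    rw [Matrix.mul_apply, Finset.sum_eq_single i (fun j _ hj => by rw [hoff i j hj.symm, zero_mul])
      (fun h => absurd (Finset.mem_univ i) h), mat_inv, adj_apply, hrev, Matrix.one_apply_eq] at this
    have h1 := congrArg (valuation F) this
    rw [map_mul, D.conj_val, map_one] at h1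
    by_contra hlt
    rw [not_le] at hlt
    exact (one_lt_mul'' hlt hlt).ne' h1
  rw [mem_filtration_iff]
  intro i j
  by_cases hij : i = j
  · subst hij; simpa using hone i
  · simp [hoff i j hij]

namespace SplitStratum

variable (S : D.SplitStratum)

/-- No smooth representation with an eigenvector of `J` of type `Ψ` is supercuspidal. -/
theorem not_isSupercuspidal_of_eigenvector {W : Type*} [AddCommGroup W] [Module ℂ W]
    {π : Representation ℂ D.U22 W} {w : W} (hw : w ≠ 0)
    (hw' : ∀ j : S.J, π j w = (S.Psi j : ℂ) • w) : ¬ HeckeTheory.IsSupercuspidal π := by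
  rintro ⟨-, hπ, hc⟩
  obtain ⟨z, hz, -, h1⟩ := S.exists_mem_Gprime_shift_eq_one
  have hs : ∀ k : ℕ, S.shift (z ^ k) = k := fun k => by rw [S.shift_pow hz, h1, mul_one]
  obtain ⟨ξ, hξ, hinf⟩ := S.cover.exists_coefficient_infinite S.isOpen_J S.isCompact_J
    ⟨D.congruenceSubgroup (S.n + 1), D.isOpen_congruenceSubgroup _, fun j hj =>
      S.Ω_trace (D.val_trace_mul_lt (by omega) S.beta_mem hj.2)⟩ hπ hw hw' (g := fun k => z ^ k)
    (fun k => pow_mem hz k) (fun k => by change 0 ≤ S.shift _; rw [hs]; positivity)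
  obtain ⟨K, hK, hKc⟩ := hc w ξ hξ
  obtain ⟨r, hr⟩ := D.exists_forall_mem_filtration hK
  refine hinf ((Set.finite_Iic r).subset fun k hk => ?_)
  obtain ⟨x, hx, c, hcc, e⟩ := hKc _ hk
  have hm := D.filtration_mul (hr x hx) (mat_mem_filtration_of_mem_center hcc)
  rw [← mat_mul, add_zero] at hm
  change x * c = z ^ k at e
  rw [e] at hm
  have := S.shift_le_of_mem (pow_mem hz k) hm
  rw [hs] at this
  exact_mod_cast this

end SplitStratum

end UnramifiedQuadratic

namespace UnramifiedQuadratic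

variable {F₀ F : Type*} [Field F₀] [ValuativeRel F₀] [TopologicalSpace F₀]
    [IsNonarchimedeanLocalField F₀] [Field F] [ValuativeRel F] [TopologicalSpace F]
    [IsNonarchimedeanLocalField F] [Algebra F₀ F] [ValuativeExtension F₀ F]
    {D : UnramifiedQuadratic F₀ F}

/-! ### From the stratum to the character of `J` -/

namespace SplitStratum

variable (S : D.SplitStratum)

/-- The function `x ↦ Ω(tr_{A/F₀}(γ(x-1)))` for an arbitrary matrix `γ`. -/
def psiAt (γ : Matrix (Fin 4) (Fin 4) F) (x : D.U22) : Circle :=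
  S.Ω (Algebra.trace F₀ F (γ * (D.mat x - 1)).trace)

theorem psiAt_beta (x : D.U22) : S.psiAt S.beta x = S.psi x := rfl

theorem psiAt_add (γ δ : Matrix (Fin 4) (Fin 4) F) (x : D.U22) :
    S.psiAt (γ + δ) x = S.psiAt γ x * S.psiAt δ x := by
  rw [psiAt, add_mul, trace_add, map_add, AddChar.map_add_eq_mul]
  rfl

theorem psiAt_eq_one {k l : ℤ} (hkl : 1 ≤ k + l) {γ : Matrix (Fin 4) (Fin 4) F}
    (hγ : γ ∈ D.filtration k) {x : D.U22} (hx : D.mat x - 1 ∈ D.filtration l) :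
    S.psiAt γ x = 1 := S.Ω_trace (D.val_trace_mul_lt hkl hγ hx)

theorem psiAt_mul {k l : ℤ} (hkl : 1 ≤ k + (l + l)) {γ : Matrix (Fin 4) (Fin 4) F}
    (hγ : γ ∈ D.filtration k) {x y : D.U22} (hx : D.mat x - 1 ∈ D.filtration l)
    (hy : D.mat y - 1 ∈ D.filtration l) : S.psiAt γ (x * y) = S.psiAt γ x * S.psiAt γ y := by
  have : γ * (D.mat (x * y) - 1) = γ * (D.mat x - 1) + γ * (D.mat y - 1) +
      γ * ((D.mat x - 1) * (D.mat y - 1)) := by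
    rw [mat_mul]; noncomm_ring
  rw [psiAt, this, trace_add, trace_add, map_add (Algebra.trace F₀ F),
    map_add (Algebra.trace F₀ F), AddChar.map_add_eq_mul, AddChar.map_add_eq_mul,
    S.Ω_trace (D.val_trace_mul_lt hkl hγ (D.filtration_mul hx hy)), mul_one]
  rfl

theorem psiAt_conj (γ : Matrix (Fin 4) (Fin 4) F) (g x : D.U22) :
    S.psiAt γ (g⁻¹ * x * g) = S.psiAt (D.mat g * γ * D.mat g⁻¹) x := by
  have e := mat_conj_sub_one (D := D) g⁻¹ x
  rw [inv_inv] at e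
  rw [psiAt, psiAt, e, ← mul_assoc, trace_mul_comm]
  congr 3
  noncomm_ring

/-- Self-adjoint matrices define trivial characters: the elements of a congruence subgroup are skew
up to an error of the second order. -/
theorem psiAt_eq_one_of_adj_eq {k l : ℤ} (hkl : 1 ≤ k + (l + l)) {δ : Matrix (Fin 4) (Fin 4) F}
    (hδ : δ ∈ D.filtration k) (hadj : D.adj δ = δ) {x : D.U22}
    (hx : D.mat x - 1 ∈ D.filtration l) : S.psiAt δ x = 1 := by
  set Z := D.mat x - 1 with hZ
  have hZ' : D.adj Z = -Z - Z * D.adj Z := by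
    have h1 : D.mat x * D.adj (D.mat x) = 1 := x.2
    have h2 : D.mat x = 1 + Z := by rw [hZ]; abel
    rw [h2, adj_add, adj_one] at h1
    have h3 : D.adj Z = (1 + Z) * (1 + D.adj Z) - 1 - Z - Z * D.adj Z := by noncomm_ring
    rw [h1] at h3
    exact h3.trans (by rw [sub_self, zero_sub])
  have hε := D.val_trace_mul_lt hkl hδ (D.filtration_mul hx (D.adj_mem_filtration hx))
  rw [psiAt]
  apply S.Ω_eq_one
  rw [← val_lt_one_iff (F := F), D.trace_eq, ← trace_adj, adj_mul, hadj, trace_mul_comm (D.adj Z),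
    ← trace_add, ← mul_add, hZ', show Z + (-Z - Z * D.adj Z) = -(Z * D.adj Z) by abel, mul_neg,
    trace_neg, Valuation.map_neg]
  exact hε

/-- The characters `ψ_γ`, `γ ∈ 𝔞_{-n}`, separate the elements of `P_{Λ,m}` modulo `P_{Λ,n+1}`. -/
theorem exists_psiAt_ne_one {x : D.U22} (hx : x ∈ D.congruenceSubgroup S.m)
    (hx' : x ∉ D.congruenceSubgroup (S.n + 1)) : ∃ γ ∈ D.filtration (-S.n), S.psiAt γ x ≠ 1 := by
  by_contra h
  push Not at h
  refine hx' ⟨hx.1, ?_⟩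
  rw [show S.n + 1 = 1 - -S.n by ring]
  refine D.mem_filtration_of_trace fun Y hY => S.val_lt_one_of_Ω fun a ha => ?_
  have := h (a • Y) (D.smul_mem_filtration_of_le_one ha hY)
  rwa [psiAt, smul_mul_assoc, trace_smul, smul_eq_mul, trace_mul_comm] at this

/-- The character `ψ_γ` of `P_{Λ,m}` for `γ ∈ 𝔞_{-n}`. -/
def psiHom (γ : D.filtration (-S.n)) : D.congruenceSubgroup S.m →* Circle where
  toFun x := S.psiAt γ x
  map_one' := by simp [psiAt, mat_one]
  map_mul' x y := S.psiAt_mul (by unfold n; omega) γ.2 x.2.2 y.2.2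

/-- A representation containing the stratum contains, for some `γ ≡ β` modulo `𝔞_{1-n}`, the
character `ψ_γ` of `P_{Λ,m}`. -/
theorem exists_eigenvector_congruenceSubgroup {W : Type*} [AddCommGroup W] [Module ℂ W]
    {π : Representation ℂ D.U22 W} (h : S.Contains π) :
    ∃ γ ∈ D.filtration (-S.n), ∃ w : W, w ≠ 0 ∧
      (∀ x ∈ D.congruenceSubgroup S.m, π x w = (S.psiAt γ x : ℂ) • w) ∧
      ∀ x ∈ D.congruenceSubgroup S.n, S.psiAt γ x = S.psi x := by
  have hn := S.one_le_n
  have hm := S.m_pos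
  obtain ⟨w, hw, hwn⟩ := h
  haveI : CompactSpace (D.filtration (-S.n)) :=
    isCompact_iff_compactSpace.mp (D.isCompact_filtration _)
  let A := D.filtration (-S.n)
  let B : AddSubgroup A := (D.filtration (1 - S.m)).toAddSubgroup.comap A.subtype.toAddMonoidHom
  haveI : Finite (A ⧸ B) := AddSubgroup.quotient_finite_of_isOpen B
    ((D.isOpen_filtration _).preimage continuous_subtype_val)
  letI := Fintype.ofFinite (A ⧸ B)
  have hNn : ∀ g ∈ D.congruenceSubgroup (S.n + 1), π g w = w := fun g hg => by
    rw [hwn g (D.filtration_anti (by omega) hg.2), ← S.psiAt_beta,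
      S.psiAt_eq_one (by omega) S.beta_mem hg.2, Circle.coe_one, one_smul]
  obtain ⟨c, w', hspan, hw', hc⟩ := HeckeTheory.exists_eigenvector_of_sum_eq_zero π
    (N := D.congruenceSubgroup (S.n + 1)) (H := D.congruenceSubgroup S.m)
    (HeckeTheory.relIndex_ne_zero_of_isOpen (D.isOpen_congruenceSubgroup _)
      (D.isCompact_congruenceSubgroup _))
    (fun c : A ⧸ B => S.psiHom c.out) (fun c x hx => S.psiAt_eq_one (by omega) c.out.2 hx.2)
    (fun x hx => by
      obtain ⟨γ, hγ, hne⟩ := S.exists_psiAt_ne_one x.2 hx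
      let g : A →+ Additive Circle :=
        { toFun := fun γ => Additive.ofMul (S.psiAt γ x)
          map_zero' := by simp [psiAt]
          map_add' := fun γ δ => congrArg Additive.ofMul (S.psiAt_add γ δ x) }
      have hB : B ≤ g.ker := fun δ hδ =>
        congrArg Additive.ofMul (S.psiAt_eq_one (k := 1 - S.m) (by omega) hδ x.2.2)
      let Φ : Multiplicative (A ⧸ B) →* ℂ :=
        Circle.coeHom.comp (AddMonoidHom.toMultiplicativeLeft (QuotientAddGroup.lift B g hB))
      have hΦ : ∀ δ : A, Φ (Multiplicative.ofAdd (QuotientAddGroup.mk δ)) = S.psiAt δ x :=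
        fun δ => rfl
      have h0 : Φ ≠ 1 := fun h1 => hne (Circle.ext (by
        rw [← hΦ ⟨γ, hγ⟩, h1]; simp))
      have := sum_hom_units_eq_zero Φ h0
      rw [← this, ← Equiv.sum_comp (Multiplicative.ofAdd (α := A ⧸ B))]
      refine Finset.sum_congr rfl fun c _ => ?_
      conv_rhs => rw [← QuotientAddGroup.out_eq' c]
      rfl) hw hNn
  refine ⟨c.out, c.out.2, w', hw', fun x hx => hc ⟨x, hx⟩, fun x hx => ?_⟩
  -- `P_{Λ,n}` is central modulo `P_{Λ,n+1}`
  have hsub : ∀ u ∈ Submodule.span ℂ (Set.range fun h : D.congruenceSubgroup S.m => π h w),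
      π x u = (S.psi x : ℂ) • u := by
    intro u hu
    induction hu using Submodule.span_induction with
    | zero => simp
    | add a b _ _ ha hb => rw [map_add, ha, hb, smul_add]
    | smul r a _ ha => rw [map_smul, ha, smul_comm]
    | mem u hu =>
      obtain ⟨h, rfl⟩ := hu
      have hX : D.mat ((h : D.U22)⁻¹ * x * h) - 1 ∈ D.filtration S.n := by
        have e := mat_conj_sub_one (D := D) (h : D.U22)⁻¹ x
        rw [inv_inv] at e
        rw [e]
        simpa using D.filtration_mul (D.filtration_mul (inv_mem h.2).1 hx.2) h.2.1
      have hpsi : S.psi ((h : D.U22)⁻¹ * x * h) = S.psi x := by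
        rw [← S.psiAt_beta, S.psiAt_conj, ← S.psiAt_beta]
        have e1 : D.mat (h : D.U22) * S.beta * D.mat (h : D.U22)⁻¹ = S.beta +
            ((D.mat (h : D.U22) - 1) * S.beta - S.beta * (D.mat (h : D.U22) - 1)) *
              D.mat (h : D.U22)⁻¹ := by
          have e2 : D.mat (h : D.U22) * S.beta * D.mat (h : D.U22)⁻¹ =
              S.beta * (D.mat (h : D.U22) * D.mat (h : D.U22)⁻¹) +
                ((D.mat (h : D.U22) - 1) * S.beta - S.beta * (D.mat (h : D.U22) - 1)) *
                  D.mat (h : D.U22)⁻¹ := by noncomm_ring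
          rwa [D.mat_mul_mat_inv, mul_one] at e2
        rw [e1, psiAt_add]
        refine mul_eq_left.mpr (S.psiAt_eq_one (k := S.m - S.n) (by omega) ?_ hx.2)
        have m1 := D.filtration_mul h.2.2 S.beta_mem
        have m2 := D.filtration_mul S.beta_mem h.2.2
        rw [add_comm] at m2
        simpa [sub_eq_add_neg] using D.filtration_mul (sub_mem m1 m2) (inv_mem h.2).1
      change π x (π h w) = (S.psi x : ℂ) • π h w
      calc π x (π h w) = π h (π ((h : D.U22)⁻¹ * x * h) w) := by
            rw [← Module.End.mul_apply, ← Module.End.mul_apply, ← map_mul, ← map_mul]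
            congr 2
            group
        _ = _ := by rw [hwn _ hX, hpsi, map_smul]
  have h1 := hc ⟨x, D.congruenceSubgroup_anti (by unfold n; omega) hx⟩
  rw [hsub w' hspan] at h1
  exact (Circle.ext (smul_left_injective ℂ hw' h1)).symm

/-- A representation containing the stratum contains the character `Ψ` of `J`. -/
theorem exists_eigenvector_J {W : Type*} [AddCommGroup W] [Module ℂ W]
    {π : Representation ℂ D.U22 W} (h : S.Contains π) :
    ∃ w : W, w ≠ 0 ∧ ∀ j : S.J, π j w = (S.Psi j : ℂ) • w := by
  have hn := S.one_le_n
  have hm := S.m_pos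
  obtain ⟨γ₀, hγ₀, w, hw, h1, h2⟩ := S.exists_eigenvector_congruenceSubgroup h
  -- only the skew part of `γ₀` matters
  obtain ⟨γ, hγ, hskew, hγe⟩ : ∃ γ ∈ D.filtration (-S.n), D.adj γ = -γ ∧
      ∀ x ∈ D.congruenceSubgroup S.m, S.psiAt γ₀ x = S.psiAt γ x := by
    refine ⟨(2⁻¹ : F) • (γ₀ - D.adj γ₀),
      D.half_mem_filtration (sub_mem hγ₀ (D.adj_mem_filtration hγ₀)), ?_, fun x hx => ?_⟩
    · rw [adj_smul, D.conj_half, adj_sub, adj_adj, ← smul_neg, neg_sub]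
    · have e : γ₀ = (2⁻¹ : F) • (γ₀ - D.adj γ₀) + (2⁻¹ : F) • (γ₀ + D.adj γ₀) := by
        rw [← smul_add, sub_add_add_cancel, smul_add, D.half_add_half]
      conv_lhs => rw [e]
      rw [psiAt_add, S.psiAt_eq_one_of_adj_eq (k := -S.n) (l := S.m) (by unfold n; omega)
        (D.half_mem_filtration (add_mem hγ₀ (D.adj_mem_filtration hγ₀)))
        (by rw [adj_smul, D.conj_half, adj_add, adj_adj, add_comm]) hx.2, mul_one]
  have hΔs : D.adj (γ - S.beta) = -(γ - S.beta) := by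
    rw [adj_sub, hskew, S.adj_beta]; abel
  have hΔ : γ - S.beta ∈ D.filtration (1 - S.n) := by
    refine D.mem_filtration_of_trace fun X hX => S.val_trace_lt_of_skew hΔs (D.filtration S.n)
      (fun Y hY => D.adj_mem_filtration hY) (fun Y hY hYs => ?_) hX
    obtain ⟨c, -, Z, hZ, hc⟩ := D.exists_cayley_of_skew hn hY hYs
    have hcY : D.mat c - 1 ∈ D.filtration S.n := by
      rw [hc, show 1 + Y + Y * Z - 1 = Y + Y * Z by abel]
      exact add_mem hY (D.filtration_anti (by omega) (D.filtration_mul hY hZ))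
    have hcn : c ∈ D.congruenceSubgroup S.n :=
      (D.mem_congruenceSubgroup_of_nonneg (by omega)).mpr hcY
    have e1 : S.psiAt (γ - S.beta) c = 1 := by
      have := S.psiAt_add (γ - S.beta) S.beta c
      rwa [sub_add_cancel, ← hγe c (D.congruenceSubgroup_anti (by unfold n; omega) hcn), h2 c hcn,
        ← S.psiAt_beta, right_eq_mul] at this
    have hm' : γ - S.beta ∈ D.filtration (-S.n) := sub_mem hγ S.beta_mem
    rw [← S.Ω_cayley (by omega) hm' hY hZ, ← hc]
    exact e1
  have hproj := S.proj_mem_filtration hΔ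
  obtain ⟨j, hj, hjB, hjF⟩ := S.exists_conj_mem_B le_rfl (D.congruenceSubgroup 1)
    (D.isCompact_congruenceSubgroup 1) (fun c x _ hx Y hY hc => by
      rw [add_sub_cancel_left] at hx hY
      refine (D.mem_congruenceSubgroup_of_nonneg (by omega)).mpr ?_
      rw [hc, show 1 + x + x * Y - 1 = x + x * Y by abel]
      exact add_mem hx (D.filtration_anti (by omega) (D.filtration_mul hx hY)))
    hskew hproj (sub_mem hΔ hproj)
  refine ⟨π j w, fun h0 => hw ?_, fun x => ?_⟩
  · have := congrArg (π j⁻¹) h0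
    rwa [map_zero, ← Module.End.mul_apply, ← map_mul, inv_mul_cancel, map_one,
      Module.End.one_apply] at this
  · have hxm := S.J_le x.2
    have hcm : j⁻¹ * (x : D.U22) * j ∈ D.congruenceSubgroup S.m := by
      refine (D.mem_congruenceSubgroup_of_nonneg (by positivity)).mpr ?_
      have e := mat_conj_sub_one (D := D) j⁻¹ x
      rw [inv_inv] at e
      rw [e]
      simpa using D.filtration_mul (D.filtration_mul (inv_mem hj).1 hxm.2) hj.1
    have e1 : S.psiAt γ (j⁻¹ * (x : D.U22) * j) = S.psi x := by
      rw [S.psiAt_conj, ← sub_add_cancel (D.mat j * γ * D.mat j⁻¹) S.beta, psiAt_add,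
        S.psiAt_beta]
      refine mul_eq_right.mpr ?_
      -- the component of `x - 1` in `B^⊥` pairs trivially with `B`
      obtain ⟨Y, Z, hY, hYB, hZ, hZB, e⟩ := (S.mem_latJ_iff _).mp x.2
      rw [psiAt, ← e, mul_add, trace_add, trace_mul_comm _ Z, hZB _ hjB, add_zero]
      exact S.Ω_trace (D.val_trace_mul_lt (by omega) hjF hY)
    calc π x (π j w) = π j (π (j⁻¹ * (x : D.U22) * j) w) := by
          rw [← Module.End.mul_apply, ← Module.End.mul_apply, ← map_mul, ← map_mul]
          congr 2
          group
      _ = _ := by rw [h1 _ hcm, hγe _ hcm, e1, map_smul]; rfl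

end SplitStratum

end UnramifiedQuadratic

end

theorem theorem4p23 {F₀ F : Type*} [Field F₀] [ValuativeRel F₀] [TopologicalSpace F₀]
    [IsNonarchimedeanLocalField F₀] [Field F] [ValuativeRel F] [TopologicalSpace F]
    [IsNonarchimedeanLocalField F] [Algebra F₀ F] [ValuativeExtension F₀ F]
    (D : UnramifiedQuadratic F₀ F) (S : D.SplitStratum) :
    -- case (a): the characteristic polynomial
    S.charPoly = (Polynomial.X - Polynomial.C S.lam) ^ 2 *
      (Polynomial.X - Polynomial.C (D.conj S.lam)) ^ 2 ∧
    -- `G'` is abelian and not compact, and `G' = ⟨ζ⟩ B'`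
    (∀ x ∈ S.Gprime, ∀ y ∈ S.Gprime, x * y = y * x) ∧
    ¬ IsCompact (S.Gprime : Set D.U22) ∧
    (∃ z : D.U22, D.mat z = S.zeta ∧
      (S.Gprime : Set D.U22) = (Subgroup.zpowers z : Set D.U22) * S.Bzero) ∧
    -- the support-preserving `*`-isomorphism
    (∃ η : HeckeTheory.HeckeAlgebra S.Jprime S.PsiPrime ≃⋆ₐ[ℂ]
        HeckeTheory.HeckeAlgebra S.J S.Psi,
      ∀ f : HeckeTheory.HeckeAlgebra S.Jprime S.PsiPrime,
        Function.support (η f : D.U22 → ℂ) =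
          (S.J : Set D.U22) *
            (Subtype.val '' Function.support (f : S.Gprime → ℂ) : Set D.U22) *
            (S.J : Set D.U22)) ∧
    -- no representation containing the stratum is supercuspidal
    (∀ {W : Type*} [AddCommGroup W] [Module ℂ W] (π : Representation ℂ D.U22 W),
      π.IsIrreducible → HeckeTheory.IsSmoothRep π → S.Contains π →
        ¬ HeckeTheory.IsSupercuspidal π) := by
  obtain ⟨z, hz, hzeta, h1⟩ := S.exists_mem_Gprime_shift_eq_one
  refine ⟨S.charPoly_eq, fun x hx y hy => S.mul_comm_of_mem_Gprime hx hy, S.not_isCompact_Gprime,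
    ⟨z, hzeta, S.Gprime_eq hz h1⟩, S.exists_heckeAlgebra_equiv, ?_⟩
  intro W _ _ π _ _ hcont
  obtain ⟨w, hw, hw'⟩ := S.exists_eigenvector_J hcont
  exact S.not_isSupercuspidal_of_eigenvector hw hw'
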